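/- Let $M$ be a compact smooth manifold of dimension $n\ge 1$ with (possibly empty) boundary $\partial M$, equipped with a smooth Riemannian metric $\langle\cdot,\cdot\rangle$, with Laplace–Beltrami operator $\Delta=\operatorname{div}\nabla$ and, on $\partial M$, outward unit normal $\nu$. Let $\kappa\in\mathbb{R}$ and assume that $\mathrm{Ric}(v,v)\ge (n-1)\kappa\,\langle v,v\rangle$ for every tangent vector $v$ of $M$. Let $g:\mathbb{R}\to\mathbb{R}$ be continuous and put $G(t)=\int_0^t g(\sigma)\,d\sigma$. Let $u:M\to\mathbb{R}$ be non-negative, of class $C^1$ on $M$ (up to the boundary) and of class $C^3$ in the interior $M\setminus\partial M$, and suppose that $$-\Delta u=g(u)\ \text{ in } M\setminus\partial M,\qquad u=0\ \text{ on }\partial M .$$ Then $$\int_M g(u)\left(\frac{2(n-1)\,u\,g(u)}{n}-3G(u)-(n-1)\kappa u^2\right)\ \ge\ \int_{\partial M}\left(\frac{\partial u}{\partial\nu}\right)^3 ,$$ where the integrals are taken with respect to the Riemannian measures of $M$ and of $\partial M$ with the induced metric (counting measure on $\partial M$ if $n=1$). If $\partial M=\emptyset$, the right-hand side is $0$. 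-/

import Mathlib

open Set MeasureTheory
open scoped Manifold ContDiff

noncomputable section

namespace RiemannianGeom

/-! ### Tensor calculus in a coordinate domain

`S` is the coordinate domain (all of `ℝⁿ`, or a closed half-space), `γ` the matrix field `(γ_{ij})`
of a Riemannian metric on it. -/

section Coordinates

variable {n : ℕ}

/-- The partial derivative `∂_i f (y)`, one-sided at boundary points of `S`. -/
def partialD (S : Set (EuclideanSpace ℝ (Fin n))) (i : Fin n)
    (f : EuclideanSpace ℝ (Fin n) → ℝ) (y : EuclideanSpace ℝ (Fin n)) : ℝ :=
  fderivWithin ℝ f S y (EuclideanSpace.single i 1)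

/-- The Christoffel symbol
`Γ^k_{ij} = ½ ∑_l γ^{kl} (∂_i γ_{jl} + ∂_j γ_{il} - ∂_l γ_{ij})`. -/
def christoffel (S : Set (EuclideanSpace ℝ (Fin n)))
    (γ : EuclideanSpace ℝ (Fin n) → Matrix (Fin n) (Fin n) ℝ) (k i j : Fin n)
    (y : EuclideanSpace ℝ (Fin n)) : ℝ :=
  (1 / 2 : ℝ) * ∑ l, (γ y)⁻¹ k l *
    (partialD S i (fun z => γ z j l) y + partialD S j (fun z => γ z i l) y
      - partialD S l (fun z => γ z i j) y)

/-- The component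
`R_{ij} = ∑_k (∂_k Γ^k_{ij} - ∂_j Γ^k_{ik}) + ∑_{k,l} (Γ^k_{kl} Γ^l_{ij} - Γ^k_{jl} Γ^l_{ik})`
of the Ricci tensor. -/
def ricciCoord (S : Set (EuclideanSpace ℝ (Fin n)))
    (γ : EuclideanSpace ℝ (Fin n) → Matrix (Fin n) (Fin n) ℝ) (i j : Fin n)
    (y : EuclideanSpace ℝ (Fin n)) : ℝ :=
  ∑ k, (partialD S k (christoffel S γ k i j) y - partialD S j (christoffel S γ k i k) y)
    + ∑ k, ∑ l, (christoffel S γ k k l y * christoffel S γ l i j y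
        - christoffel S γ k j l y * christoffel S γ l i k y)

/-- The Laplace-Beltrami operator
`Δ f = (det γ)^{-1/2} ∑_{i,j} ∂_i ((det γ)^{1/2} γ^{ij} ∂_j f)`. -/
def laplaceCoord (S : Set (EuclideanSpace ℝ (Fin n)))
    (γ : EuclideanSpace ℝ (Fin n) → Matrix (Fin n) (Fin n) ℝ)
    (f : EuclideanSpace ℝ (Fin n) → ℝ) (y : EuclideanSpace ℝ (Fin n)) : ℝ :=
  (Real.sqrt (γ y).det)⁻¹ * ∑ i, ∑ j,
    partialD S i (fun z => Real.sqrt (γ z).det * (γ z)⁻¹ i j * partialD S j f z) y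

end Coordinates

/-! ### Riemannian manifolds, possibly with boundary -/

section Manifold

variable {n : ℕ} {H : Type*} [TopologicalSpace H]
  (I : ModelWithCorners ℝ (EuclideanSpace ℝ (Fin n)) H)
  {M : Type*} [TopologicalSpace M] [ChartedSpace H M]

/-- The coordinate vector field `∂_i` of the chart around `p`, at the point with coordinates `y`. -/
def coordVec (p : M) (i : Fin n) (y : EuclideanSpace ℝ (Fin n)) :
    TangentSpace I ((extChartAt I p).symm y) :=
  mfderivWithin 𝓘(ℝ, EuclideanSpace ℝ (Fin n)) I (extChartAt I p).symm (range I) y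
    (EuclideanSpace.single i 1 : EuclideanSpace ℝ (Fin n))

/-- The components of a tangent vector at `x` in the chart around `x`. -/
def coordsOf (x : M) (v : TangentSpace I x) : EuclideanSpace ℝ (Fin n) :=
  mfderiv I 𝓘(ℝ, EuclideanSpace ℝ (Fin n)) (extChartAt I x) x v

variable [IsManifold I ∞ M]
  (m : Bundle.ContMDiffRiemannianMetric I ∞ (EuclideanSpace ℝ (Fin n))
    (fun x : M => TangentSpace I x))

/-- The matrix `(γ_{ij})` of the metric `m` in the chart around `p`, as a function of the
coordinates. -/
def gram (p : M) (y : EuclideanSpace ℝ (Fin n)) : Matrix (Fin n) (Fin n) ℝ :=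
  Matrix.of fun i j =>
    m.inner ((extChartAt I p).symm y) (coordVec I p i y) (coordVec I p j y)

/-- The Ricci curvature `Ric(v, w)`, computed in the chart around `x`. -/
def ricci (x : M) (v w : TangentSpace I x) : ℝ :=
  ∑ i, ∑ j, ricciCoord (range I) (gram I m x) i j (extChartAt I x x)
    * coordsOf I x v i * coordsOf I x w j

/-- The Laplace-Beltrami operator of the metric `m`, computed in the chart around `x`. -/
def laplacian (u : M → ℝ) (x : M) : ℝ :=
  laplaceCoord (range I) (gram I m x) (fun y => u ((extChartAt I x).symm y)) (extChartAt I x x)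

/-- The Riemannian measure of the domain of the chart around `p`: the measure
`(det γ)^{1/2} dy` on the image of the chart, carried to `M`. -/
def chartVolume [MeasurableSpace M] (p : M) : Measure M :=
  (((volume : Measure (EuclideanSpace ℝ (Fin n))).restrict (extChartAt I p).target).withDensity
    (fun y => ENNReal.ofReal (Real.sqrt (gram I m p y).det))).map (extChartAt I p).symm

/-- The Riemannian measure on `M`. The measures `chartVolume I m p` agree on overlaps of chart
domains, so their least upper bound is the measure that restricts to each of them. -/
def riemVolume [MeasurableSpace M] : Measure M :=
  ⨆ p : M, chartVolume I m p

end Manifold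

/-! ### The boundary

The dimension is `d + 1`; the boundary of the model half-space is `{y | y 0 = 0}`, and the
half-space itself is `{y | 0 ≤ y 0}`. -/

section Boundary

variable {d : ℕ} {H : Type*} [TopologicalSpace H]
  (I : ModelWithCorners ℝ (EuclideanSpace ℝ (Fin (d + 1))) H)
  {M : Type*} [TopologicalSpace M] [ChartedSpace H M]

/-- The inclusion `z ↦ (0, z)` of `ℝᵈ` as the hyperplane `y 0 = 0`. -/
def hyperplaneIncl (z : Fin d → ℝ) : EuclideanSpace ℝ (Fin (d + 1)) :=
  WithLp.toLp 2 (Fin.cons 0 z)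

variable [IsManifold I ∞ M]
  (m : Bundle.ContMDiffRiemannianMetric I ∞ (EuclideanSpace ℝ (Fin (d + 1)))
    (fun x : M => TangentSpace I x))

/-- The Riemannian measure, for the induced metric `(γ_{ij})_{i,j ≥ 1}`, of the part of the
boundary that lies in the domain of the chart around `p`. -/
def chartArea [MeasurableSpace M] (p : M) : Measure M :=
  (((volume : Measure (Fin d → ℝ)).restrict
      {z | hyperplaneIncl z ∈ (extChartAt I p).target ∧
        (extChartAt I p).symm (hyperplaneIncl z) ∈ I.boundary M}).withDensity
    (fun z => ENNReal.ofReal (Real.sqrt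
      ((gram I m p (hyperplaneIncl z)).submatrix Fin.succ Fin.succ).det))).map
    (fun z => (extChartAt I p).symm (hyperplaneIncl z))

/-- The Riemannian measure of the boundary with the induced metric, as a measure on `M`
concentrated on the boundary (counting measure on the boundary if `M` is one-dimensional). -/
def boundaryArea [MeasurableSpace M] : Measure M :=
  ⨆ p : M, chartArea I m p

/-- The coordinates `ν^i = - γ^{0i} / (γ^{00})^{1/2}` of the outward unit normal at a boundary
point, in the chart around that point. The vector `ν` is orthogonal to `∂_1, …, ∂_d`, has length
one, and points out of the half-space. -/
def normalCoord (x : M) (i : Fin (d + 1)) : ℝ :=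
  - (gram I m x (extChartAt I x x))⁻¹ 0 i /
    Real.sqrt ((gram I m x (extChartAt I x x))⁻¹ 0 0)

/-- The outward normal derivative `∂u/∂ν = ∑_i ν^i ∂_i u` at a boundary point. -/
def normalDeriv (u : M → ℝ) (x : M) : ℝ :=
  ∑ i, normalCoord I m x i *
    partialD (range I) i (fun y => u ((extChartAt I x).symm y)) (extChartAt I x x)

end Boundary

end RiemannianGeom

end

open Set MeasureTheory
open scoped Manifold ContDiff

set_option linter.unusedSectionVars false

noncomputable section

namespace RiemannianGeom

/-! ### Partial derivatives on an open subset of the coordinate domain -/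

section PartialD

variable {n : ℕ} {S W : Set (EuclideanSpace ℝ (Fin n))} {y : EuclideanSpace ℝ (Fin n)}
  {f f' : EuclideanSpace ℝ (Fin n) → ℝ}

/-! Write `f = g(u) = -Δu`, `P = |∇u|²` and `c = (n-1)κ`. The formal argument is short. Bochner's
inequality gives `½ΔP ≥ f²/n - ⟨∇f,∇u⟩ + cP`. Multiplying by `u` and integrating by parts turns it
into `∫ ((1/n - 1) u f² + 3/2 f P + c u P) ≤ ½ ∫_∂M |∇u|³`, which is `integral_inequality`. Testing
`-Δu = f` with `u²` and with `G(u)`, which both vanish on `∂M`, gives `2∫ u P = ∫ u² f` and `∫ f P =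
∫ G(u) f`; these eliminate `P`. Since `u ≥ 0` vanishes on `∂M`, its gradient there is normal and
`∂u/∂ν = -|∇u|`, so the right-hand side is `-½ ∫ (∂u/∂ν)³`. Multiplying by `-2` concludes.

The difficulty is regularity: up to the boundary `P` is only continuous, so `u` cannot be tested
against `ΔP`. The multiplier `u` is replaced by `η(u)`, where `η' = χ` is a cutoff vanishing below
`ε`, so that everything involving second derivatives happens away from `∂M` (`green_interior`,
`integral_bochner_cutoff`). This leaves a term `½ ∫ χ'(u) P²`, which concentrates at the boundary as
`ε → 0`. It is controlled without the coarea formula: choose a smooth `ψ ≥ P`, bound `χ' P²` by `χ'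
P ψ`, and integrate by parts once more with test function `χ(u) ψ` (`integral_bochner_majorant`).
Now no derivative of `χ` is left and `ε → 0` by dominated convergence (`integral_majorant_le`). On
`{u = 0}` the cutoff does not tend to one, but there `∇u = 0`, and `Δu = 0` almost everywhere
(`ae_eq_zero_of_eq_zero`). Finally Green's formula with boundary term (`green`) converts the terms
in `ψ` into `∫_∂M ψ |∇u|`, and `ψ` is taken uniformly close to `P`.

The geometric tools are built from coordinates: Bochner's inequality (`IsMetricOn.bochner`),
independence of the chart (`gradInner_eq`, `laplacian_eq`), the volume and boundary measures as
glued chart measures (`riemVolume_restrict`, `boundaryArea_restrict`), and Green's formula from the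
divergence theorem on a box and a partition of unity. -/

theorem partialD_eq_fderiv (hS : S ∈ nhds y) (i : Fin n) :
    partialD S i f y = fderiv ℝ f y (EuclideanSpace.single i 1) := by
  rw [partialD, fderivWithin_of_mem_nhds hS]

theorem mem_nhds_of_isOpen_subset (hW : IsOpen W) (hWS : W ⊆ S) (hy : y ∈ W) : S ∈ nhds y :=
  Filter.mem_of_superset (hW.mem_nhds hy) hWS

theorem partialD_congr_of_eqOn (hW : IsOpen W) (h : EqOn f f' W) (hy : y ∈ W) (i : Fin n) :
    partialD S i f y = partialD S i f' y := by
  have h1 : f =ᶠ[nhds y] f' := Filter.mem_of_superset (hW.mem_nhds hy) h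
  rw [partialD, partialD, (h1.filter_mono nhdsWithin_le_nhds).fderivWithin_eq (h hy)]

theorem partialD_add (hS : S ∈ nhds y) (hf : DifferentiableAt ℝ f y)
    (hf' : DifferentiableAt ℝ f' y) (i : Fin n) :
    partialD S i (fun z => f z + f' z) y = partialD S i f y + partialD S i f' y := by
  simp only [partialD_eq_fderiv hS]
  rw [fderiv_fun_add hf hf']; rfl

theorem partialD_mul (hS : S ∈ nhds y) (hf : DifferentiableAt ℝ f y)
    (hf' : DifferentiableAt ℝ f' y) (i : Fin n) :
    partialD S i (fun z => f z * f' z) y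
      = partialD S i f y * f' y + f y * partialD S i f' y := by
  simp only [partialD_eq_fderiv hS]
  rw [fderiv_fun_mul hf hf']
  simp; ring

theorem partialD_const_mul (hS : S ∈ nhds y) (hf : DifferentiableAt ℝ f y) (c : ℝ) (i : Fin n) :
    partialD S i (fun z => c * f z) y = c * partialD S i f y := by
  simp only [partialD_eq_fderiv hS]
  rw [fderiv_const_mul hf]; rfl

theorem partialD_sum (hS : S ∈ nhds y) {ι : Type*} (s : Finset ι)
    {F : ι → EuclideanSpace ℝ (Fin n) → ℝ} (hF : ∀ k ∈ s, DifferentiableAt ℝ (F k) y) (i : Fin n) :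
    partialD S i (fun z => ∑ k ∈ s, F k z) y = ∑ k ∈ s, partialD S i (F k) y := by
  simp only [partialD_eq_fderiv hS]
  rw [fderiv_fun_sum hF]; simp

theorem contDiffOn_partialD (hW : IsOpen W) (hWS : W ⊆ S) {k l : WithTop ℕ∞}
    (hf : ContDiffOn ℝ l f W) (hkl : k + 1 ≤ l) (i : Fin n) :
    ContDiffOn ℝ k (partialD S i f) W := by
  have h1 : ContDiffOn ℝ k (fun z => fderiv ℝ f z (EuclideanSpace.single i 1)) W :=
    (hf.fderiv_of_isOpen hW hkl).clm_apply contDiffOn_const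
  exact h1.congr fun z hz => partialD_eq_fderiv (mem_nhds_of_isOpen_subset hW hWS hz) i

theorem partialD_comm (hW : IsOpen W) (hWS : W ⊆ S) (hf : ContDiffOn ℝ 2 f W) (hy : y ∈ W)
    (i j : Fin n) :
    partialD S i (partialD S j f) y = partialD S j (partialD S i f) y := by
  have hS := mem_nhds_of_isOpen_subset hW hWS hy
  have key : ∀ i j : Fin n, partialD S i (partialD S j f) y
      = fderiv ℝ (fderiv ℝ f) y (EuclideanSpace.single i 1) (EuclideanSpace.single j 1) := by
    intro i j
    rw [partialD_congr_of_eqOn (f' := fun z => fderiv ℝ f z (EuclideanSpace.single j 1)) hW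
      (fun z hz => partialD_eq_fderiv (mem_nhds_of_isOpen_subset hW hWS hz) j) hy,
      partialD_eq_fderiv hS, fderiv_clm_apply _ (by fun_prop)]
    · simp
    · exact ((hf.fderiv_of_isOpen (m := 1) hW (by norm_num)).differentiableOn
        (by norm_num)).differentiableAt (hW.mem_nhds hy)
  rw [key, key]
  exact ((hf.contDiffAt (hW.mem_nhds hy)).isSymmSndFDerivAt (by simp)) _ _

end PartialD

/-! ### Determinants and inverses of matrix fields -/

section MatrixField

variable {ι : Type*} [Fintype ι] [DecidableEq ι]
  {V : Type*} [NormedAddCommGroup V] [NormedSpace ℝ V] {k : WithTop ℕ∞} {s : Set V}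
  {γ : V → Matrix ι ι ℝ}

theorem contDiffOn_det (hγ : ∀ i j, ContDiffOn ℝ k (fun z => γ z i j) s) :
    ContDiffOn ℝ k (fun z => (γ z).det) s := by
  simp only [Matrix.det_apply']
  refine ContDiffOn.sum fun σ _ => ?_
  exact contDiffOn_const.mul (contDiffOn_prod fun i _ => hγ _ _)

theorem contDiffOn_inv_apply (hγ : ∀ i j, ContDiffOn ℝ k (fun z => γ z i j) s)
    (hdet : ∀ z ∈ s, (γ z).det ≠ 0) (i j : ι) :
    ContDiffOn ℝ k (fun z => (γ z)⁻¹ i j) s := by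
  simp only [Matrix.inv_def, Ring.inverse_eq_inv', Matrix.smul_apply, Matrix.adjugate_apply,
    smul_eq_mul]
  refine ((contDiffOn_det hγ).inv hdet).mul (contDiffOn_det fun a b => ?_)
  simp only [Matrix.updateRow_apply]
  split_ifs
  · exact contDiffOn_const
  · exact hγ a b

/-- Jacobi's formula. The determinant is multilinear in the rows, so its derivative replaces one row
at a time, and each resulting determinant is a Cramer determinant, that is, a row of the adjugate
applied to the new row. -/
theorem fderiv_det {z : V} (hγ : ∀ i j, DifferentiableAt ℝ (fun z => γ z i j) z)
    (hdet : (γ z).det ≠ 0) (v : V) :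
    fderiv ℝ (fun z => (γ z).det) z v
      = (γ z).det * ∑ i, ∑ j, (γ z)⁻¹ j i * fderiv ℝ (fun z => γ z i j) z v := by
  let D : ContinuousMultilinearMap ℝ (fun _ : ι => ι → ℝ) ℝ :=
    ⟨(Matrix.detRowAlternating (R := ℝ) (n := ι)).toMultilinearMap,
      (continuous_id.matrix_det : Continuous fun A : Matrix ι ι ℝ => A.det)⟩
  have h1 : HasFDerivAt (fun z => fun i j => γ z i j)
      (ContinuousLinearMap.pi fun i => ContinuousLinearMap.pi fun j =>
        fderiv ℝ (fun z => γ z i j) z) z :=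
    hasFDerivAt_pi.2 fun i => hasFDerivAt_pi.2 fun j => (hγ i j).hasFDerivAt
  have h2 := HasFDerivAt.comp z (D.hasFDerivAt (fun i j => γ z i j)) h1
  change fderiv ℝ (D ∘ fun z => fun i j => γ z i j) z v = _
  rw [h2.fderiv]
  simp only [ContinuousLinearMap.comp_apply, ContinuousMultilinearMap.linearDeriv_apply]
  rw [Finset.mul_sum]
  refine Finset.sum_congr rfl fun i _ => ?_
  change ((γ z).updateRow i fun j => fderiv ℝ (fun z => γ z i j) z v).det = _
  rw [← Matrix.cramer_transpose_apply, Matrix.cramer_eq_adjugate_mulVec,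
    ← Matrix.adjugate_transpose]
  simp only [Matrix.mulVec, dotProduct, Matrix.transpose_apply, Matrix.inv_def,
    Ring.inverse_eq_inv', Matrix.smul_apply, smul_eq_mul, Finset.mul_sum]
  refine Finset.sum_congr rfl fun j _ => ?_
  field_simp

/-- The trace of the square of a `γ`-self-adjoint endomorphism is nonnegative. -/
theorem trace_mul_self_nonneg {P A : Matrix ι ι ℝ} (hP : P.PosDef) (hA : (P * A).IsSymm) :
    0 ≤ (A * A).trace := by
  have hdet : IsUnit P.det := (Matrix.isUnit_iff_isUnit_det P).1 hP.isUnit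
  obtain ⟨m, v, hv⟩ := Matrix.posSemidef_iff_eq_sum_vecMulVec.1 hP.inv.posSemidef
  -- With `B = (PA) P⁻¹ (PA)`, which is positive semidefinite because `PA` is symmetric, `A² = P⁻¹
  -- B`. Writing `P⁻¹ = ∑ v_k v_kᵀ` makes the trace `∑ v_kᵀ B v_k`.
  have h1 : A * A = P⁻¹ * ((P * A) * P⁻¹ * (P * A)) := by
    rw [Matrix.mul_assoc (P * A), Matrix.nonsing_inv_mul_cancel_left _ _ hdet,
      ← Matrix.mul_assoc, Matrix.nonsing_inv_mul_cancel_left _ _ hdet]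
  have h2 : ((P * A) * P⁻¹ * (P * A)).PosSemidef := by
    have := hP.inv.posSemidef.conjTranspose_mul_mul_same (P * A)
    rwa [Matrix.conjTranspose_eq_transpose_of_trivial, hA] at this
  rw [h1]
  generalize (P * A) * P⁻¹ * (P * A) = B at h2
  rw [hv, Finset.sum_mul, Matrix.trace_sum]
  refine Finset.sum_nonneg fun k _ => ?_
  rw [Matrix.vecMulVec_mul, Matrix.trace_vecMulVec]
  have := h2.dotProduct_mulVec_nonneg (v k)
  rw [dotProduct_comm, ← Matrix.dotProduct_mulVec]
  simpa using this

/-- The nonnegativity of `tr(A²)` is applied to the trace-free part `A - (tr A / n) 1`, which is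
again self-adjoint for `P`. For the Hessian this yields `|Hess f|² ≥ (Δf)²/n`. -/
theorem sq_trace_le_card_mul_trace_mul_self {P A : Matrix ι ι ℝ} (hP : P.PosDef)
    (hA : (P * A).IsSymm) (hn : 0 < Fintype.card ι) :
    A.trace ^ 2 / (Fintype.card ι : ℝ) ≤ (A * A).trace := by
  have hn' : (0 : ℝ) < Fintype.card ι := by exact_mod_cast hn
  set t : ℝ := A.trace / Fintype.card ι with ht
  have hPs : P.IsSymm := by
    have := hP.isHermitian
    rwa [Matrix.IsHermitian, Matrix.conjTranspose_eq_transpose_of_trivial] at this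
  have h := trace_mul_self_nonneg (A := A - t • 1) hP (by
    rw [Matrix.IsSymm, Matrix.mul_sub, Matrix.transpose_sub, hA]
    simp [hPs.eq])
  have h2 : (A - t • 1) * (A - t • 1) = A * A - (2 * t) • A + (t ^ 2) • 1 := by
    rw [Matrix.sub_mul, Matrix.mul_sub, Matrix.mul_sub]
    simp only [Matrix.smul_mul, Matrix.mul_smul, Matrix.one_mul, Matrix.mul_one, smul_smul]
    rw [two_mul, add_smul, sq]; abel
  rw [h2, Matrix.trace_add, Matrix.trace_sub, Matrix.trace_smul, Matrix.trace_smul,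
    Matrix.trace_one] at h
  simp only [smul_eq_mul] at h
  have h3 : A.trace = t * Fintype.card ι := by rw [ht]; field_simp
  rw [h3] at h ⊢
  have : (t * (Fintype.card ι : ℝ)) ^ 2 / (Fintype.card ι : ℝ) = t ^ 2 * Fintype.card ι := by
    field_simp
  rw [this]; nlinarith

end MatrixField

/-! ### The Bochner inequality in coordinates -/

section Bochner

variable {n : ℕ}

theorem two_le_infty : (2 : WithTop ℕ∞) ≤ ∞ := WithTop.coe_le_coe.2 le_top

/-- `γ` is a smooth Riemannian metric on the coordinate set `W`. -/
structure IsMetricOn (W : Set (EuclideanSpace ℝ (Fin n)))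
    (γ : EuclideanSpace ℝ (Fin n) → Matrix (Fin n) (Fin n) ℝ) : Prop where
  smooth : ∀ i j, ContDiffOn ℝ ∞ (fun z => γ z i j) W
  posDef : ∀ z ∈ W, (γ z).PosDef

/-- The component `∑_j γ^{ij} ∂_j f` of the gradient. -/
def gradCoord (S : Set (EuclideanSpace ℝ (Fin n)))
    (γ : EuclideanSpace ℝ (Fin n) → Matrix (Fin n) (Fin n) ℝ)
    (f : EuclideanSpace ℝ (Fin n) → ℝ) (i : Fin n) (y : EuclideanSpace ℝ (Fin n)) : ℝ :=
  ∑ j, (γ y)⁻¹ i j * partialD S j f y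

/-- The inner product `∑_{i,j} γ^{ij} ∂_i a ∂_j b` of two gradients. -/
def gradInnerCoord (S : Set (EuclideanSpace ℝ (Fin n)))
    (γ : EuclideanSpace ℝ (Fin n) → Matrix (Fin n) (Fin n) ℝ)
    (a b : EuclideanSpace ℝ (Fin n) → ℝ) (y : EuclideanSpace ℝ (Fin n)) : ℝ :=
  ∑ i, partialD S i a y * gradCoord S γ b i y

variable {S W : Set (EuclideanSpace ℝ (Fin n))}
  {γ : EuclideanSpace ℝ (Fin n) → Matrix (Fin n) (Fin n) ℝ} {y : EuclideanSpace ℝ (Fin n)}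
  {f : EuclideanSpace ℝ (Fin n) → ℝ}

/-! ### Christoffel symbols, volume density and Laplacian of a coordinate metric. -/

namespace IsMetricOn

theorem mono {W' : Set (EuclideanSpace ℝ (Fin n))} (h : IsMetricOn W γ) (hW : W' ⊆ W) :
    IsMetricOn W' γ :=
  ⟨fun i j => (h.smooth i j).mono hW, fun z hz => h.posDef z (hW hz)⟩

theorem det_pos (h : IsMetricOn W γ) (hy : y ∈ W) : 0 < (γ y).det := (h.posDef y hy).det_pos

theorem isUnit_det (h : IsMetricOn W γ) (hy : y ∈ W) : IsUnit (γ y).det :=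
  isUnit_iff_ne_zero.2 (h.det_pos hy).ne'

theorem symm (h : IsMetricOn W γ) (hy : y ∈ W) (i j : Fin n) : γ y i j = γ y j i := by
  have := (h.posDef y hy).isHermitian.apply j i
  simpa using this

theorem inv_symm (h : IsMetricOn W γ) (hy : y ∈ W) (i j : Fin n) :
    (γ y)⁻¹ i j = (γ y)⁻¹ j i := by
  have := (h.posDef y hy).inv.isHermitian.apply j i
  simpa using this

theorem contDiffOn_inv (h : IsMetricOn W γ) (i j : Fin n) :
    ContDiffOn ℝ ∞ (fun z => (γ z)⁻¹ i j) W :=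
  contDiffOn_inv_apply h.smooth (fun _ hz => (h.det_pos hz).ne') i j

theorem contDiffOn_sqrt_det (h : IsMetricOn W γ) :
    ContDiffOn ℝ ∞ (fun z => Real.sqrt (γ z).det) W :=
  (contDiffOn_det h.smooth).sqrt fun _ hz => (h.det_pos hz).ne'

theorem sum_mul_inv (h : IsMetricOn W γ) (hy : y ∈ W) (l : Fin n) (v : Fin n → ℝ) :
    ∑ k, γ y l k * ∑ j, (γ y)⁻¹ k j * v j = v l := by
  have := congrFun (congrArg (fun M : Matrix (Fin n) (Fin n) ℝ => M.mulVec v)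
    (Matrix.mul_nonsing_inv _ (h.isUnit_det hy))) l
  simp only [← Matrix.mulVec_mulVec, Matrix.one_mulVec] at this
  exact this

theorem sum_inv_mul (h : IsMetricOn W γ) (hy : y ∈ W) (l : Fin n) (v : Fin n → ℝ) :
    ∑ k, (γ y)⁻¹ l k * ∑ j, γ y k j * v j = v l := by
  have := congrFun (congrArg (fun M : Matrix (Fin n) (Fin n) ℝ => M.mulVec v)
    (Matrix.nonsing_inv_mul _ (h.isUnit_det hy))) l
  simp only [← Matrix.mulVec_mulVec, Matrix.one_mulVec] at this
  exact this

variable (h : IsMetricOn W γ) (hW : IsOpen W) (hWS : W ⊆ S)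
include h

theorem sum_mul_gradCoord (hy : y ∈ W) (l : Fin n) :
    ∑ k, γ y l k * gradCoord S γ f k y = partialD S l f y :=
  h.sum_mul_inv hy l _

include hW hWS

theorem contDiffOn_partialD_metric (l i j : Fin n) :
    ContDiffOn ℝ ∞ (partialD S l (fun z => γ z i j)) W :=
  contDiffOn_partialD hW hWS (h.smooth i j) (by simp) l

theorem contDiffOn_christoffel (k i j : Fin n) : ContDiffOn ℝ ∞ (christoffel S γ k i j) W := by
  unfold christoffel
  refine contDiffOn_const.mul (ContDiffOn.sum fun l _ => (h.contDiffOn_inv k l).mul ?_)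
  exact ((h.contDiffOn_partialD_metric hW hWS i j l).add
    (h.contDiffOn_partialD_metric hW hWS j i l)).sub (h.contDiffOn_partialD_metric hW hWS l i j)

theorem contDiffOn_gradCoord {k l : WithTop ℕ∞} (hf : ContDiffOn ℝ l f W) (hkl : k + 1 ≤ l)
    (hk : k ≤ ∞) (i : Fin n) : ContDiffOn ℝ k (gradCoord S γ f i) W :=
  ContDiffOn.sum fun j _ => ((h.contDiffOn_inv i j).of_le hk).mul
    (contDiffOn_partialD hW hWS hf hkl j)

omit hWS in
theorem partialD_metric_symm (hy : y ∈ W) (l i j : Fin n) :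
    partialD S l (fun z => γ z i j) y = partialD S l (fun z => γ z j i) y :=
  partialD_congr_of_eqOn hW (fun _ hz => h.symm hz i j) hy l

omit hWS in
theorem christoffel_symm (hy : y ∈ W) (k i j : Fin n) :
    christoffel S γ k i j y = christoffel S γ k j i y := by
  unfold christoffel
  congr 1
  refine Finset.sum_congr rfl fun l _ => ?_
  rw [h.partialD_metric_symm hW hy l i j]; ring

omit hWS in
theorem partialD_christoffel_symm (hy : y ∈ W) (a k i j : Fin n) :
    partialD S a (christoffel S γ k i j) y = partialD S a (christoffel S γ k j i) y :=
  partialD_congr_of_eqOn hW (fun _ hz => h.christoffel_symm hW hz k i j) hy a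

omit hW hWS in
theorem sum_mul_christoffel (hy : y ∈ W) (l i j : Fin n) :
    ∑ k, γ y l k * christoffel S γ k i j y = (1 / 2 : ℝ) *
      (partialD S i (fun z => γ z j l) y + partialD S j (fun z => γ z i l) y
        - partialD S l (fun z => γ z i j) y) := by
  have := h.sum_mul_inv hy l fun l => (1 / 2 : ℝ) *
      (partialD S i (fun z => γ z j l) y + partialD S j (fun z => γ z i l) y
        - partialD S l (fun z => γ z i j) y)
  rw [← this]
  refine Finset.sum_congr rfl fun k _ => ?_
  unfold christoffel
  rw [Finset.mul_sum]
  congr 1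
  exact Finset.sum_congr rfl fun m _ => by ring

omit hWS in
-- Of the three terms of the Christoffel symbol, the first and the last cancel in the contraction,
-- since they differ by a swap of the indices of the symmetric `γ^{lm}`.
theorem sum_christoffel (hy : y ∈ W) (k : Fin n) :
    ∑ l, christoffel S γ l l k y
      = (1 / 2 : ℝ) * ∑ l, ∑ m, (γ y)⁻¹ l m * partialD S k (fun z => γ z l m) y := by
  unfold christoffel
  rw [← Finset.mul_sum]
  congr 1
  have h1 : ∑ l, ∑ m, (γ y)⁻¹ l m * partialD S l (fun z => γ z k m) y
      = ∑ l, ∑ m, (γ y)⁻¹ l m * partialD S m (fun z => γ z l k) y := by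
    rw [Finset.sum_comm]
    refine Finset.sum_congr rfl fun l _ => Finset.sum_congr rfl fun m _ => ?_
    rw [h.inv_symm hy, h.partialD_metric_symm hW hy m k l]
  simp only [mul_sub, mul_add, Finset.sum_add_distrib, Finset.sum_sub_distrib, h1]
  ring

omit hWS in
-- By Jacobi's formula `∂_k log √(det γ) = ½ γ^{lm} ∂_k γ_{lm}`, which is the contracted Christoffel
-- symbol.
theorem partialD_sqrt_det (hS : S ∈ nhds y) (hy : y ∈ W) (k : Fin n) :
    partialD S k (fun z => Real.sqrt (γ z).det) y
      = Real.sqrt (γ y).det * ∑ l, christoffel S γ l l k y := by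
  have hd : ∀ i j, DifferentiableAt ℝ (fun z => γ z i j) y := fun i j =>
    ((h.smooth i j).differentiableOn (by simp)).differentiableAt (hW.mem_nhds hy)
  have hdet : DifferentiableAt ℝ (fun z => (γ z).det) y :=
    ((contDiffOn_det h.smooth).differentiableOn (by simp)).differentiableAt (hW.mem_nhds hy)
  have hpos := h.det_pos hy
  rw [partialD_eq_fderiv hS, fderiv_sqrt hdet hpos.ne', h.sum_christoffel hW hy]
  simp only [smul_apply, smul_eq_mul]
  rw [fderiv_det hd hpos.ne']
  have h2 : ∑ i, ∑ j, (γ y)⁻¹ j i * fderiv ℝ (fun z => γ z i j) y (EuclideanSpace.single k 1)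
      = ∑ l, ∑ m, (γ y)⁻¹ l m * partialD S k (fun z => γ z l m) y := by
    refine Finset.sum_congr rfl fun l _ => Finset.sum_congr rfl fun m _ => ?_
    rw [h.inv_symm hy, partialD_eq_fderiv hS]
  rw [h2]
  have h3 : Real.sqrt (γ y).det ≠ 0 := (Real.sqrt_pos.2 hpos).ne'
  have h4 : (γ y).det = Real.sqrt (γ y).det * Real.sqrt (γ y).det :=
    (Real.mul_self_sqrt hpos.le).symm
  generalize Real.sqrt (γ y).det = t at *
  rw [h4]
  field_simp

/-- The Laplacian is the divergence of the gradient. -/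
theorem laplaceCoord_eq (hf : ContDiffOn ℝ 2 f W) (hy : y ∈ W) :
    laplaceCoord S γ f y = ∑ k, partialD S k (gradCoord S γ f k) y
      + ∑ k, (∑ l, christoffel S γ l l k y) * gradCoord S γ f k y := by
  have hS := mem_nhds_of_isOpen_subset hW hWS hy
  have hnhds := hW.mem_nhds hy
  have hs : DifferentiableAt ℝ (fun z => Real.sqrt (γ z).det) y :=
    (h.contDiffOn_sqrt_det.differentiableOn (by simp)).differentiableAt hnhds
  have hinv : ∀ i j, DifferentiableAt ℝ (fun z => (γ z)⁻¹ i j) y := fun i j =>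
    ((h.contDiffOn_inv i j).differentiableOn (by simp)).differentiableAt hnhds
  have hpd : ∀ j, DifferentiableAt ℝ (partialD S j f) y := fun j =>
    ((contDiffOn_partialD (k := 1) hW hWS hf (by norm_num) j).differentiableOn
      (by norm_num)).differentiableAt hnhds
  have hX : ∀ i, DifferentiableAt ℝ (gradCoord S γ f i) y := fun i =>
    ((h.contDiffOn_gradCoord (k := 1) hW hWS hf (by norm_num) (by exact_mod_cast le_top)
      i).differentiableOn (by norm_num)).differentiableAt hnhds
  have h1 : ∀ i, ∑ j, partialD S i
      (fun z => Real.sqrt (γ z).det * (γ z)⁻¹ i j * partialD S j f z) y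
      = Real.sqrt (γ y).det * ((∑ l, christoffel S γ l l i y) * gradCoord S γ f i y
        + partialD S i (gradCoord S γ f i) y) := by
    intro i
    rw [← partialD_sum hS]
    · have : (fun z => ∑ j, Real.sqrt (γ z).det * (γ z)⁻¹ i j * partialD S j f z)
          = fun z => Real.sqrt (γ z).det * gradCoord S γ f i z := by
        funext z
        rw [gradCoord, Finset.mul_sum]
        exact Finset.sum_congr rfl fun j _ => by ring
      rw [this, partialD_mul hS hs (hX i), h.partialD_sqrt_det hW hS hy]
      ring
    · exact fun j _ => (hs.mul (hinv i j)).mul (hpd j)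
  rw [laplaceCoord, Finset.sum_congr rfl fun i _ => h1 i, ← Finset.mul_sum, ← mul_assoc,
    inv_mul_cancel₀ (Real.sqrt_pos.2 (h.det_pos hy)).ne', one_mul, Finset.sum_add_distrib,
    add_comm]

/-- Regularity of the Laplacian. -/
theorem contDiffOn_laplaceCoord {k l : WithTop ℕ∞} (hf : ContDiffOn ℝ l f W) (hkl : k + 2 ≤ l)
    (hk : k + 1 ≤ ∞) : ContDiffOn ℝ k (laplaceCoord S γ f) W := by
  have hk' : k ≤ ∞ := le_trans (by simp) hk
  have hf2 : ContDiffOn ℝ 2 f W := hf.of_le (le_trans (by simp) hkl)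
  have hl : k + 1 + 1 ≤ l := by rw [add_assoc]; exact hkl
  have h1 : ContDiffOn ℝ k (fun y => ∑ k, partialD S k (gradCoord S γ f k) y
      + ∑ k, (∑ l, christoffel S γ l l k y) * gradCoord S γ f k y) W := by
    refine (ContDiffOn.sum fun j _ => ?_).add (ContDiffOn.sum fun j _ => ?_)
    · exact contDiffOn_partialD hW hWS (h.contDiffOn_gradCoord hW hWS hf hl hk j) le_rfl j
    · exact (ContDiffOn.sum fun i _ => (h.contDiffOn_christoffel hW hWS i i j).of_le hk').mul
        ((h.contDiffOn_gradCoord hW hWS hf hl hk j).of_le (by simp))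
  exact h1.congr fun z hz => h.laplaceCoord_eq hW hWS hf2 hz

theorem contDiffOn_gradInnerCoord {k l l' : WithTop ℕ∞} {f' : EuclideanSpace ℝ (Fin n) → ℝ}
    (hf : ContDiffOn ℝ l f W) (hf' : ContDiffOn ℝ l' f' W) (hkl : k + 1 ≤ l) (hkl' : k + 1 ≤ l')
    (hk : k ≤ ∞) : ContDiffOn ℝ k (gradInnerCoord S γ f f') W :=
  ContDiffOn.sum fun j _ => (contDiffOn_partialD hW hWS hf hkl j).mul
    (h.contDiffOn_gradCoord hW hWS hf' hkl' hk j)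

end IsMetricOn

/-- The component `(∇_i grad f)^k` of the Hessian endomorphism. -/
def hessCoord (S : Set (EuclideanSpace ℝ (Fin n)))
    (γ : EuclideanSpace ℝ (Fin n) → Matrix (Fin n) (Fin n) ℝ)
    (f : EuclideanSpace ℝ (Fin n) → ℝ) (k i : Fin n) (y : EuclideanSpace ℝ (Fin n)) : ℝ :=
  partialD S i (gradCoord S γ f k) y + ∑ l, christoffel S γ k i l y * gradCoord S γ f l y

/-! ### Symmetry of the Hessian and the gradient of the squared gradient length. -/

namespace IsMetricOn

variable (h : IsMetricOn W γ) (hW : IsOpen W) (hWS : W ⊆ S)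
include h hW hWS

/-- The Hessian with lowered index. -/
theorem sum_mul_hessCoord (hf : ContDiffOn ℝ 2 f W) (hy : y ∈ W) (l i : Fin n) :
    ∑ k, γ y l k * hessCoord S γ f k i y = partialD S i (partialD S l f) y
      - (1 / 2 : ℝ) * ∑ m, (partialD S i (fun z => γ z l m) y + partialD S l (fun z => γ z i m) y
        - partialD S m (fun z => γ z i l) y) * gradCoord S γ f m y := by
  have hS := mem_nhds_of_isOpen_subset hW hWS hy
  have hnhds := hW.mem_nhds hy
  have hγ : ∀ i j, DifferentiableAt ℝ (fun z => γ z i j) y := fun i j =>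
    ((h.smooth i j).differentiableOn (by simp)).differentiableAt hnhds
  have hX : ∀ i, DifferentiableAt ℝ (gradCoord S γ f i) y := fun i =>
    ((h.contDiffOn_gradCoord (k := 1) hW hWS hf (by norm_num) (by exact_mod_cast le_top)
      i).differentiableOn (by norm_num)).differentiableAt hnhds
  -- Differentiating the relation `∂_l f = ∑ γ_{lk} X^k`, with `X` the gradient, avoids any
  -- derivative of the inverse matrix.
  have h1 : partialD S i (partialD S l f) y
      = ∑ k, (partialD S i (fun z => γ z l k) y * gradCoord S γ f k y
        + γ y l k * partialD S i (gradCoord S γ f k) y) := by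
    rw [partialD_congr_of_eqOn (f' := fun z => ∑ k, γ z l k * gradCoord S γ f k z) hW
      (fun z hz => (h.sum_mul_gradCoord hz l).symm) hy, partialD_sum hS]
    · exact Finset.sum_congr rfl fun k _ => partialD_mul hS (hγ l k) (hX k) i
    · exact fun k _ => (hγ l k).mul (hX k)
  have h2 : ∑ k, γ y l k * ∑ m, christoffel S γ k i m y * gradCoord S γ f m y
      = ∑ m, ((1 / 2 : ℝ) * (partialD S i (fun z => γ z m l) y + partialD S m (fun z => γ z i l) y
        - partialD S l (fun z => γ z i m) y)) * gradCoord S γ f m y := by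
    simp only [← h.sum_mul_christoffel hy, Finset.mul_sum, Finset.sum_mul]
    rw [Finset.sum_comm]
    exact Finset.sum_congr rfl fun m _ => Finset.sum_congr rfl fun k _ => by ring
  simp only [hessCoord, mul_add, Finset.sum_add_distrib]
  rw [h2, h1, Finset.sum_add_distrib, Finset.mul_sum]
  have h3 : ∑ m, ((1 / 2 : ℝ) * (partialD S i (fun z => γ z m l) y
        + partialD S m (fun z => γ z i l) y
        - partialD S l (fun z => γ z i m) y)) * gradCoord S γ f m y
      = ∑ m, partialD S i (fun z => γ z l m) y * gradCoord S γ f m y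
        - ∑ m, (1 / 2 : ℝ) * ((partialD S i (fun z => γ z l m) y
          + partialD S l (fun z => γ z i m) y
          - partialD S m (fun z => γ z i l) y) * gradCoord S γ f m y) := by
    rw [← Finset.sum_sub_distrib]
    refine Finset.sum_congr rfl fun m _ => ?_
    rw [h.partialD_metric_symm hW hy i m l]; ring
  rw [h3]; ring

/-- With the index lowered, the second derivatives commute and the first-order terms are visibly
symmetric. This is the self-adjointness required by the trace inequality. -/
theorem hessCoord_isSymm (hf : ContDiffOn ℝ 2 f W) (hy : y ∈ W) :
    (γ y * Matrix.of fun k i => hessCoord S γ f k i y).IsSymm := by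
  refine Matrix.IsSymm.ext fun l i => ?_
  simp only [Matrix.mul_apply, Matrix.of_apply]
  rw [h.sum_mul_hessCoord hW hWS hf hy, h.sum_mul_hessCoord hW hWS hf hy,
    partialD_comm hW hWS hf hy]
  congr 2
  refine Finset.sum_congr rfl fun m _ => ?_
  rw [partialD_congr_of_eqOn (S := S) hW (fun z hz => h.symm hz l i) hy m]; ring

/-- The gradient of `|∇f|²` is twice the Hessian applied to the gradient. -/
theorem gradCoord_gradInnerCoord_self (hf : ContDiffOn ℝ 2 f W) (hy : y ∈ W) (k : Fin n) :
    gradCoord S γ (gradInnerCoord S γ f f) k y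
      = 2 * ∑ i, hessCoord S γ f k i y * gradCoord S γ f i y := by
  have hS := mem_nhds_of_isOpen_subset hW hWS hy
  have hnhds := hW.mem_nhds hy
  have hγ : ∀ i j, DifferentiableAt ℝ (fun z => γ z i j) y := fun i j =>
    ((h.smooth i j).differentiableOn (by simp)).differentiableAt hnhds
  have hpd : ∀ j, DifferentiableAt ℝ (partialD S j f) y := fun j =>
    ((contDiffOn_partialD (k := 1) hW hWS hf (by norm_num) j).differentiableOn
      (by norm_num)).differentiableAt hnhds
  have hX : ∀ i, DifferentiableAt ℝ (gradCoord S γ f i) y := fun i =>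
    ((h.contDiffOn_gradCoord (k := 1) hW hWS hf (by norm_num) (by exact_mod_cast le_top)
      i).differentiableOn (by norm_num)).differentiableAt hnhds
  have h1 : ∀ l, partialD S l (gradInnerCoord S γ f f) y
      = 2 * ∑ i, (∑ j, γ y l j * hessCoord S γ f j i y) * gradCoord S γ f i y := by
    intro l
    have hA : partialD S l (gradInnerCoord S γ f f) y
        = ∑ i, (partialD S l (partialD S i f) y * gradCoord S γ f i y
          + partialD S i f y * partialD S l (gradCoord S γ f i) y) := by
      unfold gradInnerCoord
      rw [partialD_sum hS]
      · exact Finset.sum_congr rfl fun i _ => partialD_mul hS (hpd i) (hX i) l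
      · exact fun i _ => (hpd i).mul (hX i)
    have hB : ∑ i, partialD S i f y * partialD S l (gradCoord S γ f i) y
        = ∑ i, partialD S l (partialD S i f) y * gradCoord S γ f i y
          - ∑ i, ∑ j, partialD S l (fun z => γ z i j) y * gradCoord S γ f j y
            * gradCoord S γ f i y := by
      have hC : ∀ i, partialD S l (partialD S i f) y
          = ∑ j, (partialD S l (fun z => γ z i j) y * gradCoord S γ f j y
            + γ y i j * partialD S l (gradCoord S γ f j) y) := by
        intro i
        rw [partialD_congr_of_eqOn (f' := fun z => ∑ k, γ z i k * gradCoord S γ f k z) hW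
          (fun z hz => (h.sum_mul_gradCoord hz i).symm) hy, partialD_sum hS]
        · exact Finset.sum_congr rfl fun k _ => partialD_mul hS (hγ i k) (hX k) l
        · exact fun k _ => (hγ i k).mul (hX k)
      simp only [hC, Finset.sum_add_distrib, add_mul, Finset.sum_mul, add_sub_cancel_left]
      simp only [← h.sum_mul_gradCoord (S := S) (f := f) hy, Finset.sum_mul]
      rw [Finset.sum_comm]
      refine Finset.sum_congr rfl fun i _ => Finset.sum_congr rfl fun j _ => ?_
      rw [h.symm hy j i]; ring
    rw [hA, Finset.sum_add_distrib, hB]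
    simp only [h.sum_mul_hessCoord hW hWS hf hy]
    -- These two sums come from the first-order part of the Hessian; contracted with the symmetric
    -- `X^i X^m` they coincide and cancel.
    have hD : ∑ i, ∑ m, partialD S i (fun z => γ z l m) y * gradCoord S γ f m y
          * gradCoord S γ f i y
        = ∑ i, ∑ m, partialD S m (fun z => γ z i l) y * gradCoord S γ f m y
          * gradCoord S γ f i y := by
      rw [Finset.sum_comm]
      refine Finset.sum_congr rfl fun i _ => Finset.sum_congr rfl fun m _ => ?_
      rw [h.partialD_metric_symm hW hy m l i]; ring
    have hE : ∑ i, (partialD S i (partialD S l f) y - (1 / 2 : ℝ) * ∑ m,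
          (partialD S i (fun z => γ z l m) y + partialD S l (fun z => γ z i m) y
            - partialD S m (fun z => γ z i l) y) * gradCoord S γ f m y) * gradCoord S γ f i y
        = ∑ i, partialD S l (partialD S i f) y * gradCoord S γ f i y
          - (1 / 2 : ℝ) * ((∑ i, ∑ m, partialD S i (fun z => γ z l m) y * gradCoord S γ f m y
            * gradCoord S γ f i y + ∑ i, ∑ m, partialD S l (fun z => γ z i m) y
              * gradCoord S γ f m y * gradCoord S γ f i y)
            - ∑ i, ∑ m, partialD S m (fun z => γ z i l) y * gradCoord S γ f m y
              * gradCoord S γ f i y) := by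
      rw [← Finset.sum_add_distrib, ← Finset.sum_sub_distrib, Finset.mul_sum,
        ← Finset.sum_sub_distrib]
      refine Finset.sum_congr rfl fun i _ => ?_
      rw [partialD_comm hW hWS hf hy i l, ← Finset.sum_add_distrib, ← Finset.sum_sub_distrib,
        sub_mul, mul_assoc, Finset.sum_mul]
      congr 2
      exact Finset.sum_congr rfl fun m _ => by ring
    rw [hE, hD]; ring
  rw [gradCoord]
  simp only [h1]
  have h2 := h.sum_inv_mul hy k fun j => ∑ i, hessCoord S γ f j i y * gradCoord S γ f i y
  rw [← h2, Finset.mul_sum]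
  refine Finset.sum_congr rfl fun l _ => ?_
  rw [mul_left_comm]
  congr 2
  simp only [Finset.sum_mul, Finset.mul_sum]
  rw [Finset.sum_comm]
  exact Finset.sum_congr rfl fun m _ => Finset.sum_congr rfl fun k _ => by ring

end IsMetricOn

/-- The algebraic identity behind the Bochner formula: `X` is a vector, `dX i k = ∂_i X^k`,
`C i k = ∂_k ∂_i X^k`, and `dΓ a k i j = ∂_a Γ^k_{ij}`. -/
theorem bochner_algebra (X : Fin n → ℝ) (dX C : Fin n → Fin n → ℝ) (Γ : Fin n → Fin n → Fin n → ℝ)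
    (dΓ : Fin n → Fin n → Fin n → Fin n → ℝ) (hΓ : ∀ k i j, Γ k i j = Γ k j i)
    (hdΓ : ∀ a k i j, dΓ a k i j = dΓ a k j i) :
    (∑ k, ∑ i, ((C i k + ∑ l, (dΓ k k i l * X l + Γ k i l * dX k l)) * X i
        + (dX i k + ∑ l, Γ k i l * X l) * dX k i)
      + ∑ k, (∑ l, Γ l l k) * ∑ i, (dX i k + ∑ l, Γ k i l * X l) * X i)
    = ∑ k, ∑ i, (dX i k + ∑ l, Γ k i l * X l) * (dX k i + ∑ l, Γ i k l * X l)
      + ∑ i, X i * (∑ k, C i k + ∑ k, ((∑ l, dΓ i l l k) * X k + (∑ l, Γ l l k) * dX i k))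
      + ∑ i, ∑ j, (∑ k, (dΓ k k i j - dΓ j k i k)
          + ∑ k, ∑ l, (Γ k k l * Γ l i j - Γ k j l * Γ l i k)) * X i * X j := by
  -- Terms are matched by type: `e1` second derivatives of `X`; `e2`, `e4` derivatives of `Γ`; `e3`,
  -- `e5` products `Γ · dX · X`; `e6`, `e7` quadratic in `Γ`. The derivative and quadratic terms in
  -- `Γ` left over assemble into the Ricci tensor.
  have e1 : ∑ k, ∑ i, C i k * X i = ∑ i, X i * ∑ k, C i k := by
    rw [Finset.sum_comm]
    exact Finset.sum_congr rfl fun i _ => by rw [Finset.mul_sum]; simp only [mul_comm]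
  have e2 : ∑ k, ∑ i, (∑ l, dΓ k k i l * X l) * X i
      = ∑ i, ∑ j, (∑ k, dΓ k k i j) * X i * X j := by
    rw [Finset.sum_comm]
    simp only [Finset.sum_mul]
    refine Finset.sum_congr rfl fun i _ => ?_
    rw [Finset.sum_comm]
    exact Finset.sum_congr rfl fun j _ => Finset.sum_congr rfl fun k _ => by ring
  have e3 : ∑ k, ∑ i, (∑ l, Γ k i l * dX k l) * X i
      = ∑ k, ∑ i, dX i k * ∑ l, Γ i k l * X l := by
    simp only [Finset.sum_mul, Finset.mul_sum]
    rw [Finset.sum_comm]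
    rw [Finset.sum_congr rfl fun i _ => Finset.sum_comm]
    rw [Finset.sum_comm]
    refine Finset.sum_congr rfl fun k _ => ?_
    rw [Finset.sum_comm]
    refine Finset.sum_congr rfl fun i _ => Finset.sum_congr rfl fun l _ => ?_
    rw [hΓ i l k]; ring
  have e4 : ∑ i, X i * ∑ k, (∑ l, dΓ i l l k) * X k
      = ∑ i, ∑ j, (∑ k, dΓ j k i k) * X i * X j := by
    simp only [Finset.mul_sum]
    rw [Finset.sum_comm]
    refine Finset.sum_congr rfl fun i _ => Finset.sum_congr rfl fun j _ => ?_
    rw [Finset.sum_congr rfl fun k _ => hdΓ j k k i]; ring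
  have e5 : ∑ k, (∑ l, Γ l l k) * ∑ i, dX i k * X i
      = ∑ i, X i * ∑ k, (∑ l, Γ l l k) * dX i k := by
    simp only [Finset.mul_sum]
    rw [Finset.sum_comm]
    exact Finset.sum_congr rfl fun i _ => Finset.sum_congr rfl fun j _ => by ring
  have e6 : ∑ k, (∑ l, Γ l l k) * ∑ i, (∑ l, Γ k i l * X l) * X i
      = ∑ i, ∑ j, (∑ k, ∑ l, Γ k k l * Γ l i j) * X i * X j := by
    have : ∀ i j, ∑ k, ∑ l, Γ k k l * Γ l i j = ∑ l, (∑ k, Γ k k l) * Γ l i j := by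
      intro i j
      rw [Finset.sum_comm]
      simp only [Finset.sum_mul]
    simp only [this]
    obtain ⟨t, ht⟩ : ∃ t : Fin n → ℝ, ∀ k, ∑ l, Γ l l k = t k := ⟨_, fun _ => rfl⟩
    simp only [ht]
    simp only [Finset.sum_mul, Finset.mul_sum]
    rw [Finset.sum_comm]
    refine Finset.sum_congr rfl fun i _ => ?_
    rw [Finset.sum_comm]
    refine Finset.sum_congr rfl fun j _ => ?_
    exact Finset.sum_congr rfl fun k _ => by ring
  have e7 : ∑ k, ∑ i, (∑ l, Γ k i l * X l) * ∑ l, Γ i k l * X l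
      = ∑ i, ∑ j, (∑ k, ∑ l, Γ k j l * Γ l i k) * X i * X j := by
    have a1 : ∑ k, ∑ i, (∑ l, Γ k i l * X l) * ∑ l, Γ i k l * X l
        = ∑ k, ∑ l, ∑ i, ∑ j, Γ k j l * Γ l i k * X i * X j := by
      refine Finset.sum_congr rfl fun k _ => Finset.sum_congr rfl fun l _ => ?_
      rw [mul_comm, Finset.sum_mul]
      refine Finset.sum_congr rfl fun i _ => ?_
      rw [Finset.mul_sum]
      refine Finset.sum_congr rfl fun j _ => ?_
      rw [hΓ k l j, hΓ l k i]; ring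
    rw [a1]
    simp only [Finset.sum_mul]
    rw [Finset.sum_congr rfl fun k _ => Finset.sum_comm]
    rw [Finset.sum_comm]
    refine Finset.sum_congr rfl fun i _ => ?_
    rw [Finset.sum_congr rfl fun k _ => Finset.sum_comm]
    rw [Finset.sum_comm]
  simp only [add_mul, mul_add, sub_mul, Finset.sum_add_distrib, Finset.sum_sub_distrib]
  rw [e1, e2, e3, e4, e5, e6, e7]
  ring

/-- The **Bochner inequality** in coordinates. -/
theorem IsMetricOn.bochner (h : IsMetricOn W γ) (hW : IsOpen W) (hWS : W ⊆ S)
    (hf : ContDiffOn ℝ 3 f W) (hy : y ∈ W) (hn : 0 < n) :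
    laplaceCoord S γ f y ^ 2 / n + gradInnerCoord S γ (laplaceCoord S γ f) f y
        + ∑ i, ∑ j, ricciCoord S γ i j y * gradCoord S γ f i y * gradCoord S γ f j y
      ≤ (1 / 2 : ℝ) * laplaceCoord S γ (gradInnerCoord S γ f f) y := by
  have hS := mem_nhds_of_isOpen_subset hW hWS hy
  have hnhds := hW.mem_nhds hy
  have hf2 : ContDiffOn ℝ 2 f W := hf.of_le (by norm_num)
  have hXc : ∀ i, ContDiffOn ℝ 2 (gradCoord S γ f i) W := fun i =>
    h.contDiffOn_gradCoord (k := 2) hW hWS hf (by norm_num) two_le_infty i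
  have hX : ∀ i, DifferentiableAt ℝ (gradCoord S γ f i) y := fun i =>
    ((hXc i).differentiableOn (by norm_num)).differentiableAt hnhds
  have hΓ : ∀ k i j, DifferentiableAt ℝ (christoffel S γ k i j) y := fun k i j =>
    ((h.contDiffOn_christoffel hW hWS k i j).differentiableOn (by simp)).differentiableAt hnhds
  have hdX : ∀ i k, DifferentiableAt ℝ (partialD S i (gradCoord S γ f k)) y := fun i k =>
    ((contDiffOn_partialD (k := 1) hW hWS (hXc k) (by norm_num) i).differentiableOn
      (by norm_num)).differentiableAt hnhds
  have hAd : ∀ k i, DifferentiableAt ℝ (hessCoord S γ f k i) y := fun k i =>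
    (hdX i k).add (DifferentiableAt.fun_sum fun l _ => (hΓ k i l).fun_mul (hX l))
  have hdA : ∀ k i, partialD S k (hessCoord S γ f k i) y
      = partialD S k (partialD S i (gradCoord S γ f k)) y
        + ∑ l, (partialD S k (christoffel S γ k i l) y * gradCoord S γ f l y
          + christoffel S γ k i l y * partialD S k (gradCoord S γ f l) y) := by
    intro k i
    unfold hessCoord
    rw [partialD_add hS (hdX i k) (DifferentiableAt.fun_sum fun l _ => (hΓ k i l).fun_mul (hX l)),
      partialD_sum hS _ fun l _ => (hΓ k i l).fun_mul (hX l)]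
    congr 1
    exact Finset.sum_congr rfl fun l _ => partialD_mul hS (hΓ k i l) (hX l) k
  have hsq : ContDiffOn ℝ 2 (gradInnerCoord S γ f f) W :=
    h.contDiffOn_gradInnerCoord hW hWS hf hf (by norm_num) (by norm_num)
      two_le_infty
  have hL : (1 / 2 : ℝ) * laplaceCoord S γ (gradInnerCoord S γ f f) y
      = ∑ k, ∑ i, (partialD S k (hessCoord S γ f k i) y * gradCoord S γ f i y
          + hessCoord S γ f k i y * partialD S k (gradCoord S γ f i) y)
        + ∑ k, (∑ l, christoffel S γ l l k y)
          * ∑ i, hessCoord S γ f k i y * gradCoord S γ f i y := by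
    have a1 : ∀ k, partialD S k (gradCoord S γ (gradInnerCoord S γ f f) k) y
        = 2 * ∑ i, (partialD S k (hessCoord S γ f k i) y * gradCoord S γ f i y
          + hessCoord S γ f k i y * partialD S k (gradCoord S γ f i) y) := by
      intro k
      rw [partialD_congr_of_eqOn hW
        (fun z hz => h.gradCoord_gradInnerCoord_self hW hWS hf2 hz k) hy,
        partialD_const_mul hS (DifferentiableAt.fun_sum fun i _ => (hAd k i).fun_mul (hX i)),
        partialD_sum hS _ fun i _ => (hAd k i).fun_mul (hX i)]
      congr 1
      exact Finset.sum_congr rfl fun i _ => partialD_mul hS (hAd k i) (hX i) k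
    rw [h.laplaceCoord_eq hW hWS hsq hy]
    simp only [a1, h.gradCoord_gradInnerCoord_self hW hWS hf2 hy, mul_left_comm _ (2 : ℝ)]
    rw [← Finset.mul_sum, ← Finset.mul_sum]; ring
  -- Differentiating the divergence produces `∂_i ∂_k X^k`, whereas `hdA` has `∂_k ∂_i X^k`;
  -- exchanging them uses that the gradient is `C²`, hence `f` of class `C³`.
  have hdL : ∀ i, partialD S i (laplaceCoord S γ f) y
      = ∑ k, partialD S k (partialD S i (gradCoord S γ f k)) y
        + ∑ k, ((∑ l, partialD S i (christoffel S γ l l k) y) * gradCoord S γ f k y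
          + (∑ l, christoffel S γ l l k y) * partialD S i (gradCoord S γ f k) y) := by
    intro i
    rw [partialD_congr_of_eqOn hW (fun z hz => h.laplaceCoord_eq hW hWS hf2 hz) hy,
      partialD_add hS (DifferentiableAt.fun_sum fun k _ => hdX k k)
        (DifferentiableAt.fun_sum fun k _ =>
          (DifferentiableAt.fun_sum fun l _ => hΓ l l k).fun_mul (hX k)),
      partialD_sum hS _ fun k _ => hdX k k,
      partialD_sum hS _ fun k _ => (DifferentiableAt.fun_sum fun l _ => hΓ l l k).fun_mul (hX k)]
    congr 1
    · exact Finset.sum_congr rfl fun k _ => partialD_comm hW hWS (hXc k) hy i k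
    · refine Finset.sum_congr rfl fun k _ => ?_
      rw [partialD_mul hS (DifferentiableAt.fun_sum fun l _ => hΓ l l k) (hX k),
        partialD_sum hS _ fun l _ => hΓ l l k]
  have htr : laplaceCoord S γ f y = (Matrix.of fun k i => hessCoord S γ f k i y).trace := by
    rw [h.laplaceCoord_eq hW hWS hf2 hy, Matrix.trace]
    simp only [Matrix.diag_apply, Matrix.of_apply, hessCoord, Finset.sum_add_distrib,
      Finset.sum_mul]
    congr 1
    exact Finset.sum_comm
  -- The only inequality of the proof; the rest is an identity. The trace of the Hessian
  -- endomorphism is the Laplacian by `htr`.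
  have hcs := sq_trace_le_card_mul_trace_mul_self (h.posDef y hy)
    (h.hessCoord_isSymm hW hWS hf2 hy) (by simpa using hn)
  rw [← htr, Fintype.card_fin] at hcs
  have hAA : (Matrix.of (fun k i => hessCoord S γ f k i y)
      * Matrix.of fun k i => hessCoord S γ f k i y).trace
      = ∑ k, ∑ i, hessCoord S γ f k i y * hessCoord S γ f i k y := by
    simp [Matrix.trace, Matrix.mul_apply]
  have key := bochner_algebra (fun i => gradCoord S γ f i y)
    (fun i k => partialD S i (gradCoord S γ f k) y)
    (fun i k => partialD S k (partialD S i (gradCoord S γ f k)) y)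
    (fun k i j => christoffel S γ k i j y)
    (fun a k i j => partialD S a (christoffel S γ k i j) y)
    (fun k i j => h.christoffel_symm hW hy k i j)
    (fun a k i j => h.partialD_christoffel_symm hW hy a k i j)
  have hG : gradInnerCoord S γ (laplaceCoord S γ f) f y
      = ∑ i, gradCoord S γ f i y * partialD S i (laplaceCoord S γ f) y :=
    Finset.sum_congr rfl fun i _ => mul_comm _ _
  rw [hL, hG]
  simp only [hdA, hdL]
  rw [hAA] at hcs
  simp only [hessCoord] at hcs ⊢
  simp only [ricciCoord]
  linarith

end Bochner

/-! ### Change of coordinates -/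

section ChangeOfCoordinates

variable {n : ℕ} {S W W' : Set (EuclideanSpace ℝ (Fin n))}
  {γ γ' : EuclideanSpace ℝ (Fin n) → Matrix (Fin n) (Fin n) ℝ} {y : EuclideanSpace ℝ (Fin n)}
  {f f' : EuclideanSpace ℝ (Fin n) → ℝ} {τ : EuclideanSpace ℝ (Fin n) → EuclideanSpace ℝ (Fin n)}

/-- The Jacobian matrix `∂_i τ^a` of a map. -/
def jacobianMat (S : Set (EuclideanSpace ℝ (Fin n)))
    (τ : EuclideanSpace ℝ (Fin n) → EuclideanSpace ℝ (Fin n)) (y : EuclideanSpace ℝ (Fin n)) :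
    Matrix (Fin n) (Fin n) ℝ :=
  Matrix.of fun a i => fderivWithin ℝ τ S y (EuclideanSpace.single i 1) a

/-- The entrywise partial derivative of a matrix field. -/
def partialMat (S : Set (EuclideanSpace ℝ (Fin n))) (k : Fin n)
    (A : EuclideanSpace ℝ (Fin n) → Matrix (Fin n) (Fin n) ℝ) (y : EuclideanSpace ℝ (Fin n)) :
    Matrix (Fin n) (Fin n) ℝ :=
  Matrix.of fun a b => partialD S k (fun z => A z a b) y

theorem euclidean_eq_sum_single (v : EuclideanSpace ℝ (Fin n)) :
    v = ∑ i, v i • EuclideanSpace.single i (1 : ℝ) := by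
  ext j
  simp [Finset.sum_apply, Pi.single_apply]

theorem jacobianMat_eq_partialD (hS : UniqueDiffWithinAt ℝ S y)
    (hτ : DifferentiableWithinAt ℝ τ S y) (a i : Fin n) :
    jacobianMat S τ y a i = partialD S i (fun z => τ z a) y := by
  have h := (EuclideanSpace.proj a : EuclideanSpace ℝ (Fin n) →L[ℝ] ℝ).hasFDerivAt.comp_hasFDerivWithinAt
    y hτ.hasFDerivWithinAt
  have h2 : fderivWithin ℝ (fun z => τ z a) S y = _ := h.fderivWithin hS
  rw [partialD, h2]
  rfl

/-- The chain rule for a change of coordinates. -/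
theorem partialD_comp (hS : UniqueDiffWithinAt ℝ S y) (hτ : DifferentiableWithinAt ℝ τ S y)
    (hτS : ∀ᶠ z in nhdsWithin y S, τ z ∈ S) (hf' : DifferentiableWithinAt ℝ f' S (τ y))
    (hff : f =ᶠ[nhdsWithin y S] fun z => f' (τ z)) (hy : f y = f' (τ y)) (i : Fin n) :
    partialD S i f y = ∑ a, jacobianMat S τ y a i * partialD S a f' (τ y) := by
  have h0 : fderivWithin ℝ f S y = fderivWithin ℝ (f' ∘ τ) S y := hff.fderivWithin_eq hy
  have h1 : HasFDerivWithinAt (f' ∘ τ) ((fderivWithin ℝ f' S (τ y)).comp (fderivWithin ℝ τ S y)) S y := by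
    have ht : Filter.Tendsto τ (nhdsWithin y S) (nhdsWithin (τ y) S) :=
      tendsto_nhdsWithin_iff.2 ⟨hτ.continuousWithinAt, hτS⟩
    exact hf'.hasFDerivWithinAt.comp_of_tendsto y hτ.hasFDerivWithinAt ht
  rw [partialD, h0, h1.fderivWithin hS]
  simp only [ContinuousLinearMap.comp_apply]
  conv_lhs => rw [euclidean_eq_sum_single (fderivWithin ℝ τ S y (EuclideanSpace.single i 1))]
  rw [map_sum]
  simp [jacobianMat, partialD]

/-- The gradient transforms as a vector. -/
theorem mulVec_inv_transform {P J : Matrix (Fin n) (Fin n) ℝ} (hJ : IsUnit J.det)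
    (v : Fin n → ℝ) :
    J.mulVec ((J.transpose * P * J)⁻¹.mulVec (J.transpose.mulVec v)) = P⁻¹.mulVec v := by
  have hJt : IsUnit J.transpose.det := by rwa [Matrix.det_transpose]
  rw [Matrix.mulVec_mulVec, Matrix.mulVec_mulVec, Matrix.mul_inv_rev, Matrix.mul_inv_rev]
  congr 1
  rw [← Matrix.mul_assoc, Matrix.mul_nonsing_inv _ hJ, Matrix.one_mul, Matrix.mul_assoc,
    Matrix.nonsing_inv_mul _ hJt, Matrix.mul_one]

/-- The transformation law of the metric already forces the Jacobian to be invertible, so no inverse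
map has to be differentiated. -/
theorem isUnit_jacobianMat_det {P P' J : Matrix (Fin n) (Fin n) ℝ}
    (hγ : P = J.transpose * P' * J) (hP : IsUnit P.det) : IsUnit J.det := by
  rw [hγ, Matrix.det_mul] at hP
  exact isUnit_of_mul_isUnit_right hP

theorem gradCoord_comp (hS : UniqueDiffWithinAt ℝ S y) (hτ : DifferentiableWithinAt ℝ τ S y)
    (hτS : ∀ᶠ z in nhdsWithin y S, τ z ∈ S) (hf' : DifferentiableWithinAt ℝ f' S (τ y))
    (hff : f =ᶠ[nhdsWithin y S] fun z => f' (τ z)) (hy : f y = f' (τ y))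
    (hγ : γ y = (jacobianMat S τ y).transpose * γ' (τ y) * jacobianMat S τ y)
    (hP : IsUnit (γ y).det) (a : Fin n) :
    gradCoord S γ' f' a (τ y) = ∑ k, jacobianMat S τ y a k * gradCoord S γ f k y := by
  have h := congrFun (mulVec_inv_transform (P := γ' (τ y)) (isUnit_jacobianMat_det hγ hP)
    fun b => partialD S b f' (τ y)) a
  have h2 : (jacobianMat S τ y).transpose.mulVec (fun b => partialD S b f' (τ y))
      = fun i => partialD S i f y :=
    funext fun i => (partialD_comp hS hτ hτS hf' hff hy i).symm
  rw [h2, ← hγ] at h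
  exact h.symm

/-- The inner product of gradients does not depend on the coordinates. -/
theorem gradInnerCoord_comp {b b' : EuclideanSpace ℝ (Fin n) → ℝ}
    (hS : UniqueDiffWithinAt ℝ S y) (hτ : DifferentiableWithinAt ℝ τ S y)
    (hτS : ∀ᶠ z in nhdsWithin y S, τ z ∈ S) (hf' : DifferentiableWithinAt ℝ f' S (τ y))
    (hff : f =ᶠ[nhdsWithin y S] fun z => f' (τ z)) (hy : f y = f' (τ y))
    (hb' : DifferentiableWithinAt ℝ b' S (τ y))
    (hbb : b =ᶠ[nhdsWithin y S] fun z => b' (τ z)) (hby : b y = b' (τ y))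
    (hγ : γ y = (jacobianMat S τ y).transpose * γ' (τ y) * jacobianMat S τ y)
    (hP : IsUnit (γ y).det) :
    gradInnerCoord S γ f b y = gradInnerCoord S γ' f' b' (τ y) := by
  unfold gradInnerCoord
  simp only [gradCoord_comp hS hτ hτS hb' hbb hby hγ hP,
    partialD_comp hS hτ hτS hf' hff hy, Finset.sum_mul, Finset.mul_sum]
  rw [Finset.sum_comm]
  exact Finset.sum_congr rfl fun i _ => Finset.sum_congr rfl fun k _ => by ring

theorem partialMat_mul (hS : S ∈ nhds y) {A B : EuclideanSpace ℝ (Fin n) → Matrix (Fin n) (Fin n) ℝ}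
    (hA : ∀ a b, DifferentiableAt ℝ (fun z => A z a b) y)
    (hB : ∀ a b, DifferentiableAt ℝ (fun z => B z a b) y) (k : Fin n) :
    partialMat S k (fun z => A z * B z) y = partialMat S k A y * B y + A y * partialMat S k B y := by
  ext a b
  simp only [partialMat, Matrix.of_apply, Matrix.add_apply, Matrix.mul_apply]
  rw [partialD_sum hS _ fun c _ => (hA a c).fun_mul (hB c b), ← Finset.sum_add_distrib]
  exact Finset.sum_congr rfl fun c _ => partialD_mul hS (hA a c) (hB c b) k

/-- This is `d log det (JᵀPJ) = 2 d log |det J| + d log det P` written with traces. It gives the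
transformation of the contracted Christoffel symbols. -/
theorem trace_inv_mul_transform {P J dP dJ : Matrix (Fin n) (Fin n) ℝ} (hJ : IsUnit J.det)
    (hP : IsUnit P.det) :
    ((J.transpose * P * J)⁻¹ * ((dJ.transpose * P + J.transpose * dP) * J
      + J.transpose * P * dJ)).trace = 2 * (J⁻¹ * dJ).trace + (P⁻¹ * dP).trace := by
  have hJt : IsUnit J.transpose.det := by rwa [Matrix.det_transpose]
  have e1 : ((J.transpose * P * J)⁻¹ * (J.transpose * P * dJ)).trace = (J⁻¹ * dJ).trace := by
    have hJP : IsUnit (J.transpose * P).det := by rw [Matrix.det_mul]; exact hJt.mul hP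
    rw [Matrix.mul_inv_rev, Matrix.mul_assoc, Matrix.nonsing_inv_mul_cancel_left _ _ hJP]
  have e2 : ∀ X : Matrix (Fin n) (Fin n) ℝ, ((J.transpose * P * J)⁻¹ * (X * J)).trace
      = (P⁻¹ * (J.transpose⁻¹ * X)).trace := by
    intro X
    rw [Matrix.mul_inv_rev, Matrix.mul_inv_rev, Matrix.mul_assoc, Matrix.trace_mul_comm]
    rw [Matrix.mul_assoc, Matrix.mul_assoc, Matrix.mul_assoc, Matrix.mul_nonsing_inv _ hJ,
      Matrix.mul_one]
  have e3 : (P⁻¹ * (J.transpose⁻¹ * (dJ.transpose * P))).trace = (J⁻¹ * dJ).trace := by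
    rw [Matrix.trace_mul_comm, Matrix.mul_assoc, Matrix.mul_assoc, Matrix.mul_nonsing_inv _ hP,
      Matrix.mul_one, ← Matrix.transpose_nonsing_inv, ← Matrix.transpose_mul,
      Matrix.trace_transpose, Matrix.trace_mul_comm]
  rw [Matrix.mul_add, Matrix.trace_add, e1, e2, Matrix.mul_add, Matrix.mul_add, Matrix.trace_add,
    e3, Matrix.nonsing_inv_mul_cancel_left _ _ hJt]
  ring

theorem IsMetricOn.sum_christoffel_eq_trace (h : IsMetricOn W γ) (hW : IsOpen W) (hy : y ∈ W)
    (k : Fin n) :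
    ∑ l, christoffel S γ l l k y = (1 / 2 : ℝ) * ((γ y)⁻¹ * partialMat S k γ y).trace := by
  rw [h.sum_christoffel hW hy]
  congr 1
  simp only [Matrix.trace, Matrix.diag_apply, Matrix.mul_apply, partialMat, Matrix.of_apply]
  refine Finset.sum_congr rfl fun i _ => Finset.sum_congr rfl fun j _ => ?_
  rw [h.partialD_metric_symm hW hy]

/-- The Laplacian does not depend on the coordinates. -/
theorem laplaceCoord_comp (h : IsMetricOn W γ) (h' : IsMetricOn W' γ') (hW : IsOpen W)
    (hW' : IsOpen W') (hWS : W ⊆ S) (hWS' : W' ⊆ S) (hτ : ContDiffOn ℝ 2 τ W)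
    (hτW : MapsTo τ W W') (hf' : ContDiffOn ℝ 2 f' W') (hff : EqOn f (fun z => f' (τ z)) W)
    (hγ : ∀ z ∈ W, γ z = (jacobianMat S τ z).transpose * γ' (τ z) * jacobianMat S τ z)
    (hy : y ∈ W) : laplaceCoord S γ f y = laplaceCoord S γ' f' (τ y) := by
  have hf : ContDiffOn ℝ 2 f W := (hf'.comp hτ hτW).congr hff
  have nS : ∀ z ∈ W, S ∈ nhds z := fun z hz => mem_nhds_of_isOpen_subset hW hWS hz
  have hS := nS y hy
  have hnhds := hW.mem_nhds hy
  have uS : ∀ z ∈ W, UniqueDiffWithinAt ℝ S z := fun z hz =>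
    uniqueDiffWithinAt_of_mem_nhds (nS z hz)
  have hτd : ∀ z ∈ W, DifferentiableAt ℝ τ z := fun z hz =>
    (hτ.differentiableOn (by norm_num)).differentiableAt (hW.mem_nhds hz)
  have hτS : ∀ z ∈ W, ∀ᶠ w in nhdsWithin z S, τ w ∈ S := fun z hz =>
    Filter.mem_of_superset (mem_nhdsWithin_of_mem_nhds (hW.mem_nhds hz))
      fun w hw => hWS' (hτW hw)
  have chain : ∀ {a a' : EuclideanSpace ℝ (Fin n) → ℝ}, EqOn a (fun z => a' (τ z)) W →
      ContDiffOn ℝ 1 a' W' → ∀ z ∈ W, ∀ i, partialD S i a z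
        = ∑ b, jacobianMat S τ z b i * partialD S b a' (τ z) := by
    intro a a' haa ha' z hz i
    refine partialD_comp (uS z hz) (hτd z hz).differentiableWithinAt (hτS z hz)
      ((ha'.differentiableOn (by norm_num)).differentiableAt
        (hW'.mem_nhds (hτW hz))).differentiableWithinAt ?_ (haa hz) i
    exact Filter.mem_of_superset (mem_nhdsWithin_of_mem_nhds (hW.mem_nhds hz)) haa
  have hX' : ∀ a, ContDiffOn ℝ 1 (gradCoord S γ' f' a) W' := fun a =>
    h'.contDiffOn_gradCoord (k := 1) hW' hWS' hf' (by norm_num) (by exact_mod_cast le_top) a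
  have hXd : ∀ i, DifferentiableAt ℝ (gradCoord S γ f i) y := fun i =>
    ((h.contDiffOn_gradCoord (k := 1) hW hWS hf (by norm_num) (by exact_mod_cast le_top)
      i).differentiableOn (by norm_num)).differentiableAt hnhds
  have hτa : ∀ a, ContDiffOn ℝ 2 (fun z => τ z a) W := fun a =>
    (EuclideanSpace.proj a : EuclideanSpace ℝ (Fin n) →L[ℝ] ℝ).contDiff.comp_contDiffOn hτ
  have hJp : ∀ a i, EqOn (fun z => jacobianMat S τ z a i) (partialD S i (fun z => τ z a)) W :=
    fun a i z hz => jacobianMat_eq_partialD (uS z hz) (hτd z hz).differentiableWithinAt a i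
  have hJc : ∀ a i, ContDiffOn ℝ 1 (fun z => jacobianMat S τ z a i) W := fun a i =>
    (contDiffOn_partialD (k := 1) hW hWS (hτa a) (by norm_num) i).congr (hJp a i)
  have hJd : ∀ a i, DifferentiableAt ℝ (fun z => jacobianMat S τ z a i) y := fun a i =>
    ((hJc a i).differentiableOn (by norm_num)).differentiableAt hnhds
  -- The Jacobian is made of first derivatives of `τ`, so this is the symmetry of second
  -- derivatives. It lets `∂_i J` in the derivative of `J X` be exchanged for `X^k ∂_k J`.
  have hJsymm : ∀ a i k, partialD S i (fun z => jacobianMat S τ z a k) y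
      = partialD S k (fun z => jacobianMat S τ z a i) y := by
    intro a i k
    rw [partialD_congr_of_eqOn hW (hJp a k) hy, partialD_congr_of_eqOn hW (hJp a i) hy,
      partialD_comm hW hWS (hτa a) hy]
  have hgrad : ∀ a, EqOn (fun z => ∑ k, jacobianMat S τ z a k * gradCoord S γ f k z)
      (fun z => gradCoord S γ' f' a (τ z)) W := by
    intro a z hz
    refine (gradCoord_comp (uS z hz) (hτd z hz).differentiableWithinAt (hτS z hz)
      ((hf'.differentiableOn (by norm_num)).differentiableAt
        (hW'.mem_nhds (hτW hz))).differentiableWithinAt ?_ (hff hz) (hγ z hz)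
        (h.isUnit_det hz) a).symm
    exact Filter.mem_of_superset (mem_nhdsWithin_of_mem_nhds (hW.mem_nhds hz)) hff
  set J := jacobianMat S τ y with hJ
  have hJu : IsUnit J.det := isUnit_jacobianMat_det (hγ y hy) (h.isUnit_det hy)
  have hPu : IsUnit (γ' (τ y)).det := h'.isUnit_det (hτW hy)
  -- the derivative of the transformed gradient
  have key : (Matrix.of fun a b => partialD S b (gradCoord S γ' f' a) (τ y)) * J
      = ∑ k, gradCoord S γ f k y • partialMat S k (jacobianMat S τ) y
        + J * Matrix.of fun k i => partialD S i (gradCoord S γ f k) y := by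
    ext a i
    have c1 := chain (hgrad a) (hX' a) y hy i
    rw [partialD_sum hS _ fun k _ => (hJd a k).fun_mul (hXd k)] at c1
    simp only [partialD_mul hS (hJd a _) (hXd _), Finset.sum_add_distrib] at c1
    simp only [Matrix.mul_apply, Matrix.of_apply, Matrix.add_apply, Matrix.sum_apply,
      Matrix.smul_apply, partialMat, smul_eq_mul]
    rw [← hJ] at c1
    have c2 : ∑ b, partialD S b (gradCoord S γ' f' a) (τ y) * J b i
        = ∑ b, J b i * partialD S b (gradCoord S γ' f' a) (τ y) :=
      Finset.sum_congr rfl fun _ _ => mul_comm _ _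
    rw [c2, ← c1]
    congr 1
    exact Finset.sum_congr rfl fun k _ => by rw [hJsymm a i k, mul_comm]
  have htr : ∑ a, partialD S a (gradCoord S γ' f' a) (τ y)
      = ∑ k, gradCoord S γ f k y * (J⁻¹ * partialMat S k (jacobianMat S τ) y).trace
        + ∑ k, partialD S k (gradCoord S γ f k) y := by
    have e1 := congrArg (fun M => (J⁻¹ * M).trace) key
    simp only [Matrix.mul_add, Matrix.trace_add] at e1
    rw [Matrix.nonsing_inv_mul_cancel_left _ _ hJu, ← Matrix.mul_assoc, Matrix.trace_mul_comm,
      ← Matrix.mul_assoc, Matrix.mul_nonsing_inv _ hJu, Matrix.one_mul, Matrix.mul_sum,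
      Matrix.trace_sum] at e1
    simp only [Matrix.mul_smul, Matrix.trace_smul, smul_eq_mul] at e1
    exact e1
  -- The correction `tr(J⁻¹ ∂_k J)` found here also occurs in `htr`. Contracted with the gradient,
  -- the two cancel in divergence plus Christoffel term.
  have ht : ∀ k, ∑ l, christoffel S γ l l k y
      = (J⁻¹ * partialMat S k (jacobianMat S τ) y).trace
        + ∑ b, J b k * ∑ l, christoffel S γ' l l b (τ y) := by
    intro k
    have hPd : ∀ a b, DifferentiableAt ℝ (fun z => γ' (τ z) a b) y := fun a b =>
      ((((h'.smooth a b).of_le two_le_infty).comp hτ hτW).differentiableOn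
        (by norm_num)).differentiableAt hnhds
    have hJtd : ∀ a b, DifferentiableAt ℝ (fun z => (jacobianMat S τ z).transpose a b) y :=
      fun a b => hJd b a
    have d1 : partialMat S k γ y
        = partialMat S k (fun z => (jacobianMat S τ z).transpose * γ' (τ z) * jacobianMat S τ z) y := by
      ext a b
      exact partialD_congr_of_eqOn hW (fun z hz => by simp only [hγ z hz]) hy k
    have hJP : ∀ a b, DifferentiableAt ℝ
        (fun z => ((jacobianMat S τ z).transpose * γ' (τ z)) a b) y := by
      intro a b
      simp only [Matrix.mul_apply]
      exact DifferentiableAt.fun_sum fun c _ => (hJtd a c).fun_mul (hPd c b)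
    rw [h.sum_christoffel_eq_trace hW hy, d1, partialMat_mul hS hJP hJd, partialMat_mul hS hJtd hPd,
      hγ y hy]
    have d2 : partialMat S k (fun z => (jacobianMat S τ z).transpose) y
        = (partialMat S k (jacobianMat S τ) y).transpose := rfl
    have d3 : partialMat S k (fun z => γ' (τ z)) y = ∑ b, J b k • partialMat S b γ' (τ y) := by
      ext a c
      simp only [partialMat, Matrix.of_apply, Matrix.sum_apply, Matrix.smul_apply, smul_eq_mul]
      exact chain (a := fun z => γ' (τ z) a c) (a' := fun z => γ' z a c) (fun _ _ => rfl)
        ((h'.smooth a c).of_le (by exact_mod_cast le_top)) y hy k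
    rw [d2, trace_inv_mul_transform hJu hPu, d3, Matrix.mul_sum, Matrix.trace_sum]
    simp only [Matrix.mul_smul, Matrix.trace_smul, smul_eq_mul,
      h'.sum_christoffel_eq_trace hW' (hτW hy)]
    rw [mul_add, Finset.mul_sum]
    congr 1
    · ring
    · exact Finset.sum_congr rfl fun b _ => by ring
  rw [h.laplaceCoord_eq hW hWS hf hy, h'.laplaceCoord_eq hW' hWS' hf' (hτW hy), htr]
  have hlast : ∑ a, (∑ l, christoffel S γ' l l a (τ y)) * gradCoord S γ' f' a (τ y)
      = ∑ k, (∑ b, J b k * ∑ l, christoffel S γ' l l b (τ y)) * gradCoord S γ f k y := by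
    have e : ∀ a, gradCoord S γ' f' a (τ y) = ∑ k, J a k * gradCoord S γ f k y :=
      fun a => (hgrad a hy).symm
    simp only [e]
    obtain ⟨t, hT⟩ : ∃ t : Fin n → ℝ, ∀ b, ∑ l, christoffel S γ' l l b (τ y) = t b :=
      ⟨_, fun _ => rfl⟩
    simp only [hT, Finset.mul_sum, Finset.sum_mul]
    rw [Finset.sum_comm]
    exact Finset.sum_congr rfl fun i _ => Finset.sum_congr rfl fun k _ => by ring
  rw [hlast]
  simp only [ht, add_mul, Finset.sum_add_distrib]
  have : ∑ k, (J⁻¹ * partialMat S k (jacobianMat S τ) y).trace * gradCoord S γ f k y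
      = ∑ k, gradCoord S γ f k y * (J⁻¹ * partialMat S k (jacobianMat S τ) y).trace :=
    Finset.sum_congr rfl fun _ _ => mul_comm _ _
  rw [this]; ring

end ChangeOfCoordinates

/-! ### The metric in charts -/

section Charts

variable {n : ℕ} {H : Type*} [TopologicalSpace H]
  (I : ModelWithCorners ℝ (EuclideanSpace ℝ (Fin n)) H)
  {M : Type*} [TopologicalSpace M] [ChartedSpace H M]

/-- The derivative of the inverse of the chart around `p`, as a map of the model space. -/
def chartD (p : M) (y : EuclideanSpace ℝ (Fin n)) :
    EuclideanSpace ℝ (Fin n) →L[ℝ] EuclideanSpace ℝ (Fin n) :=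
  mfderivWithin 𝓘(ℝ, EuclideanSpace ℝ (Fin n)) I (extChartAt I p).symm (range I) y

/-- The change of coordinates from the chart around `p` to the chart around `q`. -/
def transition (p q : M) (y : EuclideanSpace ℝ (Fin n)) : EuclideanSpace ℝ (Fin n) :=
  extChartAt I q ((extChartAt I p).symm y)

/-- The part of the image of the chart around `p` that lies in the chart around `q`. -/
def overlap (p q : M) : Set (EuclideanSpace ℝ (Fin n)) :=
  (extChartAt I p).target ∩ (extChartAt I p).symm ⁻¹' (extChartAt I q).source

variable {I}

theorem overlap_eq (p q : M) :
    overlap I p q = ((extChartAt I p).symm ≫ extChartAt I q).source := by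
  simp [overlap, PartialEquiv.trans_source]

theorem overlap_mem_nhdsWithin {p q : M} {y : EuclideanSpace ℝ (Fin n)} (hy : y ∈ overlap I p q) :
    overlap I p q ∈ nhdsWithin y (range I) := by
  refine Filter.inter_mem (extChartAt_target_mem_nhdsWithin_of_mem hy.1) ?_
  have h := (continuousOn_extChartAt_symm (I := I) p y hy.1).preimage_mem_nhdsWithin
    ((isOpen_extChartAt_source (I := I) q).mem_nhds hy.2)
  rwa [nhdsWithin_extChartAt_target_eq_of_mem hy.1] at h

theorem transition_mem {p q : M} {y : EuclideanSpace ℝ (Fin n)} (hy : y ∈ overlap I p q) :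
    transition I p q y ∈ overlap I q p := by
  refine ⟨(extChartAt I q).map_source hy.2, ?_⟩
  rw [mem_preimage, transition, (extChartAt I q).left_inv hy.2]
  exact (extChartAt I p).map_target hy.1

theorem symm_transition {p q : M} {y : EuclideanSpace ℝ (Fin n)} (hy : y ∈ overlap I p q) :
    (extChartAt I q).symm (transition I p q y) = (extChartAt I p).symm y :=
  (extChartAt I q).left_inv hy.2

theorem transition_transition {p q : M} {y : EuclideanSpace ℝ (Fin n)} (hy : y ∈ overlap I p q) :
    transition I q p (transition I p q y) = y := by
  rw [transition, symm_transition hy, (extChartAt I p).right_inv hy.1]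

variable [IsManifold I ∞ M]
  (m : Bundle.ContMDiffRiemannianMetric I ∞ (EuclideanSpace ℝ (Fin n))
    (fun x : M => TangentSpace I x))

/-- The metric at `x`, as a bilinear form on the model space. -/
def metricForm (x : M) :
    EuclideanSpace ℝ (Fin n) →L[ℝ] EuclideanSpace ℝ (Fin n) →L[ℝ] ℝ := m.inner x

theorem gram_apply (p : M) (y : EuclideanSpace ℝ (Fin n)) (i j : Fin n) :
    gram I m p y i j = metricForm m ((extChartAt I p).symm y)
      (chartD I p y (EuclideanSpace.single i 1)) (chartD I p y (EuclideanSpace.single j 1)) := rfl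

theorem contDiffWithinAt_transition {p q : M} {y : EuclideanSpace ℝ (Fin n)}
    (hy : y ∈ overlap I p q) : ContDiffWithinAt ℝ ∞ (transition I p q) (range I) y :=
  contDiffWithinAt_ext_coord_change q p (by rwa [← overlap_eq])

theorem differentiableWithinAt_transition {p q : M} {y : EuclideanSpace ℝ (Fin n)}
    (hy : y ∈ overlap I p q) : DifferentiableWithinAt ℝ (transition I p q) (range I) y :=
  (contDiffWithinAt_ext_coord_change (n := ∞) q p (by rwa [← overlap_eq])).differentiableWithinAt
    (by simp)

/-- The derivative of the chart is a left inverse. Injectivity is what makes the Gram matrices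
definite rather than semidefinite. -/
theorem chartD_injective {p : M} {y : EuclideanSpace ℝ (Fin n)}
    (hy : y ∈ (extChartAt I p).target) : Function.Injective (chartD I p y) := by
  have : IsManifold I 1 M := IsManifold.of_le (n := ∞) (by exact_mod_cast le_top)
  have h := mfderiv_extChartAt_comp_mfderivWithin_extChartAt_symm (I := I) hy
  intro v w hvw
  have hv := congrArg (fun L => L v) h
  have hw := congrArg (fun L => L w) h
  exact (hv.symm.trans (congrArg
    (mfderiv I 𝓘(ℝ, EuclideanSpace ℝ (Fin n)) (extChartAt I p) ((extChartAt I p).symm y)) hvw)).trans hw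

theorem coordsOf_chartD (x : M) (v : EuclideanSpace ℝ (Fin n)) :
    coordsOf I x (chartD I x (extChartAt I x x) v) = v := by
  have : IsManifold I 1 M := IsManifold.of_le (n := ∞) (by exact_mod_cast le_top)
  have h := mfderiv_extChartAt_comp_mfderivWithin_extChartAt_symm' (I := I)
    (mem_extChartAt_source (I := I) x)
  exact congrArg (fun L => L v) h

/-- The chain rule gives the derivative of the transition as that of the chart `q` after that of the
inverse chart `p`; applying the derivative of the inverse chart `q` undoes the former. -/
theorem chartD_transition {p q : M} {y : EuclideanSpace ℝ (Fin n)} (hy : y ∈ overlap I p q)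
    (v : EuclideanSpace ℝ (Fin n)) :
    chartD I p y v = chartD I q (transition I p q y)
      (fderivWithin ℝ (transition I p q) (range I) y v) := by
  have : IsManifold I 1 M := IsManifold.of_le (n := ∞) (by exact_mod_cast le_top)
  have hu : UniqueMDiffWithinAt 𝓘(ℝ, EuclideanSpace ℝ (Fin n)) (range I) y :=
    I.uniqueMDiffOn _ (extChartAt_target_subset_range p hy.1)
  have hsrc : (extChartAt I p).symm y ∈ (chartAt H q).source := by
    rw [← extChartAt_source I]; exact hy.2
  have h1 := mfderiv_comp_mfderivWithin (I := 𝓘(ℝ, EuclideanSpace ℝ (Fin n))) (I' := I)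
    (I'' := 𝓘(ℝ, EuclideanSpace ℝ (Fin n))) y (g := extChartAt I q)
    (f := (extChartAt I p).symm) (s := range I) (mdifferentiableAt_extChartAt hsrc)
    (mdifferentiableWithinAt_extChartAt_symm hy.1) hu
  rw [mfderivWithin_eq_fderivWithin] at h1
  have h2 := mfderivWithin_extChartAt_symm_comp_mfderiv_extChartAt' (I := I) hy.2
  have e1 := congrArg (fun L => L v) h1
  have e2 := congrArg (fun L => L (chartD I p y v)) h2
  change fderivWithin ℝ (transition I p q) (range I) y v = _ at e1
  rw [e1]
  exact e2.symm

theorem metricForm_sum (x : M) (v w : Fin n → EuclideanSpace ℝ (Fin n)) (a b : Fin n → ℝ) :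
    metricForm m x (∑ i, a i • v i) (∑ j, b j • w j)
      = ∑ i, ∑ j, a i * b j * metricForm m x (v i) (w j) := by
  simp only [map_sum, map_smul, sum_apply, smul_apply,
    smul_eq_mul, Finset.mul_sum]
  rw [Finset.sum_comm]
  exact Finset.sum_congr rfl fun i _ => Finset.sum_congr rfl fun j _ => by ring

theorem metricForm_chartD (p : M) (y v w : EuclideanSpace ℝ (Fin n)) :
    metricForm m ((extChartAt I p).symm y) (chartD I p y v) (chartD I p y w)
      = ∑ i, ∑ j, v i * w j * gram I m p y i j := by
  have h : ∀ v : EuclideanSpace ℝ (Fin n), chartD I p y v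
      = ∑ i, v i • chartD I p y (EuclideanSpace.single i 1) := by
    intro v
    conv_lhs => rw [euclidean_eq_sum_single v, map_sum]
    simp only [map_smul]
  rw [h v, h w, metricForm_sum]
  rfl

/-- The transformation law of the metric coefficients. -/
theorem gram_transition {p q : M} {y : EuclideanSpace ℝ (Fin n)} (hy : y ∈ overlap I p q) :
    gram I m p y = (jacobianMat (range I) (transition I p q) y).transpose
      * gram I m q (transition I p q y) * jacobianMat (range I) (transition I p q) y := by
  ext i j
  rw [gram_apply, chartD_transition hy, chartD_transition hy, ← symm_transition hy,
    metricForm_chartD]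
  simp only [Matrix.mul_apply, Matrix.transpose_apply, Finset.sum_mul, jacobianMat,
    Matrix.of_apply]
  rw [Finset.sum_comm]
  exact Finset.sum_congr rfl fun i _ => Finset.sum_congr rfl fun j _ => by ring

theorem gram_posDef {p : M} {y : EuclideanSpace ℝ (Fin n)} (hy : y ∈ (extChartAt I p).target) :
    (gram I m p y).PosDef := by
  refine Matrix.PosDef.of_dotProduct_mulVec_pos ?_ fun v hv => ?_
  · ext i j
    simp only [Matrix.conjTranspose_apply, star_trivial]
    exact m.symm _ _ _
  · have h1 : star v ⬝ᵥ (gram I m p y).mulVec v = metricForm m ((extChartAt I p).symm y)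
        (chartD I p y (WithLp.toLp 2 v)) (chartD I p y (WithLp.toLp 2 v)) := by
      rw [metricForm_chartD]
      simp only [dotProduct, Matrix.mulVec, Finset.mul_sum, Pi.star_apply, star_trivial]
      exact Finset.sum_congr rfl fun i _ => Finset.sum_congr rfl fun j _ => by ring
    rw [h1]
    refine m.pos _ _ fun h0 => hv ?_
    have h2 : chartD I p y (WithLp.toLp 2 v) = chartD I p y 0 := by rw [map_zero]; exact h0
    have h3 := chartD_injective hy h2
    ext i
    exact congrFun (congrArg WithLp.ofLp h3) i

/-- The coordinate fields are images of constant fields under the tangent map of the inverse chart,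
hence smooth sections, and a smooth metric contracts smooth sections to a smooth function. The
derivatives within `target` and within `range I` agree because the two sets agree near each point of
the target. -/
theorem contDiffOn_gram (p : M) (i j : Fin n) :
    ContDiffOn ℝ ∞ (fun y => gram I m p y i j) (extChartAt I p).target := by
  have hU : UniqueMDiffOn 𝓘(ℝ, EuclideanSpace ℝ (Fin n)) (extChartAt I p).target :=
    (uniqueDiffOn_extChartAt_target p).uniqueMDiffOn
  have hsec : ∀ i : Fin n, ContMDiffOn 𝓘(ℝ, EuclideanSpace ℝ (Fin n)) I.tangent ∞
      (fun y => (⟨(extChartAt I p).symm y, coordVec I p i y⟩ : TangentBundle I M))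
      (extChartAt I p).target := by
    intro i
    have h1 := (contMDiffOn_extChartAt_symm (I := I) (n := ∞) p).contMDiffOn_tangentMapWithin
      (m := ∞) (by simp) hU
    have h2 : ContMDiffOn 𝓘(ℝ, EuclideanSpace ℝ (Fin n))
        (𝓘(ℝ, EuclideanSpace ℝ (Fin n)).tangent) ∞
        (fun y : EuclideanSpace ℝ (Fin n) => (⟨y, EuclideanSpace.single i (1 : ℝ)⟩ :
          TangentBundle 𝓘(ℝ, EuclideanSpace ℝ (Fin n)) (EuclideanSpace ℝ (Fin n))))
        (extChartAt I p).target := by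
      exact contMDiffOn_vectorSpace_iff_contDiffOn.2 contDiffOn_const
    refine (h1.comp h2 fun y hy => hy).congr fun y hy => ?_
    have h3 := mfderivWithin_congr_set (I := 𝓘(ℝ, EuclideanSpace ℝ (Fin n))) (I' := I)
      (f := (extChartAt I p).symm) (extChartAt_target_eventuallyEq_of_mem hy)
    simp only [tangentMapWithin, Function.comp_apply, coordVec]
    rw [h3]
  rw [← contMDiffOn_iff_contDiffOn]
  intro y hy
  have h3 : ContMDiffWithinAt 𝓘(ℝ, EuclideanSpace ℝ (Fin n)) (I.prod 𝓘(ℝ)) ∞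
      (fun y => Bundle.TotalSpace.mk' ℝ (E := Bundle.Trivial M ℝ) ((extChartAt I p).symm y)
        (m.inner ((extChartAt I p).symm y) (coordVec I p i y) (coordVec I p j y)))
      (extChartAt I p).target y := by
    apply ContMDiffWithinAt.clm_bundle_apply₂ (F₁ := EuclideanSpace ℝ (Fin n))
      (F₂ := EuclideanSpace ℝ (Fin n))
    · exact ContMDiffAt.comp_contMDiffWithinAt y m.contMDiff.contMDiffAt
        (contMDiffOn_extChartAt_symm p y hy)
    · exact hsec i y hy
    · exact hsec j y hy
  rw [Bundle.contMDiffWithinAt_totalSpace] at h3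
  exact h3.2

theorem isMetricOn_gram (p : M) : IsMetricOn (extChartAt I p).target (gram I m p) :=
  ⟨fun i j => contDiffOn_gram m p i j, fun _ hy => gram_posDef m hy⟩

end Charts

/-! ### Functions on the manifold, read in charts -/

section Functions

variable {n : ℕ} {H : Type*} [TopologicalSpace H]
  (I : ModelWithCorners ℝ (EuclideanSpace ℝ (Fin n)) H)
  {M : Type*} [TopologicalSpace M] [ChartedSpace H M]

/-- The expression of a function in the chart around `p`. -/
def inChart (p : M) (f : M → ℝ) (y : EuclideanSpace ℝ (Fin n)) : ℝ := f ((extChartAt I p).symm y)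

/-- The function `f` is of class `C^k` in all charts, up to the boundary. -/
def IsC (k : WithTop ℕ∞) (f : M → ℝ) : Prop :=
  ∀ p : M, ContDiffOn ℝ k (inChart I p f) (extChartAt I p).target

/-- The function `f` is of class `C^k` in all charts, in the interior. -/
def IsCInt (k : WithTop ℕ∞) (f : M → ℝ) : Prop :=
  ∀ p : M, ContDiffOn ℝ k (inChart I p f) (interior (extChartAt I p).target)

/-- The function `f` is differentiable at `x`, in the chart around `x`. -/
def IsDiffAt (f : M → ℝ) (x : M) : Prop :=
  DifferentiableWithinAt ℝ (inChart I x f) (range I) (extChartAt I x x)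

variable {I} {k l : WithTop ℕ∞} {f f' : M → ℝ} {x : M}

theorem inChart_apply (p : M) (hx : x ∈ (extChartAt I p).source) (f : M → ℝ) :
    inChart I p f (extChartAt I p x) = f x := by
  rw [inChart, (extChartAt I p).left_inv hx]

theorem IsC.isCInt (h : IsC I k f) : IsCInt I k f := fun p => (h p).mono interior_subset

theorem IsC.of_le (h : IsC I k f) (hl : l ≤ k) : IsC I l f := fun p => (h p).of_le hl

theorem IsCInt.of_le (h : IsCInt I k f) (hl : l ≤ k) : IsCInt I l f := fun p => (h p).of_le hl

theorem IsC.mul (h : IsC I k f) (h' : IsC I k f') : IsC I k (fun x => f x * f' x) :=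
  fun p => (h p).mul (h' p)

theorem IsC.comp {F : ℝ → ℝ} (hF : ContDiff ℝ k F) (h : IsC I k f) : IsC I k (fun x => F (f x)) :=
  fun p => hF.comp_contDiffOn (h p)

theorem IsCInt.mul (h : IsCInt I k f) (h' : IsCInt I k f') : IsCInt I k (fun x => f x * f' x) :=
  fun p => (h p).mul (h' p)

theorem IsCInt.neg (h : IsCInt I k f) : IsCInt I k (fun x => - f x) :=
  fun p => (h p).neg

theorem IsCInt.comp {F : ℝ → ℝ} (hF : ContDiff ℝ k F) (h : IsCInt I k f) :
    IsCInt I k (fun x => F (f x)) :=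
  fun p => hF.comp_contDiffOn (h p)

theorem IsC.isDiffAt (h : IsC I 1 f) (x : M) : IsDiffAt I f x := by
  have h1 := (h x).differentiableOn (by norm_num) _ (mem_extChartAt_target (I := I) x)
  exact h1.mono_of_mem_nhdsWithin (extChartAt_target_mem_nhdsWithin x)

theorem eventuallyEq_inChart {p : M} {y : EuclideanSpace ℝ (Fin n)}
    (hy : y ∈ (extChartAt I p).target) (h : f =ᶠ[nhds ((extChartAt I p).symm y)] f') :
    inChart I p f =ᶠ[nhdsWithin y (range I)] inChart I p f' := by
  have h1 := (continuousOn_extChartAt_symm (I := I) p y hy).eventually h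
  rw [nhdsWithin_extChartAt_target_eq_of_mem hy] at h1
  exact h1

theorem IsC.continuous (h : IsC I 0 f) : Continuous f := by
  rw [continuous_iff_continuousAt]
  intro x
  have h1 : ContinuousWithinAt (inChart I x f) (extChartAt I x).target (extChartAt I x x) :=
    (h x).continuousOn _ (mem_extChartAt_target x)
  have h2 : ContinuousWithinAt (fun z => inChart I x f (extChartAt I x z))
      (extChartAt I x).source x :=
    ContinuousWithinAt.comp (g := inChart I x f) (t := (extChartAt I x).target) h1
      (continuousAt_extChartAt (I := I) x).continuousWithinAt (extChartAt I x).mapsTo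
  refine (h2.continuousAt (extChartAt_source_mem_nhds x)).congr ?_
  filter_upwards [extChartAt_source_mem_nhds (I := I) x] with z hz
  exact inChart_apply x hz f

variable [IsManifold I ∞ M]

/-- Interior points are defined through the preferred chart at the point; smoothness of the
transition maps allows any other chart to decide. All interior arguments below can therefore stay in
one fixed chart. -/
theorem mem_interior_iff (p : M) (hx : x ∈ (extChartAt I p).source) :
    x ∈ I.interior M ↔ extChartAt I p x ∈ interior (extChartAt I p).target := by
  have hx' : x ∈ (chartAt H p).source := by rwa [← extChartAt_source I]
  exact I.isInteriorPoint_iff_of_mem_atlas (n := ∞) (by simp) (chart_mem_atlas H p) hx'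

theorem symm_mem_interior_iff (p : M) {y : EuclideanSpace ℝ (Fin n)}
    (hy : y ∈ (extChartAt I p).target) :
    (extChartAt I p).symm y ∈ I.interior M ↔ y ∈ interior (extChartAt I p).target := by
  rw [mem_interior_iff p ((extChartAt I p).map_target hy), (extChartAt I p).right_inv hy]

theorem isOpen_interiorM : IsOpen (I.interior M) :=
  I.isOpen_interior (n := ∞) (by simp)

theorem range_mem_nhds {p : M} {y : EuclideanSpace ℝ (Fin n)}
    (hy : y ∈ interior (extChartAt I p).target) : range I ∈ nhds y :=
  mem_nhds_of_isOpen_subset isOpen_interior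
    (interior_subset.trans (extChartAt_target_subset_range p)) hy

theorem IsCInt.isDiffAt (h : IsCInt I 1 f) (hx : x ∈ I.interior M) : IsDiffAt I f x := by
  have hy := (mem_interior_iff x (mem_extChartAt_source x)).1 hx
  exact (((h x).differentiableOn (by norm_num)).differentiableAt
    (isOpen_interior.mem_nhds hy)).differentiableWithinAt

theorem isC_of_contMDiff (hk : k ≤ ∞) (h : ContMDiff I 𝓘(ℝ, ℝ) k f) : IsC I k f := by
  intro p
  rw [← contMDiffOn_iff_contDiffOn]
  exact h.comp_contMDiffOn ((contMDiffOn_extChartAt_symm (n := ∞) p).of_le hk)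

theorem isCInt_of_contMDiffOn (hk : k ≤ ∞) (h : ContMDiffOn I 𝓘(ℝ, ℝ) k f (I.interior M)) :
    IsCInt I k f := by
  intro p
  rw [← contMDiffOn_iff_contDiffOn]
  refine h.comp (((contMDiffOn_extChartAt_symm (n := ∞) p).of_le hk).mono interior_subset) ?_
  intro y hy
  exact (symm_mem_interior_iff p (interior_subset hy)).2 hy

/-- A function that is regular in the interior and vanishes near the boundary is regular. -/
theorem IsCInt.isC (h : IsCInt I k f) (h0 : ∀ x ∈ I.boundary M, f =ᶠ[nhds x] 0) : IsC I k f := by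
  intro p y hy
  by_cases hyi : y ∈ interior (extChartAt I p).target
  · exact ((h p).contDiffAt (isOpen_interior.mem_nhds hyi)).contDiffWithinAt
  · have hb : (extChartAt I p).symm y ∈ I.boundary M := by
      rw [← I.compl_interior]
      exact fun hc => hyi ((symm_mem_interior_iff p hy).1 hc)
    have h1 := eventuallyEq_inChart hy (h0 _ hb)
    rw [← nhdsWithin_extChartAt_target_eq_of_mem hy] at h1
    have h2 : ContDiffWithinAt ℝ k (fun _ => (0 : ℝ)) (extChartAt I p).target y :=
      contDiffWithinAt_const
    exact h2.congr_of_eventuallyEq h1 (h1.self_of_nhdsWithin hy)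

variable (m : Bundle.ContMDiffRiemannianMetric I ∞ (EuclideanSpace ℝ (Fin n))
    (fun x : M => TangentSpace I x))

/-- The inner product `⟨∇a, ∇b⟩`, computed in the chart around `x`. -/
def gradInner (a b : M → ℝ) (x : M) : ℝ :=
  gradInnerCoord (range I) (gram I m x) (inChart I x a) (inChart I x b) (extChartAt I x x)

theorem mem_overlap {p q x : M} (hp : x ∈ (extChartAt I p).source)
    (hq : x ∈ (extChartAt I q).source) : extChartAt I p x ∈ overlap I p q :=
  ⟨(extChartAt I p).map_source hp, by rwa [mem_preimage, (extChartAt I p).left_inv hp]⟩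

theorem transition_apply {p x : M} (q : M) (hp : x ∈ (extChartAt I p).source) :
    transition I p q (extChartAt I p x) = extChartAt I q x := by
  rw [transition, (extChartAt I p).left_inv hp]

theorem inChart_eventuallyEq_transition {p q : M} {y : EuclideanSpace ℝ (Fin n)}
    (hy : y ∈ overlap I p q) (a : M → ℝ) :
    inChart I p a =ᶠ[nhdsWithin y (range I)] fun z => inChart I q a (transition I p q z) := by
  filter_upwards [overlap_mem_nhdsWithin hy] with z hz
  rw [inChart, inChart, symm_transition hz]

/-- The inner product of gradients can be computed in any chart. -/
theorem gradInner_eq {a b : M → ℝ} (p : M) (hx : x ∈ (extChartAt I p).source)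
    (ha : IsDiffAt I a x) (hb : IsDiffAt I b x) :
    gradInner m a b x = gradInnerCoord (range I) (gram I m p) (inChart I p a) (inChart I p b)
      (extChartAt I p x) := by
  have hy := mem_overlap (I := I) hx (mem_extChartAt_source (I := I) x)
  have ht := transition_apply (I := I) x hx
  unfold gradInner
  rw [← ht]
  symm
  refine gradInnerCoord_comp (I.uniqueDiffOn _ (extChartAt_target_subset_range p hy.1))
    (differentiableWithinAt_transition hy) ?_ (by rw [ht]; exact ha)
    (inChart_eventuallyEq_transition hy a) ?_ (by rw [ht]; exact hb)
    (inChart_eventuallyEq_transition hy b) ?_ (gram_transition m hy)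
    ((isMetricOn_gram m p).isUnit_det hy.1)
  · filter_upwards [overlap_mem_nhdsWithin hy] with z hz
    exact extChartAt_target_subset_range x (transition_mem hz).1
  · rw [inChart, inChart, symm_transition hy]
  · rw [inChart, inChart, symm_transition hy]

theorem isMetricOn_interior (p : M) : IsMetricOn (interior (extChartAt I p).target) (gram I m p) :=
  (isMetricOn_gram m p).mono interior_subset

theorem interior_target_subset (p : M) : interior (extChartAt I p).target ⊆ range I :=
  interior_subset.trans (extChartAt_target_subset_range p)

/-- The Laplacian can be computed in any chart. -/
theorem laplacian_eq {w : M → ℝ} (hw : IsCInt I 2 w) (p : M) (hx : x ∈ (extChartAt I p).source)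
    (hxi : x ∈ I.interior M) :
    laplacian I m w x
      = laplaceCoord (range I) (gram I m p) (inChart I p w) (extChartAt I p x) := by
  have hy := mem_overlap (I := I) hx (mem_extChartAt_source (I := I) x)
  have ht := transition_apply (I := I) x hx
  have hyi := (mem_interior_iff p hx).1 hxi
  have hyo : extChartAt I p x ∈ interior (overlap I p x) := by
    rw [mem_interior_iff_mem_nhds]
    have := overlap_mem_nhdsWithin hy
    rwa [nhdsWithin_eq_nhds.2 (range_mem_nhds hyi)] at this
  have hsub : interior (overlap I p x) ⊆ interior (extChartAt I p).target :=
    interior_mono inter_subset_left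
  have hmaps : MapsTo (transition I p x) (interior (overlap I p x))
      (interior (extChartAt I x).target) := by
    intro z hz
    have hz' := interior_subset hz
    have h1 : (extChartAt I p).symm z ∈ I.interior M :=
      (symm_mem_interior_iff p hz'.1).2 (hsub hz)
    exact (mem_interior_iff x hz'.2).1 h1
  have key := laplaceCoord_comp (S := range I) (τ := transition I p x) (f := inChart I p w)
    ((isMetricOn_interior m p).mono hsub) (isMetricOn_interior m x)
    isOpen_interior isOpen_interior (hsub.trans (interior_target_subset p))
    (interior_target_subset x)
    (fun z hz => ((contDiffWithinAt_transition (interior_subset hz)).of_le two_le_infty).mono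
      (hsub.trans (interior_target_subset p))) hmaps (hw x)
    (fun z hz => by
      change inChart I p w z = inChart I x w (transition I p x z)
      rw [inChart, inChart, symm_transition (interior_subset hz)])
    (fun z hz => gram_transition m (interior_subset hz)) hyo
  rw [key, ht]
  rfl

/-! Calculus of `gradInner`. -/

theorem gradInner_congr {a a' b b' : M → ℝ} (ha : a =ᶠ[nhds x] a') (hb : b =ᶠ[nhds x] b') :
    gradInner m a b x = gradInner m a' b' x := by
  have key : ∀ {a a' : M → ℝ}, a =ᶠ[nhds x] a' → ∀ i,
      partialD (range I) i (inChart I x a) (extChartAt I x x)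
        = partialD (range I) i (inChart I x a') (extChartAt I x x) := by
    intro a a' h i
    have h1 := eventuallyEq_inChart (I := I) (f := a) (f' := a') (mem_extChartAt_target (I := I) x)
      (by rwa [extChartAt_to_inv])
    rw [partialD, partialD, h1.fderivWithin_eq (h1.self_of_nhdsWithin (mem_range_self _))]
  unfold gradInner gradInnerCoord gradCoord
  simp only [key ha, key hb]

theorem laplacian_congr {a a' : M → ℝ} (ha : a =ᶠ[nhds x] a') (hxi : x ∈ I.interior M) :
    laplacian I m a x = laplacian I m a' x := by
  have hyi := (mem_interior_iff x (mem_extChartAt_source x)).1 hxi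
  have hS := range_mem_nhds hyi
  have h1 := eventuallyEq_inChart (I := I) (f := a) (f' := a') (mem_extChartAt_target (I := I) x)
    (by rwa [extChartAt_to_inv])
  rw [nhdsWithin_eq_nhds.2 hS] at h1
  -- The Laplacian differentiates twice, so the first derivatives must agree on a neighbourhood and
  -- not only at the point.
  have h2 : ∀ j, partialD (range I) j (inChart I x a) =ᶠ[nhds (extChartAt I x x)]
      partialD (range I) j (inChart I x a') := by
    intro j
    filter_upwards [h1.eventuallyEq_nhds] with z hz
    rw [partialD, partialD, (hz.filter_mono nhdsWithin_le_nhds).fderivWithin_eq hz.self_of_nhds]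
  unfold laplacian laplaceCoord
  congr 1
  refine Finset.sum_congr rfl fun i _ => Finset.sum_congr rfl fun j _ => ?_
  have h3 : (fun z => Real.sqrt (gram I m x z).det * (gram I m x z)⁻¹ i j
      * partialD (range I) j (inChart I x a) z) =ᶠ[nhds (extChartAt I x x)]
      (fun z => Real.sqrt (gram I m x z).det * (gram I m x z)⁻¹ i j
      * partialD (range I) j (inChart I x a') z) := by
    filter_upwards [h2 j] with z hz
    rw [hz]
  rw [partialD, partialD]
  exact congrArg (fun L : EuclideanSpace ℝ (Fin n) →L[ℝ] ℝ => L (EuclideanSpace.single i 1))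
    ((h3.filter_mono nhdsWithin_le_nhds).fderivWithin_eq h3.self_of_nhds)

theorem gradInner_comm (a b : M → ℝ) (x : M) : gradInner m a b x = gradInner m b a x := by
  unfold gradInner gradInnerCoord gradCoord
  simp only [Finset.mul_sum]
  rw [Finset.sum_comm]
  refine Finset.sum_congr rfl fun i _ => Finset.sum_congr rfl fun j _ => ?_
  rw [(isMetricOn_gram m x).inv_symm (mem_extChartAt_target x)]; ring

theorem uniqueDiffWithinAt_range (x : M) :
    UniqueDiffWithinAt ℝ (range I) (extChartAt I x x) :=
  I.uniqueDiffOn _ (extChartAt_target_subset_range x (mem_extChartAt_target x))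

theorem gradInner_mul_left {a b : M → ℝ} (c : M → ℝ) (ha : IsDiffAt I a x) (hb : IsDiffAt I b x) :
    gradInner m (fun z => a z * b z) c x = a x * gradInner m b c x + b x * gradInner m a c x := by
  have h1 : ∀ i, partialD (range I) i (inChart I x fun z => a z * b z) (extChartAt I x x)
      = a x * partialD (range I) i (inChart I x b) (extChartAt I x x)
        + b x * partialD (range I) i (inChart I x a) (extChartAt I x x) := by
    intro i
    have : inChart I x (fun z => a z * b z) = fun y => inChart I x a y * inChart I x b y := rfl
    rw [partialD, this, fderivWithin_fun_mul (uniqueDiffWithinAt_range x) ha hb,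
      inChart_apply x (mem_extChartAt_source x), inChart_apply x (mem_extChartAt_source x)]
    rfl
  unfold gradInner gradInnerCoord
  simp only [h1, add_mul, Finset.sum_add_distrib, Finset.mul_sum, mul_assoc]

theorem gradInner_sum_left {ι : Type*} (s : Finset ι) {a : ι → M → ℝ} (c : M → ℝ)
    (ha : ∀ j ∈ s, IsDiffAt I (a j) x) :
    gradInner m (fun z => ∑ j ∈ s, a j z) c x = ∑ j ∈ s, gradInner m (a j) c x := by
  have h1 : ∀ i, partialD (range I) i (inChart I x fun z => ∑ j ∈ s, a j z) (extChartAt I x x)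
      = ∑ j ∈ s, partialD (range I) i (inChart I x (a j)) (extChartAt I x x) := by
    intro i
    have : inChart I x (fun z => ∑ j ∈ s, a j z) = fun y => ∑ j ∈ s, inChart I x (a j) y := rfl
    rw [partialD, this, fderivWithin_fun_sum (uniqueDiffWithinAt_range x) ha]
    simp [partialD]
  unfold gradInner gradInnerCoord
  simp only [h1, Finset.sum_mul]
  rw [Finset.sum_comm]

theorem gradInner_comp_left {F : ℝ → ℝ} {F' : ℝ} {a : M → ℝ} (c : M → ℝ)
    (hF : HasDerivAt F F' (a x)) (ha : IsDiffAt I a x) :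
    gradInner m (fun z => F (a z)) c x = F' * gradInner m a c x := by
  have h1 : ∀ i, partialD (range I) i (inChart I x fun z => F (a z)) (extChartAt I x x)
      = F' * partialD (range I) i (inChart I x a) (extChartAt I x x) := by
    intro i
    have h2 : HasDerivAt F F' (inChart I x a (extChartAt I x x)) := by
      rwa [inChart_apply x (mem_extChartAt_source x)]
    have h3 := h2.comp_hasFDerivWithinAt _ ha.hasFDerivWithinAt
    have : inChart I x (fun z => F (a z)) = F ∘ inChart I x a := rfl
    rw [partialD, this, h3.fderivWithin (uniqueDiffWithinAt_range x)]
    rfl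
  unfold gradInner gradInnerCoord
  simp only [h1, mul_assoc, Finset.mul_sum]

theorem gradInner_self_nonneg (a : M → ℝ) (x : M) : 0 ≤ gradInner m a a x := by
  have h := (isMetricOn_gram m x).posDef _ (mem_extChartAt_target x)
  have h2 := h.inv.posSemidef.dotProduct_mulVec_nonneg
    fun i => partialD (range I) i (inChart I x a) (extChartAt I x x)
  rw [star_trivial] at h2
  exact h2

/-! Regularity of `gradInner` and of the Laplacian. -/

theorem continuousOn_partialD_target {p : M} {a : EuclideanSpace ℝ (Fin n) → ℝ}
    (ha : ContDiffOn ℝ 1 a (extChartAt I p).target) (i : Fin n) :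
    ContinuousOn (partialD (range I) i a) (extChartAt I p).target := by
  have h1 : ContinuousOn (fun y => fderivWithin ℝ a (extChartAt I p).target y
      (EuclideanSpace.single i 1)) (extChartAt I p).target :=
    (ha.continuousOn_fderivWithin (uniqueDiffOn_extChartAt_target p) le_rfl).clm_apply
      continuousOn_const
  refine h1.congr fun y hy => ?_
  rw [partialD, ← fderivWithin_congr_set (extChartAt_target_eventuallyEq_of_mem hy)]

theorem continuousOn_gradCoord_target {p : M} {a : EuclideanSpace ℝ (Fin n) → ℝ}
    (ha : ContDiffOn ℝ 1 a (extChartAt I p).target) (i : Fin n) :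
    ContinuousOn (gradCoord (range I) (gram I m p) a i) (extChartAt I p).target :=
  continuousOn_finsetSum _ fun j _ => ((isMetricOn_gram m p).contDiffOn_inv i j).continuousOn.mul
    (continuousOn_partialD_target ha j)

/-- The definition of `gradInner` changes chart with the point, so regularity is not visible from
it. Chart independence replaces it by one coordinate expression on a whole target;
`isCInt_gradInner` and `isCInt_laplacian` proceed in the same way. -/
theorem isC_zero_gradInner {a b : M → ℝ} (ha : IsC I 1 a) (hb : IsC I 1 b) :
    IsC I 0 (gradInner m a b) := by
  intro p
  rw [contDiffOn_zero]
  have h1 : ContinuousOn (gradInnerCoord (range I) (gram I m p) (inChart I p a) (inChart I p b))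
      (extChartAt I p).target :=
    continuousOn_finsetSum _ fun j _ => (continuousOn_partialD_target (ha p) j).mul
      (continuousOn_gradCoord_target m (hb p) j)
  refine h1.congr fun y hy => ?_
  rw [inChart, gradInner_eq m p ((extChartAt I p).map_target hy) (ha.isDiffAt _) (hb.isDiffAt _),
    (extChartAt I p).right_inv hy]

theorem continuous_gradInner {a b : M → ℝ} (ha : IsC I 1 a) (hb : IsC I 1 b) :
    Continuous (gradInner m a b) := (isC_zero_gradInner m ha hb).continuous

theorem isCInt_gradInner {a b : M → ℝ} (hk : k ≤ ∞) (ha : IsCInt I (k + 1) a)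
    (hb : IsCInt I (k + 1) b) : IsCInt I k (gradInner m a b) := by
  intro p
  refine ((isMetricOn_interior m p).contDiffOn_gradInnerCoord isOpen_interior
    (interior_target_subset p) (ha p) (hb p) le_rfl le_rfl hk).congr fun y hy => ?_
  have hy' := interior_subset hy
  have hxi := (symm_mem_interior_iff p hy').2 hy
  rw [inChart, gradInner_eq m p ((extChartAt I p).map_target hy')
    ((ha.of_le (by simp)).isDiffAt hxi) ((hb.of_le (by simp)).isDiffAt hxi),
    (extChartAt I p).right_inv hy']

theorem isCInt_laplacian {a : M → ℝ} (hk : k + 1 ≤ ∞) (ha : IsCInt I (k + 2) a) :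
    IsCInt I k (laplacian I m a) := by
  intro p
  refine ((isMetricOn_interior m p).contDiffOn_laplaceCoord isOpen_interior
    (interior_target_subset p) (ha p) le_rfl hk).congr fun y hy => ?_
  have hy' := interior_subset hy
  have hxi := (symm_mem_interior_iff p hy').2 hy
  rw [inChart, laplacian_eq m (ha.of_le (by simp)) p ((extChartAt I p).map_target hy') hxi,
    (extChartAt I p).right_inv hy']

/-- The **Bochner inequality** under a lower bound of the Ricci curvature. -/
theorem bochner_inequality (hn : 0 < n) {c : ℝ}
    (hRic : ∀ v : TangentSpace I x, c * m.inner x v v ≤ ricci I m x v v)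
    {u : M → ℝ} (hu : IsCInt I 3 u) (hxi : x ∈ I.interior M) :
    laplacian I m u x ^ 2 / n + gradInner m (laplacian I m u) u x + c * gradInner m u u x
      ≤ (1 / 2 : ℝ) * laplacian I m (gradInner m u u) x := by
  have hyi := (mem_interior_iff x (mem_extChartAt_source x)).1 hxi
  have hmet := isMetricOn_interior m x
  have hb := hmet.bochner isOpen_interior (interior_target_subset x) (hu x) hyi hn
  have hu1 : IsCInt I 1 u := hu.of_le (by norm_num)
  have hu2 : IsCInt I 2 u := hu.of_le (by norm_num)
  have e1 : EqOn (inChart I x (laplacian I m u))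
      (laplaceCoord (range I) (gram I m x) (inChart I x u)) (interior (extChartAt I x).target) := by
    intro y hy
    have hy' := interior_subset hy
    rw [inChart, laplacian_eq m hu2 x ((extChartAt I x).map_target hy')
      ((symm_mem_interior_iff x hy').2 hy), (extChartAt I x).right_inv hy']
  have e2 : EqOn (inChart I x (gradInner m u u))
      (gradInnerCoord (range I) (gram I m x) (inChart I x u) (inChart I x u))
      (interior (extChartAt I x).target) := by
    intro y hy
    have hy' := interior_subset hy
    have hzi := (symm_mem_interior_iff x hy').2 hy
    rw [inChart, gradInner_eq m x ((extChartAt I x).map_target hy')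
      (hu1.isDiffAt hzi) (hu1.isDiffAt hzi), (extChartAt I x).right_inv hy']
  have e3 : laplacian I m (gradInner m u u) x = laplaceCoord (range I) (gram I m x)
      (gradInnerCoord (range I) (gram I m x) (inChart I x u) (inChart I x u))
      (extChartAt I x x) := by
    have hsq : ContDiffOn ℝ 2 (gradInnerCoord (range I) (gram I m x) (inChart I x u)
        (inChart I x u)) (interior (extChartAt I x).target) :=
      hmet.contDiffOn_gradInnerCoord isOpen_interior (interior_target_subset x) (hu x) (hu x)
        (by norm_num) (by norm_num) two_le_infty
    change laplaceCoord (range I) (gram I m x) (inChart I x (gradInner m u u)) _ = _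
    have hX : ∀ k, EqOn (gradCoord (range I) (gram I m x) (inChart I x (gradInner m u u)) k)
        (gradCoord (range I) (gram I m x) (gradInnerCoord (range I) (gram I m x) (inChart I x u)
        (inChart I x u)) k) (interior (extChartAt I x).target) := by
      intro k z hz
      unfold gradCoord
      exact Finset.sum_congr rfl fun j _ => by
        rw [partialD_congr_of_eqOn isOpen_interior e2 hz]
    rw [hmet.laplaceCoord_eq isOpen_interior (interior_target_subset x) (hsq.congr e2) hyi,
      hmet.laplaceCoord_eq isOpen_interior (interior_target_subset x) hsq hyi]
    congr 1
    · exact Finset.sum_congr rfl fun k _ => partialD_congr_of_eqOn isOpen_interior (hX k) hyi k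
    · exact Finset.sum_congr rfl fun k _ => by rw [hX k hyi]
  have e4 : gradInner m (laplacian I m u) u x = gradInnerCoord (range I) (gram I m x)
      (laplaceCoord (range I) (gram I m x) (inChart I x u)) (inChart I x u) (extChartAt I x x) := by
    unfold gradInner gradInnerCoord
    exact Finset.sum_congr rfl fun i _ => by rw [partialD_congr_of_eqOn isOpen_interior e1 hyi]
  -- The Ricci bound is applied to the gradient vector: `X` holds its coordinates, `e5` identifies
  -- the Ricci term and `e6` the squared length.
  set X : EuclideanSpace ℝ (Fin n) := WithLp.toLp 2 fun i =>
    gradCoord (range I) (gram I m x) (inChart I x u) i (extChartAt I x x) with hX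
  have hr := hRic (chartD I x (extChartAt I x x) X)
  have e5 : ricci I m x (chartD I x (extChartAt I x x) X) (chartD I x (extChartAt I x x) X)
      = ∑ i, ∑ j, ricciCoord (range I) (gram I m x) i j (extChartAt I x x)
        * gradCoord (range I) (gram I m x) (inChart I x u) i (extChartAt I x x)
        * gradCoord (range I) (gram I m x) (inChart I x u) j (extChartAt I x x) := by
    unfold ricci
    rw [coordsOf_chartD]
  have e6 : m.inner x (chartD I x (extChartAt I x x) X) (chartD I x (extChartAt I x x) X)
      = gradInner m u u x := by
    have h1 := metricForm_chartD m x (extChartAt I x x) X X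
    rw [extChartAt_to_inv] at h1
    refine h1.trans ?_
    unfold gradInner gradInnerCoord
    refine Finset.sum_congr rfl fun i _ => ?_
    rw [← (isMetricOn_gram m x).sum_mul_gradCoord (S := range I) (f := inChart I x u)
      (mem_extChartAt_target x) i, Finset.sum_mul]
    exact Finset.sum_congr rfl fun j _ => by rw [hX]; ring
  rw [e5, e6] at hr
  rw [e3, e4]
  change laplaceCoord (range I) (gram I m x) (inChart I x u) (extChartAt I x x) ^ 2 / n + _ + _ ≤ _
  linarith

end Functions

/-! ### Gluing measures and push-forwards of measures with density -/

section Glue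

/-- If the measures `ν i` live on `U i` and agree on overlaps, then their supremum restricts to
each of them. -/
theorem iSup_restrict_eq {X ι : Type*} [MeasurableSpace X] {ν : ι → Measure X} {U : ι → Set X}
    (hU : ∀ i, MeasurableSet (U i)) (hν : ∀ i, ν i (U i)ᶜ = 0)
    (hc : ∀ i j A, MeasurableSet A → A ⊆ U i ∩ U j → ν i A = ν j A) (i : ι) :
    (⨆ j, ν j).restrict (U i) = ν i := by
  have hself : (ν i).restrict (U i) = ν i := Measure.restrict_eq_self_of_ae_mem (hν i)
  refine le_antisymm ?_ ?_
  · have h1 : (⨆ j, ν j) ≤ ν i + (⊤ : Measure X).restrict (U i)ᶜ := by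
      refine iSup_le fun j => Measure.le_iff.2 fun A hA => ?_
      rw [← measure_inter_add_sdiff A (hU i)]
      refine add_le_add ?_ ?_
      · have h2 : ν j (A ∩ U i) = ν j (A ∩ U i ∩ U j) := by
          rw [← measure_inter_add_sdiff (A ∩ U i) (hU j)]
          have : ν j ((A ∩ U i) \ U j) = 0 := measure_mono_null (fun x hx => hx.2) (hν j)
          rw [this, add_zero]
        rw [h2, hc j i _ ((hA.inter (hU i)).inter (hU j)) fun x hx => ⟨hx.2, hx.1.2⟩]
        exact measure_mono fun x hx => hx.1.1
      · change ν j (A \ U i) ≤ (⊤ : Measure X).restrict (U i)ᶜ A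
        rw [Measure.restrict_apply hA]
        exact (le_top : ν j ≤ ⊤) _
    refine (Measure.restrict_mono le_rfl h1).trans ?_
    rw [Measure.restrict_add, hself, Measure.restrict_restrict (hU i), inter_compl_self,
      Measure.restrict_empty, add_zero]
  · conv_lhs => rw [← hself]
    exact Measure.restrict_mono le_rfl (le_iSup ν i)

variable {V X : Type*} [MeasurableSpace V] [TopologicalSpace V] [BorelSpace V]
  [TopologicalSpace X] [MeasurableSpace X] [BorelSpace X]
  {μ : Measure V} [SFinite μ] {T : Set V} {ρ : V → ENNReal} {g : V → X}

theorem measurableSet_inter_preimage (hT : MeasurableSet T) (hg : ContinuousOn g T) {A : Set X}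
    (hA : MeasurableSet A) : MeasurableSet (T ∩ g ⁻¹' A) := by
  have h1 : MeasurableSet (T.domRestrict g ⁻¹' A) :=
    (continuousOn_iff_continuous_domRestrict.1 hg).measurable hA
  have h2 : T ∩ g ⁻¹' A = Subtype.val '' (T.domRestrict g ⁻¹' A) := by
    ext x
    simp only [mem_inter_iff, mem_preimage, mem_image, Subtype.exists,
      exists_and_right, exists_eq_right]
    exact ⟨fun h => ⟨h.1, h.2⟩, fun ⟨h, h'⟩ => ⟨h, h'⟩⟩
  rw [h2]
  exact hT.subtype_image h1

theorem aemeasurable_withDensity (hT : MeasurableSet T) (hg : ContinuousOn g T) :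
    AEMeasurable g ((μ.restrict T).withDensity ρ) :=
  (hg.aemeasurable hT).mono_ac (withDensity_absolutelyContinuous _ _)

theorem map_withDensity_apply (hT : MeasurableSet T) (hg : ContinuousOn g T) {A : Set X}
    (hA : MeasurableSet A) :
    ((μ.restrict T).withDensity ρ).map g A = ∫⁻ y in T ∩ g ⁻¹' A, ρ y ∂μ := by
  rw [Measure.map_apply_of_aemeasurable (aemeasurable_withDensity hT hg) hA,
    withDensity_apply', Measure.restrict_restrict' hT, inter_comm]

theorem integral_map_withDensity (hT : MeasurableSet T) (hg : ContinuousOn g T) {r : V → ℝ}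
    (hr : ContinuousOn r T) (hr0 : ∀ y ∈ T, 0 ≤ r y) {F : X → ℝ} (hF : Continuous F) :
    ∫ x, F x ∂((μ.restrict T).withDensity fun y => ENNReal.ofReal (r y)).map g
      = ∫ y in T, r y * F (g y) ∂μ := by
  rw [integral_map (aemeasurable_withDensity hT hg) hF.aestronglyMeasurable,
    integral_withDensity_eq_integral_toReal_smul₀
      (hr.aemeasurable hT).ennreal_ofReal (by simp)]
  refine setIntegral_congr_fun hT fun y hy => ?_
  simp [ENNReal.toReal_ofReal (hr0 y hy)]

end Glue

/-! ### The Riemannian measure -/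

section Volume

variable {n : ℕ} {H : Type*} [TopologicalSpace H]
  {I : ModelWithCorners ℝ (EuclideanSpace ℝ (Fin n)) H}
  {M : Type*} [TopologicalSpace M] [ChartedSpace H M] [IsManifold I ∞ M]
  [MeasurableSpace M] [BorelSpace M]
  (m : Bundle.ContMDiffRiemannianMetric I ∞ (EuclideanSpace ℝ (Fin n))
    (fun x : M => TangentSpace I x))

theorem measurableSet_target (p : M) : MeasurableSet (extChartAt I p).target := by
  rw [extChartAt_target]
  exact ((chartAt H p).open_target.preimage I.continuous_symm).measurableSet.inter
    I.isClosed_range.measurableSet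

theorem measurableSet_source (p : M) : MeasurableSet (extChartAt I p).source :=
  (isOpen_extChartAt_source p).measurableSet

theorem chartVolume_apply (p : M) {A : Set M} (hA : MeasurableSet A) :
    chartVolume I m p A = ∫⁻ y in (extChartAt I p).target ∩ (extChartAt I p).symm ⁻¹' A,
      ENNReal.ofReal (Real.sqrt (gram I m p y).det) :=
  map_withDensity_apply (measurableSet_target p) (continuousOn_extChartAt_symm p) hA

theorem det_eq_det_jacobianMat {S : Set (EuclideanSpace ℝ (Fin n))}
    {τ : EuclideanSpace ℝ (Fin n) → EuclideanSpace ℝ (Fin n)} (y : EuclideanSpace ℝ (Fin n)) :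
    (fderivWithin ℝ τ S y).det = (jacobianMat S τ y).det := by
  rw [ContinuousLinearMap.det, ← LinearMap.det_toMatrix
    (EuclideanSpace.basisFun (Fin n) ℝ).toBasis]
  rfl

/-- Change of variables: `det(JᵀPJ) = (det J)² det P`, so the density `√det` picks up exactly the
factor `|det J|` of the integral transformation formula. -/
theorem chartVolume_compat (p q : M) {A : Set M} (hA : MeasurableSet A)
    (hApq : A ⊆ (extChartAt I p).source ∩ (extChartAt I q).source) :
    chartVolume I m p A = chartVolume I m q A := by
  rw [chartVolume_apply m p hA, chartVolume_apply m q hA]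
  set B := (extChartAt I p).target ∩ (extChartAt I p).symm ⁻¹' A with hB
  have hBo : ∀ y ∈ B, y ∈ overlap I p q := fun y hy => ⟨hy.1, (hApq hy.2).2⟩
  have hBm : MeasurableSet B :=
    measurableSet_inter_preimage (measurableSet_target p) (continuousOn_extChartAt_symm p) hA
  have himg : (extChartAt I q).target ∩ (extChartAt I q).symm ⁻¹' A = transition I p q '' B := by
    ext z
    constructor
    · rintro ⟨hz, hzA⟩
      have hzo : z ∈ overlap I q p := ⟨hz, (hApq hzA).1⟩
      refine ⟨transition I q p z, ⟨(transition_mem hzo).1, ?_⟩, transition_transition hzo⟩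
      rw [mem_preimage, symm_transition hzo]
      exact hzA
    · rintro ⟨y, hy, rfl⟩
      refine ⟨(transition_mem (hBo y hy)).1, ?_⟩
      rw [mem_preimage, symm_transition (hBo y hy)]
      exact hy.2
  have hinj : InjOn (transition I p q) B := by
    intro y hy z hz hyz
    rw [← transition_transition (hBo y hy), ← transition_transition (hBo z hz), hyz]
  have hBS : B ⊆ range I := fun y hy => extChartAt_target_subset_range p hy.1
  rw [himg, lintegral_image_eq_lintegral_abs_det_fderiv_mul volume hBm
    (fun y hy => ((differentiableWithinAt_transition (hBo y hy)).hasFDerivWithinAt).mono hBS) hinj]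
  refine setLIntegral_congr_fun hBm fun y hy => ?_
  simp only [det_eq_det_jacobianMat]
  rw [gram_transition m (hBo y hy), Matrix.det_mul, Matrix.det_mul, Matrix.det_transpose,
    ← ENNReal.ofReal_mul (abs_nonneg _)]
  congr 1
  rw [show ∀ a b : ℝ, a * b * a = a ^ 2 * b from fun a b => by ring,
    Real.sqrt_mul (sq_nonneg _), Real.sqrt_sq_eq_abs]

theorem chartVolume_compl (p : M) : chartVolume I m p (extChartAt I p).sourceᶜ = 0 := by
  rw [chartVolume_apply m p (measurableSet_source p).compl]
  have : (extChartAt I p).target ∩ (extChartAt I p).symm ⁻¹' (extChartAt I p).sourceᶜ = ∅ := by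
    ext y
    simp only [mem_inter_iff, mem_preimage, mem_compl_iff, mem_empty_iff_false, iff_false, not_and,
      not_not]
    exact fun hy => (extChartAt I p).map_target hy
  rw [this]; simp

theorem riemVolume_restrict (p : M) :
    (riemVolume I m).restrict (extChartAt I p).source = chartVolume I m p :=
  iSup_restrict_eq (ν := chartVolume I m) (U := fun p => (extChartAt I p).source)
    (fun p => measurableSet_source p) (chartVolume_compl m)
    (fun p q _ hA hApq => chartVolume_compat m p q hA hApq) p

theorem riemVolume_apply (p : M) {A : Set M} (hA : MeasurableSet A)
    (hAp : A ⊆ (extChartAt I p).source) : riemVolume I m A = chartVolume I m p A := by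
  rw [← riemVolume_restrict, Measure.restrict_apply hA, inter_eq_left.2 hAp]

theorem integral_riemVolume (p : M) {F : M → ℝ} (hF : Continuous F)
    (hF0 : ∀ x, x ∉ (extChartAt I p).source → F x = 0) :
    ∫ x, F x ∂(riemVolume I m)
      = ∫ y in (extChartAt I p).target, Real.sqrt (gram I m p y).det * inChart I p F y := by
  rw [← setIntegral_eq_integral_of_forall_compl_eq_zero hF0, riemVolume_restrict m p]
  exact integral_map_withDensity (measurableSet_target p) (continuousOn_extChartAt_symm p)
    (isMetricOn_gram m p).contDiffOn_sqrt_det.continuousOn (fun _ _ => Real.sqrt_nonneg _) hF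

/-- By compactness finiteness is local, and in a chart the continuous density is integrated over the
compact image of a compact neighbourhood. -/
theorem isFiniteMeasure_riemVolume [T2Space M] [CompactSpace M] :
    IsFiniteMeasure (riemVolume I m) := by
  refine ⟨isCompact_univ.measure_lt_top_of_nhdsWithin fun x _ => ?_⟩
  rw [nhdsWithin_univ]
  obtain ⟨K, hK, hKs, hKx⟩ := local_compact_nhds (extChartAt_source_mem_nhds (I := I) x)
  refine ⟨K, hK, ?_⟩
  rw [riemVolume_apply m x hKx.measurableSet hKs, chartVolume_apply m x hKx.measurableSet]
  have himg : (extChartAt I x).target ∩ (extChartAt I x).symm ⁻¹' K = extChartAt I x '' K := by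
    ext y
    constructor
    · exact fun hy => ⟨_, hy.2, (extChartAt I x).right_inv hy.1⟩
    · rintro ⟨z, hz, rfl⟩
      refine ⟨(extChartAt I x).map_source (hKs hz), ?_⟩
      rwa [mem_preimage, (extChartAt I x).left_inv (hKs hz)]
  have hc : IsCompact (extChartAt I x '' K) :=
    hKx.image_of_continuousOn ((continuousOn_extChartAt x).mono hKs)
  rw [himg]
  refine Integrable.lintegral_lt_top ?_
  refine ContinuousOn.integrableOn_compact hc
    ((isMetricOn_gram m x).contDiffOn_sqrt_det.continuousOn.mono ?_)
  rw [← himg]; exact inter_subset_left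

end Volume

/-! ### The Riemannian measure of the boundary -/

section BoundaryMeasure

variable {d : ℕ} {H : Type*} [TopologicalSpace H]
  {I : ModelWithCorners ℝ (EuclideanSpace ℝ (Fin (d + 1))) H}
  {M : Type*} [TopologicalSpace M] [ChartedSpace H M] [IsManifold I ∞ M]

/-- The inclusion of the hyperplane `y 0 = 0`, as a continuous linear map. -/
def inclL (d : ℕ) : (Fin d → ℝ) →L[ℝ] EuclideanSpace ℝ (Fin (d + 1)) :=
  LinearMap.toContinuousLinearMap
    { toFun := hyperplaneIncl
      map_add' := fun z w => by
        ext i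
        refine Fin.cases ?_ (fun i => ?_) i <;> simp [hyperplaneIncl]
      map_smul' := fun c z => by
        ext i
        refine Fin.cases ?_ (fun i => ?_) i <;> simp [hyperplaneIncl] }

/-- The projection `y ↦ (y 1, …, y d)`. -/
def tailL (d : ℕ) : EuclideanSpace ℝ (Fin (d + 1)) →L[ℝ] (Fin d → ℝ) :=
  ContinuousLinearMap.pi fun i => EuclideanSpace.proj i.succ

@[simp] theorem inclL_apply (z : Fin d → ℝ) : inclL d z = hyperplaneIncl z := rfl

@[simp] theorem tailL_apply (y : EuclideanSpace ℝ (Fin (d + 1))) (i : Fin d) :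
    tailL d y i = y i.succ := rfl

@[simp] theorem hyperplaneIncl_zero (z : Fin d → ℝ) : hyperplaneIncl z 0 = 0 := rfl

@[simp] theorem hyperplaneIncl_succ (z : Fin d → ℝ) (i : Fin d) :
    hyperplaneIncl z i.succ = z i := rfl

theorem tailL_hyperplaneIncl (z : Fin d → ℝ) : tailL d (hyperplaneIncl z) = z := rfl

theorem hyperplaneIncl_tailL {y : EuclideanSpace ℝ (Fin (d + 1))} (hy : y 0 = 0) :
    hyperplaneIncl (tailL d y) = y := by
  ext i
  refine Fin.cases ?_ (fun i => ?_) i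
  · simp [hy]
  · simp

theorem continuous_hyperplaneIncl : Continuous (hyperplaneIncl (d := d)) := (inclL d).continuous

theorem hyperplaneIncl_single (j : Fin d) :
    hyperplaneIncl (Pi.single j 1) = EuclideanSpace.single j.succ (1 : ℝ) := by
  ext i
  refine Fin.cases ?_ (fun i => ?_) i
  · simp [Fin.succ_ne_zero]
  · simp [Pi.single_apply]

variable (hI : range I = univ ∨ range I = {y : EuclideanSpace ℝ (Fin (d + 1)) | 0 ≤ y 0})

theorem continuous_coord (i : Fin (d + 1)) :
    Continuous fun y : EuclideanSpace ℝ (Fin (d + 1)) => y i :=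
  (EuclideanSpace.proj i : EuclideanSpace ℝ (Fin (d + 1)) →L[ℝ] ℝ).continuous

include hI in
-- At a boundary point `range I` cannot be a neighbourhood of the coordinates. This excludes the
-- boundaryless model, and in the half-space it excludes `0 < y 0`.
theorem eq_zero_of_symm_mem_boundary {p : M} {y : EuclideanSpace ℝ (Fin (d + 1))}
    (hy : y ∈ (extChartAt I p).target) (hb : (extChartAt I p).symm y ∈ I.boundary M) :
    range I = {y : EuclideanSpace ℝ (Fin (d + 1)) | 0 ≤ y 0} ∧ y 0 = 0 := by
  have hni : range I ∉ nhds y := by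
    intro hn
    rw [← I.compl_interior, mem_compl_iff, symm_mem_interior_iff p hy] at hb
    apply hb
    rw [mem_interior_iff_mem_nhds]
    have := extChartAt_target_mem_nhdsWithin_of_mem hy
    rwa [nhdsWithin_eq_nhds.2 hn] at this
  rcases hI with h | h
  · rw [h] at hni; exact absurd Filter.univ_mem hni
  · refine ⟨h, ?_⟩
    have h0 : 0 ≤ y 0 := by
      have := extChartAt_target_subset_range p hy
      rw [h] at this; exact this
    by_contra hne
    have hpos : 0 < y 0 := lt_of_le_of_ne h0 (Ne.symm hne)
    apply hni
    rw [h]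
    filter_upwards [(isOpen_lt continuous_const (continuous_coord 0)).mem_nhds hpos] with z hz
    exact le_of_lt hz

/-- Moving from a point of the hyperplane along `-e_0` leaves the half-space at once, so the target
is no neighbourhood of it. -/
theorem symm_mem_boundary_of_eq_zero
    (hS : range I = {y : EuclideanSpace ℝ (Fin (d + 1)) | 0 ≤ y 0}) {p : M}
    {y : EuclideanSpace ℝ (Fin (d + 1))} (hy : y ∈ (extChartAt I p).target) (h0 : y 0 = 0) :
    (extChartAt I p).symm y ∈ I.boundary M := by
  rw [← I.compl_interior, mem_compl_iff, symm_mem_interior_iff p hy]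
  intro hi
  have h1 := range_mem_nhds hi
  rw [hS] at h1
  have h2 : Filter.Tendsto (fun t : ℝ => y - t • EuclideanSpace.single (0 : Fin (d + 1)) (1 : ℝ))
      (nhdsWithin 0 (Ioi 0)) (nhds y) := by
    have : Continuous fun t : ℝ => y - t • EuclideanSpace.single (0 : Fin (d + 1)) (1 : ℝ) := by
      fun_prop
    have h3 := this.tendsto 0
    simp only [zero_smul, sub_zero] at h3
    exact h3.mono_left nhdsWithin_le_nhds
  obtain ⟨t, ht, ht0⟩ := ((h2.eventually h1).and self_mem_nhdsWithin).exists
  simp only [PiLp.sub_apply, PiLp.smul_apply, h0, smul_eq_mul] at ht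
  simp at ht
  exact absurd ht0 (not_lt.2 ht)

/-- The coordinates of the boundary points in the chart around `p`. -/
def boundaryTarget (I : ModelWithCorners ℝ (EuclideanSpace ℝ (Fin (d + 1))) H) (p : M) :
    Set (Fin d → ℝ) :=
  {z | hyperplaneIncl z ∈ (extChartAt I p).target ∧
    (extChartAt I p).symm (hyperplaneIncl z) ∈ I.boundary M}

theorem continuousOn_symm_hyperplaneIncl (p : M) :
    ContinuousOn (fun z => (extChartAt I p).symm (hyperplaneIncl z)) (boundaryTarget I p) :=
  (continuousOn_extChartAt_symm p).comp continuous_hyperplaneIncl.continuousOn fun _ hz => hz.1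

include hI in
-- As soon as a chart meets the boundary, the model is the half-space, and then the boundary
-- condition holds automatically on the hyperplane. Openness of the set of boundary coordinates
-- follows.
theorem boundaryTarget_eq (p : M) : boundaryTarget I p = ∅ ∨
    (range I = {y : EuclideanSpace ℝ (Fin (d + 1)) | 0 ≤ y 0} ∧
      boundaryTarget I p = hyperplaneIncl ⁻¹' (extChartAt I p).target) := by
  rcases (boundaryTarget I p).eq_empty_or_nonempty with h | ⟨z, hz⟩
  · exact Or.inl h
  · have hS := (eq_zero_of_symm_mem_boundary hI hz.1 hz.2).1
    refine Or.inr ⟨hS, ?_⟩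
    ext w
    exact ⟨fun hw => hw.1, fun hw => ⟨hw, symm_mem_boundary_of_eq_zero hS hw rfl⟩⟩

include hI in
theorem isOpen_boundaryTarget (p : M) : IsOpen (boundaryTarget I p) := by
  rcases boundaryTarget_eq hI p with h | ⟨hS, h⟩
  · rw [h]; exact isOpen_empty
  · rw [h]
    have : hyperplaneIncl ⁻¹' (extChartAt I p).target
        = hyperplaneIncl (d := d) ⁻¹' (I.symm ⁻¹' (chartAt H p).target) := by
      rw [extChartAt_target, preimage_inter, inter_eq_left]
      intro z _
      rw [mem_preimage, hS]
      simp
    rw [this]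
    exact ((chartAt H p).open_target.preimage I.continuous_symm).preimage continuous_hyperplaneIncl

variable [MeasurableSpace M] [BorelSpace M]
  (m : Bundle.ContMDiffRiemannianMetric I ∞ (EuclideanSpace ℝ (Fin (d + 1)))
    (fun x : M => TangentSpace I x))

/-- The volume density of the boundary in the chart around `p`. -/
def areaDensity (p : M) (z : Fin d → ℝ) : ℝ :=
  Real.sqrt ((gram I m p (hyperplaneIncl z)).submatrix Fin.succ Fin.succ).det

theorem continuousOn_matrix_det {X ι : Type*} [TopologicalSpace X] [Fintype ι] [DecidableEq ι]
    {s : Set X} {A : X → Matrix ι ι ℝ} (h : ∀ i j, ContinuousOn (fun x => A x i j) s) :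
    ContinuousOn (fun x => (A x).det) s := by
  simp only [Matrix.det_apply]
  exact continuousOn_finsetSum _ fun σ _ =>
    (continuousOn_finsetProd _ fun i _ => h _ _).const_smul _

theorem continuousOn_areaDensity (p : M) :
    ContinuousOn (areaDensity m p) (hyperplaneIncl ⁻¹' (extChartAt I p).target) := by
  have h1 : ContinuousOn (fun y => ((gram I m p y).submatrix Fin.succ Fin.succ).det)
      (extChartAt I p).target :=
    continuousOn_matrix_det fun i j => ((isMetricOn_gram m p).smooth i.succ j.succ).continuousOn
  exact Real.continuous_sqrt.comp_continuousOn
    (h1.comp continuous_hyperplaneIncl.continuousOn fun _ hz => hz)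

include hI

theorem chartArea_apply (p : M) {A : Set M} (hA : MeasurableSet A) :
    chartArea I m p A = ∫⁻ z in boundaryTarget I p
      ∩ (fun z => (extChartAt I p).symm (hyperplaneIncl z)) ⁻¹' A,
      ENNReal.ofReal (areaDensity m p z) :=
  map_withDensity_apply (isOpen_boundaryTarget hI p).measurableSet
    (continuousOn_symm_hyperplaneIncl p) hA

/-- Transition maps send boundary points to boundary points, hence hyperplane to hyperplane.
Dropping the zeroth coordinate thus loses nothing, and they induce changes of coordinates on `ℝᵈ`.
-/
theorem transition_boundary {p q : M} {z : Fin d → ℝ} (hz : z ∈ boundaryTarget I p)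
    (hq : (extChartAt I p).symm (hyperplaneIncl z) ∈ (extChartAt I q).source) :
    hyperplaneIncl (tailL d (transition I p q (hyperplaneIncl z)))
      = transition I p q (hyperplaneIncl z) := by
  have ho : hyperplaneIncl z ∈ overlap I p q := ⟨hz.1, hq⟩
  refine hyperplaneIncl_tailL (eq_zero_of_symm_mem_boundary hI (transition_mem ho).1 ?_).2
  rw [symm_transition ho]
  exact hz.2

/-- The change of coordinates on the boundary. -/
theorem areaDensity_transition {p q : M} {z : Fin d → ℝ} (hz : z ∈ boundaryTarget I p)
    (hq : (extChartAt I p).symm (hyperplaneIncl z) ∈ (extChartAt I q).source) :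
    areaDensity m p z = |((tailL d ∘L fderivWithin ℝ (transition I p q) (range I)
        (hyperplaneIncl z)) ∘L inclL d).det|
      * areaDensity m q (tailL d (transition I p q (hyperplaneIncl z))) := by
  have ho : hyperplaneIncl z ∈ overlap I p q := ⟨hz.1, hq⟩
  have hS := (eq_zero_of_symm_mem_boundary hI hz.1 hz.2).1
  set J := jacobianMat (range I) (transition I p q) (hyperplaneIncl z) with hJ
  have hO : {w | w ∈ boundaryTarget I p ∧
      (extChartAt I p).symm (hyperplaneIncl w) ∈ (extChartAt I q).source} ∈ nhds z := by
    have h1 := ((continuousOn_symm_hyperplaneIncl (I := I) p) z hz).preimage_mem_nhdsWithin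
      ((isOpen_extChartAt_source (I := I) q).mem_nhds hq)
    rw [nhdsWithin_eq_nhds.2 ((isOpen_boundaryTarget hI p).mem_nhds hz)] at h1
    exact Filter.inter_mem ((isOpen_boundaryTarget hI p).mem_nhds hz) h1
  -- The zeroth component of the transition vanishes identically on the hyperplane near `z`, so its
  -- tangential derivatives vanish. Consequently the tangential block of the Gram matrix transforms
  -- by the tangential block of `J` alone.
  have hJ0 : ∀ j : Fin d, J 0 j.succ = 0 := by
    intro j
    have h1 : HasFDerivWithinAt (fun w => transition I p q (hyperplaneIncl w))
        ((fderivWithin ℝ (transition I p q) (range I) (hyperplaneIncl z)).comp (inclL d)) univ z :=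
      HasFDerivWithinAt.comp (g := transition I p q) (t := range I) z
        (differentiableWithinAt_transition ho).hasFDerivWithinAt
        (inclL d).hasFDerivAt.hasFDerivWithinAt (by
          intro w _
          rw [hS]
          simp)
    rw [hasFDerivWithinAt_univ] at h1
    have h2 := (EuclideanSpace.proj (0 : Fin (d + 1)) :
      EuclideanSpace ℝ (Fin (d + 1)) →L[ℝ] ℝ).hasFDerivAt.comp z h1
    have h3 : (fun w => transition I p q (hyperplaneIncl w) 0) =ᶠ[nhds z] fun _ => (0 : ℝ) := by
      filter_upwards [hO] with w hw
      rw [← transition_boundary hI hw.1 hw.2]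
      rfl
    have h4 := (h2.congr_of_eventuallyEq h3.symm).unique (hasFDerivAt_const (0 : ℝ) z)
    have h5 := congrArg (fun L : (Fin d → ℝ) →L[ℝ] ℝ => L (Pi.single j 1)) h4
    simp only [ContinuousLinearMap.comp_apply, inclL_apply, hyperplaneIncl_single] at h5
    exact h5
  have hdet : ((tailL d ∘L fderivWithin ℝ (transition I p q) (range I)
        (hyperplaneIncl z)) ∘L inclL d).det = (J.submatrix Fin.succ Fin.succ).det := by
    rw [ContinuousLinearMap.det, ← LinearMap.det_toMatrix (Pi.basisFun ℝ (Fin d))]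
    congr 1
    ext a i
    simp only [LinearMap.toMatrix_apply, Pi.basisFun_repr, Pi.basisFun_apply]
    change fderivWithin ℝ (transition I p q) (range I) (hyperplaneIncl z)
      (hyperplaneIncl (Pi.single i 1)) a.succ = _
    rw [hyperplaneIncl_single]
    rfl
  have hsub : (gram I m p (hyperplaneIncl z)).submatrix Fin.succ Fin.succ
      = (J.submatrix Fin.succ Fin.succ).transpose
        * (gram I m q (transition I p q (hyperplaneIncl z))).submatrix Fin.succ Fin.succ
        * J.submatrix Fin.succ Fin.succ := by
    ext i j
    rw [gram_transition m ho]
    simp only [Matrix.submatrix_apply, Matrix.mul_apply, Matrix.transpose_apply]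
    rw [← hJ]
    simp only [Fin.sum_univ_succ, hJ0, mul_zero, zero_mul, zero_add]
  unfold areaDensity
  rw [hsub, hdet, transition_boundary hI hz hq, Matrix.det_mul, Matrix.det_mul,
    Matrix.det_transpose, show ∀ a b : ℝ, a * b * a = a ^ 2 * b from fun a b => by ring,
    Real.sqrt_mul (sq_nonneg _), Real.sqrt_sq_eq_abs]

theorem chartArea_compat (p q : M) {A : Set M} (hA : MeasurableSet A)
    (hApq : A ⊆ (extChartAt I p).source ∩ (extChartAt I q).source) :
    chartArea I m p A = chartArea I m q A := by
  rw [chartArea_apply hI m p hA, chartArea_apply hI m q hA]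
  set τ : (Fin d → ℝ) → Fin d → ℝ := fun z => tailL d (transition I p q (hyperplaneIncl z)) with hτ
  set B := boundaryTarget I p ∩ (fun z => (extChartAt I p).symm (hyperplaneIncl z)) ⁻¹' A with hB
  have hBm : MeasurableSet B :=
    measurableSet_inter_preimage (isOpen_boundaryTarget hI p).measurableSet
      (continuousOn_symm_hyperplaneIncl p) hA
  have hBo : ∀ z ∈ B, hyperplaneIncl z ∈ overlap I p q := fun z hz => ⟨hz.1.1, (hApq hz.2).2⟩
  have himg : boundaryTarget I q ∩ (fun z => (extChartAt I q).symm (hyperplaneIncl z)) ⁻¹' A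
      = τ '' B := by
    ext w
    constructor
    · rintro ⟨hw, hwA⟩
      have hwo : hyperplaneIncl w ∈ overlap I q p := ⟨hw.1, (hApq hwA).1⟩
      have ht := transition_boundary hI hw (hApq hwA).1
      refine ⟨tailL d (transition I q p (hyperplaneIncl w)), ⟨⟨?_, ?_⟩, ?_⟩, ?_⟩
      · rw [ht]; exact (transition_mem hwo).1
      · rw [ht, symm_transition hwo]; exact hw.2
      · rw [mem_preimage, ht, symm_transition hwo]; exact hwA
      · rw [hτ]
        simp only
        rw [ht, transition_transition hwo, tailL_hyperplaneIncl]
    · rintro ⟨z, hz, rfl⟩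
      have ht := transition_boundary hI hz.1 (hApq hz.2).2
      have ho := hBo z hz
      refine ⟨⟨?_, ?_⟩, ?_⟩
      · rw [hτ]; simp only; rw [ht]; exact (transition_mem ho).1
      · rw [hτ]; simp only; rw [ht, symm_transition ho]; exact hz.1.2
      · rw [mem_preimage, hτ]; simp only; rw [ht, symm_transition ho]; exact hz.2
  have hinj : InjOn τ B := by
    intro y hy z hz hyz
    have h1 : transition I p q (hyperplaneIncl y) = transition I p q (hyperplaneIncl z) := by
      rw [← transition_boundary hI hy.1 (hApq hy.2).2,
        ← transition_boundary hI hz.1 (hApq hz.2).2]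
      exact congrArg _ hyz
    have h2 : hyperplaneIncl y = hyperplaneIncl z := by
      rw [← transition_transition (hBo y hy), ← transition_transition (hBo z hz), h1]
    rw [← tailL_hyperplaneIncl y, ← tailL_hyperplaneIncl z, h2]
  have hder : ∀ z ∈ B, HasFDerivWithinAt τ ((tailL d ∘L fderivWithin ℝ (transition I p q) (range I)
        (hyperplaneIncl z)) ∘L inclL d) B z := by
    intro z hz
    have h1 : HasFDerivWithinAt (fun w => transition I p q (hyperplaneIncl w))
        ((fderivWithin ℝ (transition I p q) (range I) (hyperplaneIncl z)).comp (inclL d)) B z :=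
      HasFDerivWithinAt.comp (g := transition I p q) (t := range I) z
        (differentiableWithinAt_transition (hBo z hz)).hasFDerivWithinAt
        (inclL d).hasFDerivAt.hasFDerivWithinAt
        fun w hw => extChartAt_target_subset_range p hw.1.1
    exact (tailL d).hasFDerivAt.comp_hasFDerivWithinAt z h1
  rw [himg, lintegral_image_eq_lintegral_abs_det_fderiv_mul volume hBm hder hinj]
  refine setLIntegral_congr_fun hBm fun z hz => ?_
  simp only
  rw [areaDensity_transition hI m hz.1 (hApq hz.2).2, ENNReal.ofReal_mul (abs_nonneg _)]

theorem chartArea_compl (p : M) : chartArea I m p (extChartAt I p).sourceᶜ = 0 := by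
  rw [chartArea_apply hI m p (measurableSet_source p).compl]
  have : boundaryTarget I p ∩ (fun z => (extChartAt I p).symm (hyperplaneIncl z)) ⁻¹'
      (extChartAt I p).sourceᶜ = ∅ := by
    ext y
    simp only [mem_inter_iff, mem_preimage, mem_compl_iff, mem_empty_iff_false, iff_false, not_and,
      not_not]
    exact fun hy => (extChartAt I p).map_target hy.1
  rw [this]; simp

theorem boundaryArea_restrict (p : M) :
    (boundaryArea I m).restrict (extChartAt I p).source = chartArea I m p :=
  iSup_restrict_eq (ν := chartArea I m) (U := fun p => (extChartAt I p).source)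
    (fun p => measurableSet_source p) (chartArea_compl hI m)
    (fun p q _ hA hApq => chartArea_compat hI m p q hA hApq) p

theorem boundaryArea_apply (p : M) {A : Set M} (hA : MeasurableSet A)
    (hAp : A ⊆ (extChartAt I p).source) : boundaryArea I m A = chartArea I m p A := by
  rw [← boundaryArea_restrict hI, Measure.restrict_apply hA, inter_eq_left.2 hAp]

theorem integral_boundaryArea (p : M) {F : M → ℝ} (hF : Continuous F)
    (hF0 : ∀ x, x ∉ (extChartAt I p).source → F x = 0) :
    ∫ x, F x ∂(boundaryArea I m)
      = ∫ z in boundaryTarget I p, areaDensity m p z * inChart I p F (hyperplaneIncl z) := by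
  rw [← setIntegral_eq_integral_of_forall_compl_eq_zero hF0, boundaryArea_restrict hI m p]
  exact integral_map_withDensity (isOpen_boundaryTarget hI p).measurableSet
    (continuousOn_symm_hyperplaneIncl p)
    ((continuousOn_areaDensity m p).mono fun _ hz => hz.1) (fun _ _ => Real.sqrt_nonneg _) hF

theorem isFiniteMeasure_boundaryArea [T2Space M] [CompactSpace M] :
    IsFiniteMeasure (boundaryArea I m) := by
  refine ⟨isCompact_univ.measure_lt_top_of_nhdsWithin fun x _ => ?_⟩
  rw [nhdsWithin_univ]
  obtain ⟨K, hK, hKs, hKx⟩ := local_compact_nhds (extChartAt_source_mem_nhds (I := I) x)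
  refine ⟨K, hK, ?_⟩
  rw [boundaryArea_apply hI m x hKx.measurableSet hKs, chartArea_apply hI m x hKx.measurableSet]
  -- The boundary coordinates that land in `K` lie in this compact set, on which the area density is
  -- continuous.
  have hc : IsCompact (tailL d '' (extChartAt I x '' K ∩ {y | y 0 = 0})) := by
    refine IsCompact.image ?_ (tailL d).continuous
    exact (hKx.image_of_continuousOn ((continuousOn_extChartAt x).mono hKs)).inter_right
      (isClosed_eq (continuous_coord 0) continuous_const)
  refine lt_of_le_of_lt (lintegral_mono_set (t := tailL d '' (extChartAt I x '' K ∩ {y | y 0 = 0}))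
    ?_) ?_
  · rintro z ⟨hz, hzK⟩
    exact ⟨hyperplaneIncl z, ⟨⟨_, hzK, (extChartAt I x).right_inv hz.1⟩, rfl⟩,
      tailL_hyperplaneIncl z⟩
  · refine Integrable.lintegral_lt_top ?_
    refine ContinuousOn.integrableOn_compact hc ((continuousOn_areaDensity m x).mono ?_)
    rintro _ ⟨y, ⟨⟨w, hw, rfl⟩, hy0⟩, rfl⟩
    rw [mem_preimage, hyperplaneIncl_tailL hy0]
    exact (extChartAt I x).map_source (hKs hw)

theorem boundaryArea_interior [CompactSpace M] : boundaryArea I m (I.interior M) = 0 := by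
  obtain ⟨t, ht⟩ := isCompact_univ.elim_finite_subcover
    (fun p : M => (extChartAt I p).source) (fun p => isOpen_extChartAt_source p)
    (fun x _ => mem_iUnion.2 ⟨x, mem_extChartAt_source x⟩)
  have h1 : I.interior M ⊆ ⋃ p ∈ t, (I.interior M ∩ (extChartAt I p).source) := by
    intro x hx
    obtain ⟨p, hp, hxp⟩ := mem_iUnion₂.1 (ht (mem_univ x))
    exact mem_iUnion₂.2 ⟨p, hp, hx, hxp⟩
  refine measure_mono_null h1 ((measure_biUnion_null_iff t.countable_toSet).2 fun p _ => ?_)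
  have hm := (isOpen_interiorM (I := I) (M := M)).measurableSet.inter (measurableSet_source (I := I) p)
  rw [boundaryArea_apply hI m p hm inter_subset_right, chartArea_apply hI m p hm]
  have : boundaryTarget I p ∩ (fun z => (extChartAt I p).symm (hyperplaneIncl z)) ⁻¹'
      (I.interior M ∩ (extChartAt I p).source) = ∅ := by
    ext z
    simp only [mem_inter_iff, mem_preimage, mem_empty_iff_false, iff_false]
    rintro ⟨hz, hz2, _⟩
    exact (disjoint_left.1 (I.disjoint_interior_boundary (M := M))) hz2 hz.2
  rw [this]; simp

/-- Finitely many charts cover `M`, and in each of them boundary points have coordinates in the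
hyperplane `y 0 = 0`, a proper subspace and so a Lebesgue null set. -/
theorem riemVolume_boundary [CompactSpace M] : riemVolume I m (I.boundary M) = 0 := by
  obtain ⟨t, ht⟩ := isCompact_univ.elim_finite_subcover
    (fun p : M => (extChartAt I p).source) (fun p => isOpen_extChartAt_source p)
    (fun x _ => mem_iUnion.2 ⟨x, mem_extChartAt_source x⟩)
  have h1 : I.boundary M ⊆ ⋃ p ∈ t, (I.boundary M ∩ (extChartAt I p).source) := by
    intro x hx
    obtain ⟨p, hp, hxp⟩ := mem_iUnion₂.1 (ht (mem_univ x))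
    exact mem_iUnion₂.2 ⟨p, hp, hx, hxp⟩
  refine measure_mono_null h1 ((measure_biUnion_null_iff t.countable_toSet).2 fun p _ => ?_)
  have hm : MeasurableSet (I.boundary M ∩ (extChartAt I p).source) := by
    rw [← I.compl_interior]
    exact (isOpen_interiorM (I := I) (M := M)).measurableSet.compl.inter (measurableSet_source p)
  rw [riemVolume_apply m p hm inter_subset_right, chartVolume_apply m p hm]
  refine setLIntegral_measure_zero _ _ (measure_mono_null
    (t := {y : EuclideanSpace ℝ (Fin (d + 1)) | y 0 = 0}) ?_ ?_)
  · rintro y ⟨hy, hyb, _⟩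
    exact (eq_zero_of_symm_mem_boundary hI hy hyb).2
  · have h2 := Measure.addHaar_submodule (volume : Measure (EuclideanSpace ℝ (Fin (d + 1))))
      (LinearMap.ker (EuclideanSpace.proj (0 : Fin (d + 1)) :
        EuclideanSpace ℝ (Fin (d + 1)) →L[ℝ] ℝ).toLinearMap) (by
        intro htop
        have h3 : EuclideanSpace.single (0 : Fin (d + 1)) (1 : ℝ) ∈ LinearMap.ker
          (EuclideanSpace.proj (0 : Fin (d + 1)) :
            EuclideanSpace ℝ (Fin (d + 1)) →L[ℝ] ℝ).toLinearMap := by rw [htop]; trivial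
        simp at h3)
    exact h2

end BoundaryMeasure

/-! ### The divergence theorem in a coordinate domain -/

section Divergence

variable {d : ℕ}

/-- The divergence theorem on the half-space `a ≤ y 0`, for fields that vanish far away. -/
theorem integral_divergence_halfSpace {a R : ℝ} (haR : a ≤ R) (hR : 0 < R)
    (V : Fin (d + 1) → EuclideanSpace ℝ (Fin (d + 1)) → ℝ)
    (D : EuclideanSpace ℝ (Fin (d + 1)) → ℝ)
    (hVc : ∀ i, ContinuousOn (V i) {y | a ≤ y 0})
    (hVd : ∀ i y, a < y 0 → DifferentiableAt ℝ (V i) y)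
    (hD : ∀ y, a < y 0 → D y = ∑ i, fderiv ℝ (V i) y (EuclideanSpace.single i 1))
    (hDi : IntegrableOn D {y | a ≤ y 0})
    (hV0 : ∀ i y, a ≤ y 0 → (∃ j, R ≤ y j ∨ (j ≠ 0 ∧ y j ≤ -R)) → V i y = 0)
    (hD0 : ∀ y, a ≤ y 0 → (∃ j, R ≤ y j ∨ (j ≠ 0 ∧ y j ≤ -R)) → D y = 0) :
    ∫ y in {y | a ≤ y 0}, D y = - ∫ z : Fin d → ℝ, V 0 (WithLp.toLp 2 (Fin.cons a z)) := by
  -- The box `[a, R] × [-R, R]^d` contains everything that matters: every face except `y 0 = a` lies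
  -- where the field vanishes.
  set lo : Fin (d + 1) → ℝ := Fin.cons a fun _ => -R with hlo
  set hi : Fin (d + 1) → ℝ := fun _ => R with hhi
  have hle : lo ≤ hi := fun i => by
    refine Fin.cases ?_ (fun j => ?_) i
    · simpa [hlo, hhi] using haR
    · simp [hlo, hhi]; linarith
  set L := (EuclideanSpace.equiv (Fin (d + 1)) ℝ).symm with hL
  have hLa : ∀ x i, L x i = x i := fun x i => rfl
  have hsub : ∀ x ∈ Icc lo hi, L x ∈ {y : EuclideanSpace ℝ (Fin (d + 1)) | a ≤ y 0} :=
    fun x hx => hx.1 0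
  have hmp : MeasurePreserving (WithLp.toLp 2 : (Fin (d + 1) → ℝ) → _) volume volume :=
    PiLp.volume_preserving_toLp (Fin (d + 1))
  have hemb : MeasurableEmbedding (WithLp.toLp 2 : (Fin (d + 1) → ℝ) → _) :=
    L.toHomeomorph.measurableEmbedding
  have hInteg : ∫ y in {y | a ≤ y 0}, D y = ∫ x in Icc lo hi, D (L x) := by
    rw [← hmp.setIntegral_preimage_emb hemb]
    refine (setIntegral_eq_of_subset_of_forall_sdiff_eq_zero ?_ (fun x hx => hsub x hx) ?_)
    · exact (measurableSet_le measurable_const (continuous_coord 0).measurable).preimage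
        hmp.measurable
    · rintro x ⟨hx1, hx2⟩
      refine hD0 _ hx1 ?_
      by_contra hcon
      push Not at hcon
      refine hx2 ⟨fun i => ?_, fun i => ?_⟩
      · refine Fin.cases ?_ (fun j => ?_) i
        · exact hx1
        · exact ((hcon j.succ).2 (Fin.succ_ne_zero j)).le
      · exact (hcon i).1.le
  have hDi' : IntegrableOn (fun x => D (L x)) (Icc lo hi) := by
    have h1 := (hmp.integrableOn_comp_preimage hemb).2 hDi
    exact h1.mono_set fun x hx => hsub x hx
  set V' : Fin (d + 1) → (Fin (d + 1) → ℝ) → (Fin (d + 1) → ℝ) →L[ℝ] ℝ :=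
    fun i x => (fderiv ℝ (V i) (L x)).comp (L : (Fin (d + 1) → ℝ) →L[ℝ] _) with hV'
  have hae : ∀ᵐ x ∂(volume.restrict (Icc lo hi)),
      D (L x) = ∑ i, V' i x (Pi.single i 1) := by
    -- The formula for `D` is known only for `a < y 0`. Passing to the open box changes a null set.
    have h1 : (pi univ fun i => Ioo (lo i) (hi i)) =ᵐ[volume] Icc lo hi :=
      Measure.univ_pi_Ioo_ae_eq_Icc
    rw [← Measure.restrict_congr_set h1]
    refine (ae_restrict_iff' (MeasurableSet.univ_pi fun i => measurableSet_Ioo)).2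
      (Filter.Eventually.of_forall fun x hx => ?_)
    rw [hD (L x) (hx 0 (mem_univ _)).1]
    rfl
  rw [hInteg, integral_congr_ae hae,
    integral_divergence_of_hasFDerivAt_off_countable' lo hi hle (fun i x => V i (L x)) V' ∅
      countable_empty
      (fun i => (hVc i).comp L.continuous.continuousOn fun x hx => hsub x hx)
      (fun x hx i => by
        have h1 : a < L x 0 := (hx.1 0 (mem_univ _)).1
        exact (hVd i (L x) h1).hasFDerivAt.comp x L.hasFDerivAt)
      (hDi'.congr_fun_ae hae)]
  have hfront : ∀ i : Fin (d + 1), ∫ x in Icc (lo ∘ i.succAbove) (hi ∘ i.succAbove),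
      V i (L (i.insertNth (hi i) x)) = 0 := by
    intro i
    refine setIntegral_eq_zero_of_forall_eq_zero fun x hx => hV0 _ _ ?_ ⟨i, Or.inl ?_⟩
    · rw [hLa]
      rcases eq_or_ne 0 i with rfl | h0
      · simpa using haR
      · obtain ⟨j, hj⟩ := Fin.exists_succAbove_eq h0
        rw [← hj, Fin.insertNth_apply_succAbove]
        have := hx.1 j
        simp only [Function.comp, hj] at this
        exact this
    · rw [hLa]; simp [hhi]
  have hback : ∀ i : Fin d, ∫ x in Icc (lo ∘ i.succ.succAbove) (hi ∘ i.succ.succAbove),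
      V i.succ (L (i.succ.insertNth (lo i.succ) x)) = 0 := by
    intro i
    refine setIntegral_eq_zero_of_forall_eq_zero fun x hx => hV0 _ _ ?_
      ⟨i.succ, Or.inr ⟨Fin.succ_ne_zero i, ?_⟩⟩
    · rw [hLa]
      obtain ⟨j, hj⟩ := Fin.exists_succAbove_eq (Fin.succ_ne_zero i).symm
      rw [← hj, Fin.insertNth_apply_succAbove]
      have := hx.1 j
      simp only [Function.comp, hj] at this
      exact this
    · rw [hLa]; simp [hlo]
  rw [Fin.sum_univ_succ]
  simp only [hfront, hback, sub_self, Finset.sum_const_zero, add_zero, zero_sub, neg_inj]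
  have hL0 : ∀ x : Fin d → ℝ, L ((0 : Fin (d + 1)).insertNth (lo 0) x)
      = WithLp.toLp 2 (Fin.cons a x) := by
    intro x
    rw [Fin.insertNth_zero']
    rfl
  simp only [hL0]
  refine setIntegral_eq_integral_of_forall_compl_eq_zero fun x hx => hV0 _ _ le_rfl ?_
  by_contra hcon
  push Not at hcon
  refine hx ⟨fun j => ?_, fun j => ?_⟩
  · have := ((hcon j.succ).2 (Fin.succ_ne_zero j)).le
    simpa [hlo] using this
  · have := (hcon j.succ).1.le
    simpa [hhi] using this

variable {S T K : Set (EuclideanSpace ℝ (Fin (d + 1)))}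

/-- A function on a relatively open set, zero off a compact subset, extends continuously by zero. -/
theorem continuousOn_indicator_of_compact {X Y : Type*} [TopologicalSpace X] [T2Space X]
    [TopologicalSpace Y] [Zero Y] {S T K : Set X} (hT : ∀ y ∈ T, T ∈ nhdsWithin y S)
    (hK : IsCompact K) (hKT : K ⊆ T) {f : X → Y} (hf : ContinuousOn f T)
    (hf0 : ∀ y ∈ T, y ∉ K → f y = 0) : ContinuousOn (T.indicator f) S := by
  intro y hy
  by_cases hyT : y ∈ T
  · have h1 : ContinuousWithinAt f S y := (hf y hyT).mono_of_mem_nhdsWithin (hT y hyT)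
    refine h1.congr_of_eventuallyEq ?_ (indicator_of_mem hyT f)
    filter_upwards [hT y hyT] with z hz using indicator_of_mem hz f
  · have h1 : ∀ᶠ z in nhds y, T.indicator f z = 0 := by
      filter_upwards [hK.isClosed.isOpen_compl.mem_nhds fun h => hyT (hKT h)] with z hz
      by_cases hzT : z ∈ T
      · rw [indicator_of_mem hzT, hf0 z hzT hz]
      · exact indicator_of_notMem hzT f
    exact (continuousAt_const.congr (f := fun _ => (0 : Y))
      (h1.mono fun z hz => hz.symm)).continuousWithinAt

/-- The divergence theorem for compactly supported fields on `ℝⁿ` or on the half-space. -/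
theorem integral_divergence_of_compact
    (hT : ∀ y ∈ T, T ∈ nhdsWithin y S) (hTS : T ⊆ S) (hTm : MeasurableSet T)
    (hK : IsCompact K) (hKT : K ⊆ T)
    {V : Fin (d + 1) → EuclideanSpace ℝ (Fin (d + 1)) → ℝ}
    {D : EuclideanSpace ℝ (Fin (d + 1)) → ℝ}
    (hVc : ∀ i, ContinuousOn (V i) T) (hV0 : ∀ i, ∀ y ∈ T, y ∉ K → V i y = 0)
    (hVd : ∀ i, ∀ y ∈ interior T, DifferentiableAt ℝ (V i) y)
    (hDc : ContinuousOn D T) (hD0 : ∀ y ∈ T, y ∉ K → D y = 0)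
    (hD : ∀ y ∈ interior T, D y = ∑ i, fderiv ℝ (V i) y (EuclideanSpace.single i 1)) :
    (S = univ → ∫ y in T, D y = 0) ∧ (S = {y | 0 ≤ y 0} → ∫ y in T, D y
      = - ∫ z in hyperplaneIncl ⁻¹' T, V 0 (hyperplaneIncl z)) := by
  obtain ⟨R, hR, hKR⟩ : ∃ R : ℝ, 0 < R ∧ ∀ y ∈ K, ∀ j, |y j| < R := by
    obtain ⟨R, hR⟩ := hK.isBounded.exists_norm_le
    refine ⟨max R 0 + 1, by positivity, fun y hy j => ?_⟩
    have h1 := PiLp.norm_apply_le y j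
    rw [Real.norm_eq_abs] at h1
    have h2 := hR y hy
    have h3 := le_max_left R 0
    linarith
  have hout : ∀ {f : EuclideanSpace ℝ (Fin (d + 1)) → ℝ}, (∀ y ∈ T, y ∉ K → f y = 0) →
      ∀ y, y ∉ K → T.indicator f y = 0 := by
    intro f hf y hy
    by_cases hyT : y ∈ T
    · rw [indicator_of_mem hyT, hf y hyT hy]
    · exact indicator_of_notMem hyT f
  have hfar : ∀ y : EuclideanSpace ℝ (Fin (d + 1)),
      (∃ j, R ≤ y j ∨ (j ≠ 0 ∧ y j ≤ -R)) → y ∉ K := by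
    rintro y ⟨j, h⟩ hy
    have := abs_lt.1 (hKR y hy j)
    rcases h with h | ⟨_, h⟩ <;> linarith [this.1, this.2]
  have hVd' : ∀ i, ∀ y ∈ interior S, DifferentiableAt ℝ (T.indicator (V i)) y ∧
      T.indicator D y = ∑ i, fderiv ℝ (T.indicator (V i)) y (EuclideanSpace.single i 1) := by
    intro i y hy
    have hSy : S ∈ nhds y := mem_interior_iff_mem_nhds.1 hy
    by_cases hyT : y ∈ T
    · have hTy : T ∈ nhds y := by
        have := hT y hyT
        rwa [nhdsWithin_eq_nhds.2 hSy] at this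
      have hyi := mem_interior_iff_mem_nhds.2 hTy
      have h1 : ∀ i, T.indicator (V i) =ᶠ[nhds y] V i := fun i => by
        filter_upwards [hTy] with z hz using indicator_of_mem hz _
      refine ⟨(hVd i y hyi).congr_of_eventuallyEq (h1 i), ?_⟩
      rw [indicator_of_mem hyT, hD y hyi]
      exact Finset.sum_congr rfl fun i _ => by rw [(h1 i).fderiv_eq]
    · have h1 : ∀ i, T.indicator (V i) =ᶠ[nhds y] fun _ => 0 := fun i => by
        filter_upwards [hK.isClosed.isOpen_compl.mem_nhds fun h => hyT (hKT h)] with z hz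
        exact hout (hV0 i) z hz
      refine ⟨(differentiableAt_const _).congr_of_eventuallyEq (h1 i), ?_⟩
      rw [indicator_of_notMem hyT]
      exact (Finset.sum_eq_zero fun i _ => by rw [(h1 i).fderiv_eq]; simp).symm
  have hDint : IntegrableOn D T :=
    ((hDc.mono hKT).integrableOn_compact hK).of_forall_sdiff_eq_zero hTm
      fun y hy => hD0 y hy.1 hy.2
  have hDi : Integrable (T.indicator D) := (integrable_indicator_iff hTm).2 hDint
  have hVc' := fun i => continuousOn_indicator_of_compact hT hK hKT (hVc i) (hV0 i)
  constructor
  · intro hS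
    rw [hS, interior_univ] at hVd'
    rw [hS] at hVc'
    -- On the whole space the half-space formula is used with `a = -R`, below the support, so that
    -- its face contributes nothing.
    have hzero : ∀ {f : EuclideanSpace ℝ (Fin (d + 1)) → ℝ}, (∀ y ∈ T, y ∉ K → f y = 0) →
      ∀ y : EuclideanSpace ℝ (Fin (d + 1)), y 0 ≤ -R → T.indicator f y = 0 := fun hf y hy =>
      hout hf y fun h => by linarith [(abs_lt.1 (hKR y h 0)).1]
    have h := integral_divergence_halfSpace (a := -R) (by linarith) hR
      (fun i => T.indicator (V i)) (T.indicator D) (fun i => (hVc' i).mono (subset_univ _))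
      (fun i y _ => (hVd' i y trivial).1) (fun y _ => (hVd' 0 y trivial).2) hDi.integrableOn
      (fun i y _ hy => hout (hV0 i) y (hfar y hy)) (fun y _ hy => hout hD0 y (hfar y hy))
    rw [← integral_indicator hTm]
    rw [setIntegral_eq_integral_of_forall_compl_eq_zero (s := {y | -R ≤ y 0}) fun y hy =>
      hzero hD0 y (not_le.1 hy).le] at h
    rw [h, neg_eq_zero]
    exact integral_eq_zero_of_ae (Filter.Eventually.of_forall fun z => hzero (hV0 0) _ le_rfl)
  · intro hS
    have hInteg : ∀ y : EuclideanSpace ℝ (Fin (d + 1)), 0 < y 0 → y ∈ interior S := by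
      intro y hy
      rw [mem_interior_iff_mem_nhds, hS]
      filter_upwards [(isOpen_lt continuous_const (continuous_coord 0)).mem_nhds hy] with z hz
        using le_of_lt hz
    have h := integral_divergence_halfSpace (a := 0) hR.le hR
      (fun i => T.indicator (V i)) (T.indicator D) (fun i => hS ▸ hVc' i)
      (fun i y hy => (hVd' i y (hInteg y hy)).1) (fun y hy => (hVd' 0 y (hInteg y hy)).2)
      hDi.integrableOn
      (fun i y _ hy => hout (hV0 i) y (hfar y hy)) (fun y _ hy => hout hD0 y (hfar y hy))
    rw [← hS] at h
    rw [← integral_indicator (hTm.preimage continuous_hyperplaneIncl.measurable)]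
    rw [setIntegral_indicator hTm, inter_eq_right.2 hTS] at h
    rw [h]
    rfl

end Divergence

/-! ### The flux through the boundary -/

section Flux

variable {d : ℕ}

theorem sum_eq_of_succ_eq_zero {c v : Fin (d + 1) → ℝ} (hv : ∀ i : Fin d, v i.succ = 0) :
    ∑ j, c j * v j = c 0 * v 0 := by
  rw [Fin.sum_univ_succ]
  simp [hv]

/-- For `A` the Gram matrix and `v` the differential of a function with vanishing tangential
derivatives, this reads `|∇w| = (γ^{00})^{1/2} ∂_0 w`. The sign of `v 0` is needed to extract the
root of its square. -/
theorem sqrt_quadratic_of_succ_eq_zero {A : Matrix (Fin (d + 1)) (Fin (d + 1)) ℝ}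
    (hA : A.PosDef) {v : Fin (d + 1) → ℝ} (hv : ∀ i : Fin d, v i.succ = 0) (hv0 : 0 ≤ v 0) :
    Real.sqrt (∑ i, v i * ∑ j, A⁻¹ i j * v j) = Real.sqrt (A⁻¹ 0 0) * v 0 := by
  have h0 : 0 < A⁻¹ 0 0 := hA.inv.diag_pos
  have h1 : ∑ i, v i * ∑ j, A⁻¹ i j * v j = A⁻¹ 0 0 * v 0 ^ 2 := by
    simp only [sum_eq_of_succ_eq_zero hv]
    rw [Fin.sum_univ_succ]
    simp only [hv, zero_mul, Finset.sum_const_zero, add_zero]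
    ring
  rw [h1, Real.sqrt_mul h0.le, Real.sqrt_sq hv0]

/-- The flux of a gradient that is normal to the boundary. -/
theorem sqrt_det_mul_flux {A : Matrix (Fin (d + 1)) (Fin (d + 1)) ℝ}
    (hA : A.PosDef) {v : Fin (d + 1) → ℝ} (hv : ∀ i : Fin d, v i.succ = 0) (hv0 : 0 ≤ v 0) :
    Real.sqrt A.det * ∑ j, A⁻¹ 0 j * v j
      = Real.sqrt (A.submatrix Fin.succ Fin.succ).det *
        Real.sqrt (∑ i, v i * ∑ j, A⁻¹ i j * v j) := by
  have h0 : 0 < A⁻¹ 0 0 := hA.inv.diag_pos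
  -- The entry `A⁻¹ 0 0` is the cofactor of the tangential block divided by `det A`. It relates the
  -- area density to the volume density.
  have hdet : (A.submatrix Fin.succ Fin.succ).det = A.det * A⁻¹ 0 0 := by
    rw [Matrix.inv_def, Matrix.smul_apply, Matrix.adjugate_fin_succ_eq_det_submatrix,
      Ring.inverse_eq_inv', smul_eq_mul, mul_inv_cancel_left₀ hA.det_pos.ne']
    simp
  rw [sqrt_quadratic_of_succ_eq_zero hA hv hv0, sum_eq_of_succ_eq_zero hv, hdet,
    Real.sqrt_mul hA.det_pos.le]
  nth_rewrite 1 [← Real.mul_self_sqrt h0.le]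
  ring

/-- The derivatives of a function at a minimum on the boundary of the half-space. -/
theorem partialD_of_isLocalMinOn {S : Set (EuclideanSpace ℝ (Fin (d + 1)))}
    (hS : S = {y | 0 ≤ y 0}) {a : EuclideanSpace ℝ (Fin (d + 1)) → ℝ}
    {y : EuclideanSpace ℝ (Fin (d + 1))} (hy : y 0 = 0) (ha : DifferentiableWithinAt ℝ a S y)
    (hmin : IsLocalMinOn a S y) :
    (∀ i : Fin d, partialD S i.succ a y = 0) ∧ 0 ≤ partialD S 0 a y := by
  -- One-sided derivatives at a minimum are nonnegative in every direction pointing into the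
  -- half-space. A tangential direction and its opposite both qualify, so tangential derivatives
  -- vanish.
  have hcone : ∀ v : EuclideanSpace ℝ (Fin (d + 1)), 0 ≤ v 0 → 0 ≤ fderivWithin ℝ a S y v := by
    intro v hv
    refine hmin.hasFDerivWithinAt_nonneg ha.hasFDerivWithinAt
      (mem_posTangentConeAt_of_segment_subset ?_)
    have hconv : Convex ℝ S := by
      rw [hS]
      intro x hx z hz s t hs ht _
      exact add_nonneg (mul_nonneg hs hx) (mul_nonneg ht hz)
    refine hconv.segment_subset ?_ ?_
    · rw [hS]; exact hy.ge
    · rw [hS]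
      change 0 ≤ y 0 + v 0
      rw [hy, zero_add]; exact hv
  refine ⟨fun i => le_antisymm ?_ (hcone _ ?_), hcone _ ?_⟩
  · have := hcone (-EuclideanSpace.single i.succ 1) (by simp)
    rw [map_neg] at this
    exact neg_nonneg.1 this
  · simp
  · simp

end Flux

/-! ### Green's formula -/

section Green

variable {d : ℕ} {H : Type*} [TopologicalSpace H]
  {I : ModelWithCorners ℝ (EuclideanSpace ℝ (Fin (d + 1))) H}
  {M : Type*} [TopologicalSpace M] [ChartedSpace H M] [IsManifold I ∞ M]
  (m : Bundle.ContMDiffRiemannianMetric I ∞ (EuclideanSpace ℝ (Fin (d + 1)))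
    (fun x : M => TangentSpace I x))
  (hI : range I = univ ∨ range I = {y : EuclideanSpace ℝ (Fin (d + 1)) | 0 ≤ y 0})
  {φ w k : M → ℝ}

/-- A nonnegative function has a minimum at each boundary zero. Its gradient is therefore normal
there, which is why only `|∇w|` enters the boundary flux. -/
theorem partialD_inChart_boundary (hS : range I = {y : EuclideanSpace ℝ (Fin (d + 1)) | 0 ≤ y 0})
    (hw : IsC I 1 w) (hw0 : ∀ x ∈ I.boundary M, w x = 0) (hwn : ∀ x, 0 ≤ w x) {p : M}
    {y : EuclideanSpace ℝ (Fin (d + 1))} (hy : y ∈ (extChartAt I p).target)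
    (hyb : (extChartAt I p).symm y ∈ I.boundary M) (hy0 : y 0 = 0) :
    (∀ i : Fin d, partialD (range I) i.succ (inChart I p w) y = 0) ∧
      0 ≤ partialD (range I) 0 (inChart I p w) y := by
  refine partialD_of_isLocalMinOn hS hy0 ?_ ?_
  · have h1 := (hw p).differentiableOn (by norm_num) _ hy
    exact h1.mono_of_mem_nhdsWithin (extChartAt_target_mem_nhdsWithin_of_mem hy)
  · refine Filter.Eventually.of_forall fun z => ?_
    change w _ ≤ w _
    rw [hw0 _ hyb]
    exact hwn _

include hI in
/-- The normal derivative of a nonnegative function that vanishes on the boundary. -/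
theorem normalDeriv_eq (hw : IsC I 1 w) (hw0 : ∀ x ∈ I.boundary M, w x = 0)
    (hwn : ∀ x, 0 ≤ w x) {x : M} (hx : x ∈ I.boundary M) :
    normalDeriv I m w x = - Real.sqrt (gradInner m w w x) := by
  have hy := mem_extChartAt_target (I := I) x
  have hyb : (extChartAt I x).symm (extChartAt I x x) ∈ I.boundary M := by
    rwa [extChartAt_to_inv]
  obtain ⟨hS, hy0⟩ := eq_zero_of_symm_mem_boundary hI hy hyb
  obtain ⟨h1, h2⟩ := partialD_inChart_boundary hS hw hw0 hwn hy hyb hy0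
  have hA := (isMetricOn_gram m x).posDef _ hy
  have h3 := sqrt_quadratic_of_succ_eq_zero hA
    (v := fun i => partialD (range I) i (inChart I x w) (extChartAt I x x)) h1 h2
  have h0 : 0 < (gram I m x (extChartAt I x x))⁻¹ 0 0 := hA.inv.diag_pos
  have h4 : gradInner m w w x = ∑ i, partialD (range I) i (inChart I x w) (extChartAt I x x) *
      ∑ j, (gram I m x (extChartAt I x x))⁻¹ i j *
        partialD (range I) j (inChart I x w) (extChartAt I x x) := rfl
  rw [h4, h3]
  unfold normalDeriv
  rw [show (fun y => w ((extChartAt I x).symm y)) = inChart I x w from rfl,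
    sum_eq_of_succ_eq_zero (v := fun i => partialD (range I) i (inChart I x w) (extChartAt I x x))
      h1, normalCoord]
  rw [neg_div, Real.div_sqrt]
  ring

theorem gradInner_eq_zero {x : M} (b : M → ℝ) (h : φ =ᶠ[nhds x] fun _ => 0) :
    gradInner m φ b x = 0 := by
  rw [gradInner_congr m h (Filter.EventuallyEq.refl _ b)]
  unfold gradInner gradInnerCoord
  refine Finset.sum_eq_zero fun i _ => ?_
  have : inChart I x (fun _ => (0 : ℝ)) = fun _ => 0 := rfl
  rw [partialD, this]
  simp

theorem gradInner_eq_zero_of_notMem_tsupport {x : M} (b : M → ℝ) (h : x ∉ tsupport φ) :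
    gradInner m φ b x = 0 :=
  gradInner_eq_zero m b (notMem_tsupport_iff_eventuallyEq.1 h)

/-- The divergence of `φ (det γ)^{1/2} ∇w` in coordinates. -/
theorem sum_fderiv_flux (hφ : IsC I 1 φ) (hw : IsCInt I 2 w) {p : M}
    {y : EuclideanSpace ℝ (Fin (d + 1))} (hy : y ∈ interior (extChartAt I p).target) :
    Real.sqrt (gram I m p y).det * (inChart I p φ y * inChart I p (laplacian I m w) y
        + inChart I p (gradInner m φ w) y)
      = ∑ i, fderiv ℝ (fun z => inChart I p φ z * (Real.sqrt (gram I m p z).det *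
          gradCoord (range I) (gram I m p) (inChart I p w) i z)) y (EuclideanSpace.single i 1) := by
  have hmet := isMetricOn_interior m p
  have hsub := interior_target_subset (I := I) p
  have hS := range_mem_nhds hy
  have hy' := interior_subset hy
  have hx := (extChartAt I p).map_target hy'
  have hxi := (symm_mem_interior_iff p hy').2 hy
  have hd1 : DifferentiableAt ℝ (inChart I p φ) y :=
    ((hφ.isCInt p).differentiableOn (by norm_num)).differentiableAt (isOpen_interior.mem_nhds hy)
  have hd2 : DifferentiableAt ℝ (fun z => Real.sqrt (gram I m p z).det) y :=
    (hmet.contDiffOn_sqrt_det.differentiableOn (by simp)).differentiableAt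
      (isOpen_interior.mem_nhds hy)
  have hd3 : ∀ i, DifferentiableAt ℝ (gradCoord (range I) (gram I m p) (inChart I p w) i) y :=
    fun i => ((hmet.contDiffOn_gradCoord isOpen_interior hsub (k := 1) (hw p) (by norm_num)
      (by norm_cast) i).differentiableOn (by norm_num)).differentiableAt
        (isOpen_interior.mem_nhds hy)
  have hL : inChart I p (laplacian I m w) y
      = laplaceCoord (range I) (gram I m p) (inChart I p w) y := by
    rw [inChart, laplacian_eq m hw p hx hxi, (extChartAt I p).right_inv hy']
  have hG : inChart I p (gradInner m φ w) y
      = gradInnerCoord (range I) (gram I m p) (inChart I p φ) (inChart I p w) y := by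
    rw [inChart, gradInner_eq m p hx (hφ.isDiffAt _)
      ((hw.of_le (by norm_num)).isDiffAt hxi), (extChartAt I p).right_inv hy']
  rw [hL, hG, hmet.laplaceCoord_eq isOpen_interior hsub (hw p) hy, gradInnerCoord]
  have hprod : ∀ i, fderiv ℝ (fun z => inChart I p φ z * (Real.sqrt (gram I m p z).det *
      gradCoord (range I) (gram I m p) (inChart I p w) i z)) y (EuclideanSpace.single i 1)
      = partialD (range I) i (inChart I p φ) y * (Real.sqrt (gram I m p y).det *
          gradCoord (range I) (gram I m p) (inChart I p w) i y)
        + inChart I p φ y * (Real.sqrt (gram I m p y).det * (∑ l, christoffel (range I)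
          (gram I m p) l l i y) * gradCoord (range I) (gram I m p) (inChart I p w) i y
          + Real.sqrt (gram I m p y).det *
            partialD (range I) i (gradCoord (range I) (gram I m p) (inChart I p w) i) y) := by
    intro i
    refine (partialD_eq_fderiv hS i).symm.trans ?_
    rw [partialD_mul hS hd1 (hd2.fun_mul (hd3 i)), partialD_mul hS hd2 (hd3 i),
      hmet.partialD_sqrt_det isOpen_interior hS hy]
  have halg : ∀ (s f : ℝ) (P G C Q : Fin (d + 1) → ℝ),
      s * (f * (∑ i, Q i + ∑ i, C i * G i) + ∑ i, P i * G i)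
        = ∑ i, (P i * (s * G i) + f * (s * C i * G i + s * Q i)) := by
    intro s f P G C Q
    simp only [mul_add, Finset.mul_sum, ← Finset.sum_add_distrib]
    exact Finset.sum_congr rfl fun i _ => by ring
  rw [Finset.sum_congr rfl fun i _ => hprod i]
  exact halg _ _ _ _ _ _

variable [MeasurableSpace M] [BorelSpace M]

include hI in
/-- Green's formula for a function supported in a chart. -/
theorem green_chart [T2Space M] [CompactSpace M] (hφ : IsC I 1 φ) (hw : IsC I 1 w)
    (hw2 : IsCInt I 2 w)
    (hk : Continuous k) (hkw : ∀ x ∈ I.interior M, k x = laplacian I m w x) (p : M)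
    (hp : tsupport φ ⊆ (extChartAt I p).source)
    (hb : (∀ x ∈ I.boundary M, φ x = 0) ∨ ((∀ x ∈ I.boundary M, w x = 0) ∧ ∀ x, 0 ≤ w x)) :
    ∫ x, (φ x * k x + gradInner m φ w x) ∂(riemVolume I m)
      = - ∫ x, φ x * Real.sqrt (gradInner m w w x) ∂(boundaryArea I m) := by
  have hφc : Continuous φ := (hφ.of_le (by norm_num)).continuous
  have hmet := isMetricOn_gram m p
  have hsub := interior_target_subset (I := I) p
  have hφ0 : ∀ x, x ∉ tsupport φ → φ x = 0 := fun x hx => image_eq_zero_of_notMem_tsupport hx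
  have hFc : Continuous fun x => φ x * k x + gradInner m φ w x :=
    (hφc.mul hk).add (continuous_gradInner m hφ hw)
  have hF0 : ∀ x, x ∉ tsupport φ → φ x * k x + gradInner m φ w x = 0 := fun x hx => by
    rw [hφ0 x hx, gradInner_eq_zero_of_notMem_tsupport m w hx]; ring
  set K := extChartAt I p '' tsupport φ with hKdef
  have hK : IsCompact K := ((isClosed_tsupport φ).isCompact).image_of_continuousOn
    ((continuousOn_extChartAt p).mono hp)
  have hKT : K ⊆ (extChartAt I p).target := by
    rintro _ ⟨x, hx, rfl⟩
    exact (extChartAt I p).map_source (hp hx)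
  have hKn : ∀ y ∈ (extChartAt I p).target, y ∉ K → (extChartAt I p).symm y ∉ tsupport φ := by
    intro y hy hyK hc
    exact hyK ⟨_, hc, (extChartAt I p).right_inv hy⟩
  have hdiv := integral_divergence_of_compact (S := range I) (T := (extChartAt I p).target) (K := K)
    (fun y hy => extChartAt_target_mem_nhdsWithin_of_mem hy) (extChartAt_target_subset_range p)
    (measurableSet_target p) hK hKT
    (V := fun i z => inChart I p φ z * (Real.sqrt (gram I m p z).det *
          gradCoord (range I) (gram I m p) (inChart I p w) i z))
    (D := fun y => Real.sqrt (gram I m p y).det *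
      inChart I p (fun x => φ x * k x + gradInner m φ w x) y)
    (fun i => (hφ p).continuousOn.mul (hmet.contDiffOn_sqrt_det.continuousOn.mul
      (continuousOn_gradCoord_target m (hw p) i)))
    (fun i y hy hyK => by rw [inChart, hφ0 _ (hKn y hy hyK), zero_mul])
    (fun i y hy => by
      refine (((hφ.isCInt p).differentiableOn (by norm_num)).differentiableAt
        (isOpen_interior.mem_nhds hy)).mul (DifferentiableAt.mul ?_ ?_)
      · exact ((isMetricOn_interior m p).contDiffOn_sqrt_det.differentiableOn
          (by simp)).differentiableAt (isOpen_interior.mem_nhds hy)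
      · exact (((isMetricOn_interior m p).contDiffOn_gradCoord isOpen_interior hsub (k := 1) (hw2 p)
          (by norm_num) (by norm_cast) i).differentiableOn (by norm_num)).differentiableAt
          (isOpen_interior.mem_nhds hy))
    (hmet.contDiffOn_sqrt_det.continuousOn.mul
      (hFc.comp_continuousOn (continuousOn_extChartAt_symm p)))
    (fun y hy hyK => by rw [inChart, hF0 _ (hKn y hy hyK), mul_zero])
    (fun y hy => by
      rw [← sum_fderiv_flux m hφ hw2 hy]
      simp only [inChart]
      rw [hkw _ ((symm_mem_interior_iff p (interior_subset hy)).2 hy)])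
  rw [integral_riemVolume m p hFc fun x hx => hF0 x fun h => hx (hp h),
    integral_boundaryArea hI m p (F := fun x => φ x * Real.sqrt (gradInner m w w x))
      (hφc.mul (continuous_gradInner m hw hw).sqrt)
      (fun x hx => by rw [hφ0 x fun h => hx (hp h), zero_mul])]
  rcases hI with hS | hS
  · rw [hdiv.1 hS]
    have : boundaryTarget I p = ∅ := by
      rw [eq_empty_iff_forall_notMem]
      intro z hz
      have h1 := (eq_zero_of_symm_mem_boundary (Or.inl hS) hz.1 hz.2).1
      rw [hS] at h1
      have h2 : -EuclideanSpace.single (0 : Fin (d + 1)) (1 : ℝ) ∈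
        {y : EuclideanSpace ℝ (Fin (d + 1)) | 0 ≤ y 0} := h1 ▸ mem_univ _
      simp only [mem_ofPred_eq] at h2
      simp at h2
      linarith
    rw [this]; simp
  · rw [hdiv.2 hS]
    have hbt : hyperplaneIncl ⁻¹' (extChartAt I p).target = boundaryTarget I p :=
      Subset.antisymm (fun z hz => ⟨hz, symm_mem_boundary_of_eq_zero hS hz rfl⟩) fun z hz => hz.1
    rw [hbt, neg_inj]
    refine setIntegral_congr_fun (isOpen_boundaryTarget (Or.inr hS) p).measurableSet
      fun z hz => ?_
    simp only [inChart]
    -- The boundary term is written with `-|∇w|` in place of the normal derivative. If `φ` vanishes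
    -- on the boundary both sides are zero; otherwise `∇w` is normal and `sqrt_det_mul_flux`
    -- identifies the flux density with `|∇w|` times the area density.
    rcases hb with hb | ⟨hw0, hwn⟩
    · rw [hb _ hz.2]; ring
    · obtain ⟨h1, h2⟩ := partialD_inChart_boundary hS hw hw0 hwn hz.1 hz.2 rfl
      have h3 := sqrt_det_mul_flux (hmet.posDef _ hz.1)
        (v := fun i => partialD (range I) i (inChart I p w) (hyperplaneIncl z)) h1 h2
      rw [gradInner_eq m p ((extChartAt I p).map_target hz.1) (hw.isDiffAt _) (hw.isDiffAt _),
        (extChartAt I p).right_inv hz.1]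
      have h4 : Real.sqrt (gram I m p (hyperplaneIncl z)).det *
          gradCoord (range I) (gram I m p) (inChart I p w) 0 (hyperplaneIncl z)
          = areaDensity m p z * Real.sqrt (gradInnerCoord (range I) (gram I m p) (inChart I p w)
            (inChart I p w) (hyperplaneIncl z)) := h3
      change φ _ * (Real.sqrt (gram I m p (hyperplaneIncl z)).det *
          gradCoord (range I) (gram I m p) (inChart I p w) 0 (hyperplaneIncl z)) = _
      rw [h4]; ring

include hI in
/-- **Green's formula** on a compact Riemannian manifold with boundary. -/
theorem green [T2Space M] [CompactSpace M] (hφ : IsC I 1 φ) (hw : IsC I 1 w)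
    (hw2 : IsCInt I 2 w)
    (hk : Continuous k) (hkw : ∀ x ∈ I.interior M, k x = laplacian I m w x)
    (hb : (∀ x ∈ I.boundary M, φ x = 0) ∨ ((∀ x ∈ I.boundary M, w x = 0) ∧ ∀ x, 0 ≤ w x)) :
    ∫ x, (φ x * k x + gradInner m φ w x) ∂(riemVolume I m)
      = - ∫ x, φ x * Real.sqrt (gradInner m w w x) ∂(boundaryArea I m) := by
  have := isFiniteMeasure_riemVolume (I := I) m
  have := isFiniteMeasure_boundaryArea hI m
  have hLC : LocallyCompactSpace H := I.locallyCompactSpace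
  obtain ⟨ρ, hρ⟩ := SmoothPartitionOfUnity.exists_isSubordinate_chartAt_source I M
  -- On a compact space a locally finite family of supports has only finitely many nonempty members,
  -- so the partition of unity is a finite sum.
  have hfin : (Function.support fun i => (ρ i : M → ℝ)).Finite := by
    refine (ρ.locallyFinite.finite_nonempty_of_compact).subset fun i hi => ?_
    obtain ⟨x, hx⟩ := Function.ne_iff.1 hi
    exact ⟨x, hx⟩
  set s := hfin.toFinset with hs
  have hsum : ∀ x, ∑ i ∈ s, ρ i x = 1 := by
    intro x
    rw [← ρ.sum_eq_one (mem_univ x), finsum_eq_sum_of_support_subset]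
    intro i hi
    rw [hs, Finset.mem_coe, Finite.mem_toFinset]
    exact fun hc => hi (congrFun hc x)
  have hρC : ∀ i, IsC I 1 (ρ i) := fun i => isC_of_contMDiff (by norm_cast)
    ((ρ i).contMDiff.of_le (by norm_cast))
  have hψ : ∀ i, IsC I 1 (fun x => ρ i x * φ x) := fun i => (hρC i).mul hφ
  have hsrc : ∀ i, tsupport (fun x => ρ i x * φ x) ⊆ (extChartAt I i).source := by
    intro i
    rw [extChartAt_source]
    exact (tsupport_mul_subset_left).trans (hρ i)
  have key := fun i => green_chart m hI (hψ i) hw hw2 hk hkw i (hsrc i)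
    (hb.imp (fun h x hx => by rw [h x hx, mul_zero]) id)
  have hφc : Continuous φ := (hφ.of_le (by norm_num)).continuous
  have hInteg : ∀ {f : M → ℝ}, Continuous f → Integrable f (riemVolume I m) := fun hf =>
    hf.integrable_of_hasCompactSupport (HasCompactSupport.of_compactSpace _)
  have hInteg' : ∀ {f : M → ℝ}, Continuous f → Integrable f (boundaryArea I m) := fun hf =>
    hf.integrable_of_hasCompactSupport (HasCompactSupport.of_compactSpace _)
  have h1 : ∀ x, φ x * k x + gradInner m φ w x
      = ∑ i ∈ s, ((ρ i x * φ x) * k x + gradInner m (fun x => ρ i x * φ x) w x) := by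
    intro x
    rw [Finset.sum_add_distrib, ← gradInner_sum_left m s w fun i _ => (hψ i).isDiffAt x]
    simp only [← Finset.sum_mul, hsum, one_mul]
  have h2 : ∀ x, φ x * Real.sqrt (gradInner m w w x)
      = ∑ i ∈ s, (ρ i x * φ x) * Real.sqrt (gradInner m w w x) := by
    intro x
    simp only [← Finset.sum_mul, hsum, one_mul]
  simp only [h1, h2]
  rw [integral_finsetSum _ fun i _ => hInteg ?_, integral_finsetSum _ fun i _ => hInteg' ?_,
    ← Finset.sum_neg_distrib]
  · exact Finset.sum_congr rfl fun i _ => key i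
  · exact ((hψ i).of_le (by norm_num)).continuous.mul (continuous_gradInner m hw hw).sqrt
  · exact (((hψ i).of_le (by norm_num)).continuous.mul hk).add (continuous_gradInner m (hψ i) hw)

end Green

/-! ### Green's formula without boundary term -/

section GreenInterior

variable {d : ℕ} {H : Type*} [TopologicalSpace H]
  {I : ModelWithCorners ℝ (EuclideanSpace ℝ (Fin (d + 1))) H}
  {M : Type*} [TopologicalSpace M] [ChartedSpace H M] [IsManifold I ∞ M]
  (m : Bundle.ContMDiffRiemannianMetric I ∞ (EuclideanSpace ℝ (Fin (d + 1)))
    (fun x : M => TangentSpace I x))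
  (hI : range I = univ ∨ range I = {y : EuclideanSpace ℝ (Fin (d + 1)) | 0 ≤ y 0})
  {φ w k : M → ℝ}

theorem IsCInt.congr {l : WithTop ℕ∞} {f f' : M → ℝ} (h : IsCInt I l f)
    (hf : ∀ x ∈ I.interior M, f' x = f x) : IsCInt I l f' := fun p =>
  (h p).congr fun _ hy => hf _ ((symm_mem_interior_iff p (interior_subset hy)).2 hy)

theorem laplacian_const_zero (x : M) : laplacian I m (fun _ => (0 : ℝ)) x = 0 := by
  unfold laplacian laplaceCoord partialD
  simp

variable [MeasurableSpace M] [BorelSpace M] [T2Space M] [CompactSpace M]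

theorem integrable_riemVolume {f : M → ℝ} (hf : Continuous f) : Integrable f (riemVolume I m) :=
  have := isFiniteMeasure_riemVolume (I := I) m
  hf.integrable_of_hasCompactSupport (HasCompactSupport.of_compactSpace _)

include hI

theorem integrable_boundaryArea {f : M → ℝ} (hf : Continuous f) :
    Integrable f (boundaryArea I m) :=
  have := isFiniteMeasure_boundaryArea hI m
  hf.integrable_of_hasCompactSupport (HasCompactSupport.of_compactSpace _)

theorem ae_mem_boundary : ∀ᵐ x ∂(boundaryArea I m), x ∈ I.boundary M := by
  rw [ae_iff]
  have : {x | x ∉ I.boundary M} = I.interior M := by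
    rw [← I.compl_boundary]; rfl
  rw [this]
  exact boundaryArea_interior hI m

theorem ae_mem_interior : ∀ᵐ x ∂(riemVolume I m), x ∈ I.interior M := by
  rw [ae_iff]
  have : {x | x ∉ I.interior M} = I.boundary M := by
    rw [← I.compl_interior]; rfl
  rw [this]
  exact riemVolume_boundary hI m

/-- Green's formula for a test function that vanishes on the boundary. -/
theorem green_of_eq_zero (hφ : IsC I 1 φ) (hw : IsC I 1 w) (hw2 : IsCInt I 2 w)
    (hk : Continuous k) (hkw : ∀ x ∈ I.interior M, k x = laplacian I m w x)
    (hφ0 : ∀ x ∈ I.boundary M, φ x = 0) :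
    ∫ x, (φ x * k x + gradInner m φ w x) ∂(riemVolume I m) = 0 := by
  rw [green m hI hφ hw hw2 hk hkw (Or.inl hφ0), neg_eq_zero]
  refine integral_eq_zero_of_ae ?_
  filter_upwards [ae_mem_boundary m hI] with x hx
  rw [hφ0 x hx, zero_mul]; rfl

/-- Green's formula for a test function that vanishes near the boundary, against a function that is
regular in the interior only. -/
theorem green_interior (hφ : IsCInt I 1 φ) (hφ0 : ∀ x ∈ I.boundary M, φ =ᶠ[nhds x] 0)
    (hw : IsCInt I 2 w) :
    ∃ F : M → ℝ, Continuous F ∧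
      (∀ x ∈ I.interior M, F x = φ x * laplacian I m w x + gradInner m φ w x) ∧
      ∫ x, F x ∂(riemVolume I m) = 0 := by
  have hsupp : tsupport φ ⊆ I.interior M := by
    intro x hx
    by_contra hxi
    rw [← mem_compl_iff, I.compl_interior] at hxi
    exact (notMem_tsupport_iff_eventuallyEq.2 (hφ0 x hxi)) hx
  obtain ⟨U, hU, hsU, hUi⟩ := normal_exists_closure_subset (isClosed_tsupport φ)
    (isOpen_interiorM (I := I) (M := M)) hsupp
  have hLC : LocallyCompactSpace H := I.locallyCompactSpace
  -- `θ` equals one near the support of `φ` and vanishes off `U`, whose closure avoids the boundary.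
  -- Hence `θ w` is `C²` on all of `M` and agrees with `w` wherever `φ` can see it.
  obtain ⟨θ, hθ1, hθ0, -⟩ := exists_contMDiffMap_one_nhds_of_subset_interior I (n := ⊤)
    (isClosed_tsupport φ) (hsU.trans hU.interior_eq.ge)
  have hθC : IsC I 2 θ := isC_of_contMDiff (by norm_cast)
    (θ.contMDiff.of_le two_le_infty)
  have hbU : ∀ x ∈ I.boundary M, (closure U)ᶜ ∈ nhds x := fun x hx =>
    isClosed_closure.isOpen_compl.mem_nhds fun hc => by
      rw [← I.compl_interior] at hx
      exact hx (hUi hc)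
  have hw0 : ∀ x ∈ (closure U)ᶜ, (fun x => θ x * w x) =ᶠ[nhds x] fun _ => 0 := by
    intro x hx
    filter_upwards [isClosed_closure.isOpen_compl.mem_nhds hx] with z hz
    rw [hθ0 z fun hc => hz (subset_closure hc), zero_mul]
  have hw' : IsCInt I 2 (fun x => θ x * w x) := hθC.isCInt.mul hw
  have hwC : IsC I 2 (fun x => θ x * w x) := hw'.isC fun x hx =>
    hw0 x (mem_of_mem_nhds (hbU x hx))
  have hφC : IsC I 1 φ := hφ.isC hφ0
  classical
  -- The coordinate Laplacian need not be meaningful at boundary points. It is set to zero there,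
  -- which is consistent with `θ w` vanishing near the boundary and gives a continuous `k`.
  set k : M → ℝ := (I.interior M).indicator (laplacian I m fun x => θ x * w x) with hk
  have hkc : Continuous k := by
    refine IsC.continuous (I := I) (IsCInt.isC ?_ ?_)
    · exact (isCInt_laplacian m (k := 0) (by norm_cast) (by simpa using hw')).congr
        fun x hx => indicator_of_mem hx _
    · intro x hx
      filter_upwards [hbU x hx] with z hz
      by_cases hzi : z ∈ I.interior M
      · rw [hk, indicator_of_mem hzi, laplacian_congr m (hw0 z hz) hzi, laplacian_const_zero]; rfl
      · exact indicator_of_notMem hzi _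
  refine ⟨fun x => φ x * k x + gradInner m φ (fun x => θ x * w x) x, ?_, ?_, ?_⟩
  · exact ((hφC.of_le (by norm_num)).continuous.mul hkc).add
      (continuous_gradInner m hφC (hwC.of_le (by norm_num)))
  · intro x hx
    beta_reduce
    by_cases hxs : x ∈ tsupport φ
    · have h1 : (fun x => θ x * w x) =ᶠ[nhds x] w := by
        filter_upwards [hθ1.filter_mono (nhds_le_nhdsSet hxs)] with z hz
        rw [hz, one_mul]
      rw [hk, indicator_of_mem hx, laplacian_congr m h1 hx,
        gradInner_congr m (Filter.EventuallyEq.refl _ φ) h1]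
    · rw [image_eq_zero_of_notMem_tsupport hxs, gradInner_eq_zero_of_notMem_tsupport m _ hxs,
        gradInner_eq_zero_of_notMem_tsupport m _ hxs]
      ring
  · refine green_of_eq_zero m hI hφC (hwC.of_le (by norm_num)) hw' hkc
      (fun x hx => indicator_of_mem hx _) fun x hx => ?_
    exact (hφ0 x hx).self_of_nhds

end GreenInterior

/-! ### The zero set of a nonnegative function -/

section ZeroSet

variable {d : ℕ} {H : Type*} [TopologicalSpace H]
  {I : ModelWithCorners ℝ (EuclideanSpace ℝ (Fin (d + 1))) H}
  {M : Type*} [TopologicalSpace M] [ChartedSpace H M] [IsManifold I ∞ M]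
  (m : Bundle.ContMDiffRiemannianMetric I ∞ (EuclideanSpace ℝ (Fin (d + 1)))
    (fun x : M => TangentSpace I x))
  {u k : M → ℝ}

/-- An interior zero of a nonnegative function is a local minimum. -/
theorem partialD_eq_zero_of_eq_zero (hu : ∀ x, 0 ≤ u x) {p : M}
    {y : EuclideanSpace ℝ (Fin (d + 1))} (hy : y ∈ interior (extChartAt I p).target)
    (h0 : inChart I p u y = 0) (i : Fin (d + 1)) : partialD (range I) i (inChart I p u) y = 0 := by
  rw [partialD_eq_fderiv (range_mem_nhds hy)]
  have : IsLocalMin (inChart I p u) y := Filter.Eventually.of_forall fun z => by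
    rw [h0]; exact hu _
  rw [this.fderiv_eq_zero]; rfl

theorem gradInner_eq_zero_of_eq_zero (hu : ∀ x, 0 ≤ u x) (a : M → ℝ) {x : M}
    (hx : x ∈ I.interior M) (h0 : u x = 0) : gradInner m a u x = 0 := by
  rw [gradInner_comm]
  unfold gradInner gradInnerCoord
  refine Finset.sum_eq_zero fun i _ => ?_
  rw [partialD_eq_zero_of_eq_zero hu ((mem_interior_iff x (mem_extChartAt_source x)).1 hx)
    (by rw [inChart_apply x (mem_extChartAt_source x), h0]), zero_mul]

/-- In a chart, the Laplacian of a nonnegative function vanishes almost everywhere on its zero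
set. -/
theorem ae_laplaceCoord_eq_zero (hu : ∀ x, 0 ≤ u x) (hu2 : IsCInt I 2 u) (p : M) :
    ∀ᵐ y ∂(volume.restrict (interior (extChartAt I p).target ∩ inChart I p u ⁻¹' {0})),
      laplaceCoord (range I) (gram I m p) (inChart I p u) y = 0 := by
  set Z := interior (extChartAt I p).target ∩ inChart I p u ⁻¹' {0} with hZ
  have hmet := isMetricOn_interior m p
  have hsub := interior_target_subset (I := I) p
  have hZm : MeasurableSet Z :=
    measurableSet_inter_preimage isOpen_interior.measurableSet (hu2 p).continuousOn
      (measurableSet_singleton 0)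
  set N : EuclideanSpace ℝ (Fin (d + 1)) → EuclideanSpace ℝ (Fin (d + 1)) := fun y =>
    WithLp.toLp 2 fun i => gradCoord (range I) (gram I m p) (inChart I p u) i y with hN
  have hNd : ∀ y ∈ interior (extChartAt I p).target, DifferentiableAt ℝ N y := fun y hy => by
    rw [differentiableAt_euclidean]
    exact fun i => ((hmet.contDiffOn_gradCoord isOpen_interior hsub (k := 1) (hu2 p) (by norm_num)
      (by norm_cast) i).differentiableOn (by norm_num)).differentiableAt
        (isOpen_interior.mem_nhds hy)
  have hg0 : ∀ y ∈ Z, ∀ i, gradCoord (range I) (gram I m p) (inChart I p u) i y = 0 :=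
    fun y hy i => Finset.sum_eq_zero fun j _ => by
      rw [partialD_eq_zero_of_eq_zero hu hy.1 hy.2, mul_zero]
  have hN0 : ∀ y ∈ Z, N y = 0 := fun y hy => by
    ext i
    exact hg0 y hy i
  -- The gradient field `N` is identically zero on `Z`, so the zero map approximates it there with
  -- error constant `0`. Almost everywhere on `Z` the derivative of `N` must then equal that map,
  -- and with it the divergence of the gradient vanishes.
  have happ : ApproximatesLinearOn N (0 : EuclideanSpace ℝ (Fin (d + 1)) →L[ℝ] _) Z 0 := by
    intro y hy z hz
    simp [hN0 y hy, hN0 z hz]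
  have hae := happ.norm_fderiv_sub_le volume hZm (fun y => fderiv ℝ N y)
    fun y hy => (hNd y hy.1).hasFDerivAt.hasFDerivWithinAt
  filter_upwards [hae, ae_restrict_mem hZm] with y hy hyZ
  have h0 : fderiv ℝ N y = 0 := by
    have := nnnorm_eq_zero.1 (le_antisymm hy bot_le)
    rwa [sub_zero] at this
  rw [hmet.laplaceCoord_eq isOpen_interior hsub (hu2 p) hyZ.1]
  have h1 : ∀ i, partialD (range I) i (gradCoord (range I) (gram I m p) (inChart I p u) i) y
      = 0 := by
    intro i
    rw [partialD_eq_fderiv (range_mem_nhds hyZ.1)]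
    have h2 := ((EuclideanSpace.proj i : EuclideanSpace ℝ (Fin (d + 1)) →L[ℝ] ℝ).hasFDerivAt).comp
      y (hNd y hyZ.1).hasFDerivAt
    have h3 : HasFDerivAt (gradCoord (range I) (gram I m p) (inChart I p u) i) _ y := h2
    rw [h3.fderiv, h0]
    simp
  simp [h1, hg0 y hyZ]

/-- The Laplacian of a nonnegative function vanishes almost everywhere on its zero set. -/
theorem ae_eq_zero_of_eq_zero [MeasurableSpace M] [BorelSpace M] [CompactSpace M]
    (hu : ∀ x, 0 ≤ u x) (hu0 : Continuous u) (hu2 : IsCInt I 2 u) (hk : Continuous k)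
    (hku : ∀ x ∈ I.interior M, k x = laplacian I m u x) :
    ∀ᵐ x ∂(riemVolume I m), x ∈ I.interior M → u x = 0 → k x = 0 := by
  rw [ae_iff]
  obtain ⟨t, ht⟩ := isCompact_univ.elim_finite_subcover
    (fun p : M => (extChartAt I p).source) (fun p => isOpen_extChartAt_source p)
    (fun x _ => mem_iUnion.2 ⟨x, mem_extChartAt_source x⟩)
  set B : Set M := I.interior M ∩ (u ⁻¹' {0} ∩ k ⁻¹' {0}ᶜ) with hB
  have hBm : MeasurableSet B := (isOpen_interiorM (I := I) (M := M)).measurableSet.inter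
    ((hu0.measurable (measurableSet_singleton 0)).inter
      (hk.measurable (measurableSet_singleton 0).compl))
  have h1 : {x | ¬(x ∈ I.interior M → u x = 0 → k x = 0)}
      ⊆ ⋃ p ∈ t, (B ∩ (extChartAt I p).source) := by
    intro x hx
    obtain ⟨p, hp, hxp⟩ := mem_iUnion₂.1 (ht (mem_univ x))
    have hx' : ¬(x ∈ I.interior M → u x = 0 → k x = 0) := hx
    push Not at hx'
    exact mem_iUnion₂.2 ⟨p, hp, ⟨hx'.1, hx'.2.1, hx'.2.2⟩, hxp⟩
  refine measure_mono_null h1 ((measure_biUnion_null_iff t.countable_toSet).2 fun p _ => ?_)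
  have hm := hBm.inter (measurableSet_source (I := I) p)
  rw [riemVolume_apply m p hm inter_subset_right, chartVolume_apply m p hm]
  refine setLIntegral_measure_zero _ _ ?_
  have hae := ae_laplaceCoord_eq_zero m hu hu2 p
  have hZm : MeasurableSet (interior (extChartAt I p).target ∩ inChart I p u ⁻¹' {0}) :=
    measurableSet_inter_preimage isOpen_interior.measurableSet (hu2 p).continuousOn
      (measurableSet_singleton 0)
  rw [ae_restrict_iff' hZm, ae_iff] at hae
  refine measure_mono_null ?_ hae
  rintro y ⟨hy, ⟨hyi, hy0, hyk⟩, -⟩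
  have hyi' := (symm_mem_interior_iff p hy).1 hyi
  intro hc
  refine hyk ?_
  change k _ = 0
  rw [hku _ hyi, laplacian_eq m hu2 p ((extChartAt I p).map_target hy) hyi,
    (extChartAt I p).right_inv hy]
  exact hc ⟨hyi', hy0⟩

end ZeroSet

/-! ### Cutoff functions -/

section Cutoff

/-- A smooth monotone function, zero on `t ≤ ε` and one on `2 ε ≤ t`. -/
def cutoff (ε t : ℝ) : ℝ := Real.smoothTransition (t / ε - 1)

/-- The primitive of the cutoff. -/
def cutoffPrim (ε t : ℝ) : ℝ := ∫ s in (0 : ℝ)..t, cutoff ε s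

variable {ε t : ℝ}

theorem contDiff_cutoff (n : ℕ∞) (ε : ℝ) : ContDiff ℝ n (cutoff ε) :=
  Real.smoothTransition.contDiff.comp ((contDiff_id.div_const ε).sub contDiff_const)

theorem cutoff_nonneg (ε t : ℝ) : 0 ≤ cutoff ε t := Real.smoothTransition.nonneg _

theorem cutoff_le_one (ε t : ℝ) : cutoff ε t ≤ 1 := Real.smoothTransition.le_one _

theorem cutoff_eq_zero (hε : 0 < ε) (ht : t ≤ ε) : cutoff ε t = 0 := by
  refine Real.smoothTransition.zero_of_nonpos ?_
  have := (div_le_one hε).2 ht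
  linarith

theorem cutoff_eq_one (hε : 0 < ε) (ht : 2 * ε ≤ t) : cutoff ε t = 1 := by
  refine Real.smoothTransition.one_of_one_le ?_
  have := (le_div_iff₀ hε).2 ht
  linarith

theorem deriv_cutoff_nonneg (hε : 0 < ε) (t : ℝ) : 0 ≤ deriv (cutoff ε) t := by
  refine Monotone.deriv_nonneg fun s t hst => Real.smoothTransition.monotone ?_
  gcongr

theorem hasDerivAt_cutoff (ε t : ℝ) : HasDerivAt (cutoff ε) (deriv (cutoff ε) t) t :=
  ((contDiff_cutoff 1 ε).differentiable (by norm_num) t).hasDerivAt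

theorem hasDerivAt_cutoffPrim (ε t : ℝ) : HasDerivAt (cutoffPrim ε) (cutoff ε t) t :=
  (contDiff_cutoff 0 ε).continuous.integral_hasStrictDerivAt 0 t |>.hasDerivAt

theorem contDiff_one_of_hasDerivAt {F f : ℝ → ℝ} (h : ∀ t, HasDerivAt F (f t) t)
    (hf : Continuous f) : ContDiff ℝ 1 F := by
  rw [contDiff_one_iff_deriv]
  refine ⟨fun t => (h t).differentiableAt, ?_⟩
  rwa [show deriv F = f from funext fun t => (h t).deriv]

theorem contDiff_cutoffPrim (ε : ℝ) : ContDiff ℝ 1 (cutoffPrim ε) :=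
  contDiff_one_of_hasDerivAt (hasDerivAt_cutoffPrim ε) (contDiff_cutoff 0 ε).continuous

theorem cutoffPrim_eq_zero (hε : 0 < ε) (ht : t ≤ ε) : cutoffPrim ε t = 0 := by
  refine intervalIntegral.integral_zero_ae (Filter.Eventually.of_forall fun s hs => ?_)
  refine cutoff_eq_zero hε ?_
  rcases le_total 0 t with h | h
  · rw [uIoc_of_le h] at hs; exact hs.2.trans ht
  · rw [uIoc_of_ge h] at hs; exact hs.2.trans hε.le

theorem intervalIntegrable_cutoff (ε a b : ℝ) : IntervalIntegrable (cutoff ε) volume a b :=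
  (contDiff_cutoff 0 ε).continuous.intervalIntegrable a b

theorem cutoffPrim_nonneg (ε : ℝ) (ht : 0 ≤ t) : 0 ≤ cutoffPrim ε t :=
  intervalIntegral.integral_nonneg ht fun s _ => cutoff_nonneg ε s

theorem cutoffPrim_le (ε : ℝ) (ht : 0 ≤ t) : cutoffPrim ε t ≤ t := by
  have := intervalIntegral.integral_mono_on ht (intervalIntegrable_cutoff ε 0 t)
    intervalIntegrable_const fun s _ => cutoff_le_one ε s
  simpa [cutoffPrim] using this

/-- The cutoff is one beyond `2ε`, so its primitive lags behind `t` by at most `2ε`. With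
`cutoffPrim_le` this squeezes it to `t` as `ε → 0`. -/
theorem le_cutoffPrim (hε : 0 < ε) (ht : 0 ≤ t) : t - 2 * ε ≤ cutoffPrim ε t := by
  rcases le_total t (2 * ε) with h | h
  · exact (sub_nonpos.2 h).trans (cutoffPrim_nonneg ε ht)
  · have h1 : cutoffPrim ε t = cutoffPrim ε (2 * ε) + ∫ s in (2 * ε)..t, cutoff ε s :=
      (intervalIntegral.integral_add_adjacent_intervals (intervalIntegrable_cutoff ε _ _)
        (intervalIntegrable_cutoff ε _ _)).symm
    have h2 : ∫ s in (2 * ε)..t, cutoff ε s = t - 2 * ε := by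
      rw [intervalIntegral.integral_congr (g := fun _ => (1 : ℝ)) fun s hs => ?_]
      · simp
      · rw [uIcc_of_le h] at hs
        exact cutoff_eq_one hε hs.1
    rw [h1, h2]
    linarith [cutoffPrim_nonneg ε (t := 2 * ε) (by linarith)]

open Filter Topology in
theorem tendsto_cutoff (ht : 0 < t) :
    Tendsto (fun N : ℕ => cutoff (1 / ((N : ℝ) + 1)) t) atTop (𝓝 1) := by
  have h1 : Tendsto (fun N : ℕ => 2 * (1 / ((N : ℝ) + 1))) atTop (𝓝 0) := by
    simpa using (tendsto_one_div_add_atTop_nhds_zero_nat (𝕜 := ℝ)).const_mul 2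
  refine tendsto_const_nhds.congr' ?_
  filter_upwards [h1.eventually (gt_mem_nhds ht)] with N hN
  exact (cutoff_eq_one (by positivity) hN.le).symm

open Filter Topology in
theorem tendsto_cutoffPrim (ht : 0 ≤ t) :
    Tendsto (fun N : ℕ => cutoffPrim (1 / ((N : ℝ) + 1)) t) atTop (𝓝 t) := by
  have h1 : Tendsto (fun N : ℕ => t - 2 * (1 / ((N : ℝ) + 1))) atTop (𝓝 t) := by
    simpa using ((tendsto_one_div_add_atTop_nhds_zero_nat (𝕜 := ℝ)).const_mul 2).const_sub t
  exact tendsto_of_tendsto_of_tendsto_of_le_of_le h1 tendsto_const_nhds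
    (fun N => le_cutoffPrim (by positivity) ht) fun N => cutoffPrim_le _ ht

end Cutoff

/-! ### The integral inequality -/

section Main

variable {d : ℕ} {H : Type*} [TopologicalSpace H]
  {I : ModelWithCorners ℝ (EuclideanSpace ℝ (Fin (d + 1))) H}
  {M : Type*} [TopologicalSpace M] [ChartedSpace H M] [IsManifold I ∞ M]
  [T2Space M] [CompactSpace M] [MeasurableSpace M] [BorelSpace M]
  (m : Bundle.ContMDiffRiemannianMetric I ∞ (EuclideanSpace ℝ (Fin (d + 1)))
    (fun x : M => TangentSpace I x))
  (hI : range I = univ ∨ range I = {y : EuclideanSpace ℝ (Fin (d + 1)) | 0 ≤ y 0})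
  {u f : M → ℝ} (huC : IsC I 1 u) (huI : IsCInt I 3 u) (hun : ∀ x, 0 ≤ u x)
  (hu0 : ∀ x ∈ I.boundary M, u x = 0) (hf : Continuous f)
  (hfu : ∀ x ∈ I.interior M, - laplacian I m u x = f x)

include huC hu0 in
-- By continuity `u < ε` near the boundary. Any function of `u` that vanishes below `ε` thus
-- vanishes near `∂M`, where second derivatives of `u` are not controlled.
theorem eventually_comp_eq_zero {F : ℝ → ℝ} {ε : ℝ} (hε : 0 < ε) (hF : ∀ t ≤ ε, F t = 0) {x : M}
    (hx : x ∈ I.boundary M) : ∀ᶠ z in nhds x, F (u z) = 0 := by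
  have hc : Continuous u := (huC.of_le (by norm_num)).continuous
  have : ∀ᶠ z in nhds x, u z < ε := hc.continuousAt.eventually
    (gt_mem_nhds (by rw [hu0 x hx]; exact hε))
  filter_upwards [this] with z hz using hF _ hz.le

include hI huC huI hun hu0 hf hfu

/-- Bochner's inequality tested with a cutoff of `u`. -/
theorem integral_bochner_cutoff {c : ℝ}
    (hRic : ∀ (x : M) (v : TangentSpace I x), c * m.inner x v v ≤ ricci I m x v v)
    {ε : ℝ} (hε : 0 < ε) :
    ∫ x, ((1 / ((d + 1 : ℕ) : ℝ) - 1) * (cutoffPrim ε (u x) * f x ^ 2)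
      + 3 / 2 * (cutoff ε (u x) * f x * gradInner m u u x)
      + c * (cutoffPrim ε (u x) * gradInner m u u x)
      - 1 / 2 * (deriv (cutoff ε) (u x) * gradInner m u u x ^ 2)) ∂(riemVolume I m) ≤ 0 := by
  have huc : Continuous u := (huC.of_le (by norm_num)).continuous
  have hu1 : IsCInt I 1 u := huC.isCInt
  have hu2 : IsCInt I 2 u := huI.of_le (by norm_num)
  have hG2 : IsCInt I 2 (gradInner m u u) :=
    isCInt_gradInner m two_le_infty (by norm_num; exact huI) (by norm_num; exact huI)
  have hG1 : IsCInt I 1 (gradInner m u u) := hG2.of_le (by norm_num)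
  have hGc : Continuous (gradInner m u u) := continuous_gradInner m huC huC
  have hΔ : IsCInt I 1 (laplacian I m u) :=
    isCInt_laplacian m (k := 1) (by norm_cast) (by norm_num; exact huI)
  -- No derivative of the nonlinearity is needed: `f = -Δu` is `C¹` in the interior because `u` is
  -- `C³` there.
  have hf1 : IsCInt I 1 f := hΔ.neg.congr fun x hx => (hfu x hx).symm
  have hη : IsCInt I 1 (fun x => cutoffPrim ε (u x)) := hu1.comp (contDiff_cutoffPrim ε)
  have hχ : IsCInt I 1 (fun x => cutoff ε (u x)) := hu1.comp (contDiff_cutoff 1 ε)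
  have hη0 : ∀ x ∈ I.boundary M, ∀ᶠ z in nhds x, cutoffPrim ε (u z) = 0 := fun x hx =>
    eventually_comp_eq_zero huC hu0 hε (fun t ht => cutoffPrim_eq_zero hε ht) hx
  have hχ0 : ∀ x ∈ I.boundary M, ∀ᶠ z in nhds x, cutoff ε (u z) = 0 := fun x hx =>
    eventually_comp_eq_zero huC hu0 hε (fun t ht => cutoff_eq_zero hε ht) hx
  have hk : ∀ x ∈ I.interior M, - f x = laplacian I m u x := fun x hx => by
    rw [← hfu x hx, neg_neg]
  -- Three integrations by parts, with `P = |∇u|²`, `η = cutoffPrim ε` and `χ = η'`: `A` tests `P`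
  -- with `η(u)`, `B` tests `u` with `χ(u) P`, and `C` tests `u` with `η(u) f`. Only `A` needs the
  -- interior version.
  obtain ⟨A, hAc, hA, hA0⟩ := green_interior m hI hη hη0 hG2
  have hφB : IsC I 1 (fun x => cutoff ε (u x) * gradInner m u u x) := (hχ.mul hG1).isC
    fun x hx => (hχ0 x hx).mono fun z hz => by simp [hz]
  have hφC : IsC I 1 (fun x => cutoffPrim ε (u x) * f x) := (hη.mul hf1).isC
    fun x hx => (hη0 x hx).mono fun z hz => by simp [hz]
  have hB0 := green_of_eq_zero m hI (k := fun x => - f x) hφB huC hu2 hf.neg hk fun x hx => by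
    rw [(hχ0 x hx).self_of_nhds, zero_mul]
  have hC0 := green_of_eq_zero m hI (k := fun x => - f x) hφC huC hu2 hf.neg hk fun x hx => by
    rw [(hη0 x hx).self_of_nhds, zero_mul]
  set B : M → ℝ := fun x => cutoff ε (u x) * gradInner m u u x * -f x
    + gradInner m (fun x => cutoff ε (u x) * gradInner m u u x) u x with hB
  set C : M → ℝ := fun x => cutoffPrim ε (u x) * f x * -f x
    + gradInner m (fun x => cutoffPrim ε (u x) * f x) u x with hC
  have hηc : Continuous fun x => cutoffPrim ε (u x) := (contDiff_cutoffPrim ε).continuous.comp huc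
  have hχc : Continuous fun x => cutoff ε (u x) := (contDiff_cutoff 0 ε).continuous.comp huc
  have hχ'c : Continuous fun x => deriv (cutoff ε) (u x) :=
    ((contDiff_cutoff 1 ε).continuous_deriv (by norm_num)).comp huc
  have hBc : Continuous B := ((hχc.mul hGc).mul hf.neg).add (continuous_gradInner m hφB huC)
  have hCc : Continuous C := ((hηc.mul hf).mul hf.neg).add (continuous_gradInner m hφC huC)
  -- In this combination the terms `χ ⟨∇u, ∇P⟩` of `A` and `B` cancel, leaving `-η f² + 3/2 χ f P -
  -- ½ χ' P² + η (½ΔP + ⟨∇f, ∇u⟩)`. Bochner's inequality bounds the last bracket below by `f²/n + c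
  -- P`.
  have hR : ∫ x, (C x + 1 / 2 * A x - 1 / 2 * B x) ∂(riemVolume I m) = 0 := by
    have i1 := integrable_riemVolume m hCc
    have i2 := (integrable_riemVolume m hAc).const_mul (1 / 2)
    have i3 := (integrable_riemVolume m hBc).const_mul (1 / 2)
    have i4 : Integrable (fun x => C x + 1 / 2 * A x) (riemVolume I m) := i1.add i2
    rw [integral_sub i4 i3, integral_add i1 i2, integral_const_mul, integral_const_mul,
      hA0, hB0, hC0]
    norm_num
  rw [← hR]
  refine integral_mono_ae (integrable_riemVolume m (by fun_prop))
    (integrable_riemVolume m (by fun_prop)) ?_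
  filter_upwards [ae_mem_interior m hI] with x hx
  have hboch := bochner_inequality m (Nat.succ_pos d) (hRic x) huI hx
  have hdu := hu1.isDiffAt hx
  have hdη := hη.isDiffAt hx
  have hdχ := hχ.isDiffAt hx
  have hdG := hG1.isDiffAt hx
  have hdf := hf1.isDiffAt hx
  have e1 : gradInner m (laplacian I m u) u x = - gradInner m f u x := by
    have h1 : laplacian I m u =ᶠ[nhds x] fun z => (-1) * f z := by
      filter_upwards [isOpen_interiorM.mem_nhds hx] with z hz
      rw [← hk z hz]; ring
    rw [gradInner_congr m h1 (Filter.EventuallyEq.refl _ u),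
      gradInner_comp_left m u (F := fun t => (-1) * t) (F' := -1)
        (by simpa using (hasDerivAt_id (f x)).const_mul (-1)) hdf]
    ring
  have e2 : gradInner m (fun x => cutoffPrim ε (u x)) (gradInner m u u) x
      = cutoff ε (u x) * gradInner m u (gradInner m u u) x :=
    gradInner_comp_left m _ (hasDerivAt_cutoffPrim ε (u x)) hdu
  have e3 : gradInner m (fun x => cutoffPrim ε (u x)) u x = cutoff ε (u x) * gradInner m u u x :=
    gradInner_comp_left m _ (hasDerivAt_cutoffPrim ε (u x)) hdu
  have e4 : gradInner m (fun x => cutoff ε (u x)) u x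
      = deriv (cutoff ε) (u x) * gradInner m u u x :=
    gradInner_comp_left m _ (hasDerivAt_cutoff ε (u x)) hdu
  have hηn : 0 ≤ cutoffPrim ε (u x) := cutoffPrim_nonneg ε (hun x)
  rw [e1, ← hk x hx] at hboch
  have hmul := mul_le_mul_of_nonneg_left hboch hηn
  simp only [hB, hC]
  rw [hA x hx, e2, gradInner_mul_left m u hdχ hdG, gradInner_mul_left m u hdη hdf, e3, e4,
    gradInner_comm m u (gradInner m u u)]
  have e5 : cutoffPrim ε (u x) * ((-f x) ^ 2 / ((d + 1 : ℕ) : ℝ))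
      = 1 / ((d + 1 : ℕ) : ℝ) * (cutoffPrim ε (u x) * f x ^ 2) := by ring
  rw [mul_add, mul_add, e5] at hmul
  linarith

/-- The same inequality, after bounding the squared gradient by a regular function `ψ`. -/
theorem integral_bochner_majorant {c : ℝ}
    (hRic : ∀ (x : M) (v : TangentSpace I x), c * m.inner x v v ≤ ricci I m x v v)
    {ψ : M → ℝ} (hψ : IsC I 1 ψ) (hψG : ∀ x, gradInner m u u x ≤ ψ x)
    {ε : ℝ} (hε : 0 < ε) :
    ∫ x, ((1 / ((d + 1 : ℕ) : ℝ) - 1) * (cutoffPrim ε (u x) * f x ^ 2)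
      + 3 / 2 * (cutoff ε (u x) * f x * gradInner m u u x)
      + c * (cutoffPrim ε (u x) * gradInner m u u x)
      - 1 / 2 * (cutoff ε (u x) * (ψ x * f x - gradInner m ψ u x))) ∂(riemVolume I m) ≤ 0 := by
  have huc : Continuous u := (huC.of_le (by norm_num)).continuous
  have hu2 : IsCInt I 2 u := huI.of_le (by norm_num)
  have hψc : Continuous ψ := (hψ.of_le (by norm_num)).continuous
  have hGc : Continuous (gradInner m u u) := continuous_gradInner m huC huC
  have hGψ : Continuous (gradInner m ψ u) := continuous_gradInner m hψ huC
  have hk : ∀ x ∈ I.interior M, - f x = laplacian I m u x := fun x hx => by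
    rw [← hfu x hx, neg_neg]
  have hχ : IsC I 1 (fun x => cutoff ε (u x)) := huC.comp (contDiff_cutoff 1 ε)
  have hφ : IsC I 1 (fun x => cutoff ε (u x) * ψ x) := hχ.mul hψ
  have hD0 := green_of_eq_zero m hI (k := fun x => - f x) hφ huC hu2 hf.neg hk fun x hx => by
    rw [hu0 x hx, cutoff_eq_zero hε hε.le, zero_mul]
  have hηc : Continuous fun x => cutoffPrim ε (u x) := (contDiff_cutoffPrim ε).continuous.comp huc
  have hχc : Continuous fun x => cutoff ε (u x) := (contDiff_cutoff 0 ε).continuous.comp huc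
  have hχ'c : Continuous fun x => deriv (cutoff ε) (u x) :=
    ((contDiff_cutoff 1 ε).continuous_deriv (by norm_num)).comp huc
  set D : M → ℝ := fun x => cutoff ε (u x) * ψ x * -f x
    + gradInner m (fun x => cutoff ε (u x) * ψ x) u x with hD
  have hDc : Continuous D := ((hχc.mul hψc).mul hf.neg).add (continuous_gradInner m hφ huC)
  have h0 := integral_bochner_cutoff m hI huC huI hun hu0 hf hfu hRic hε
  have i1 : Integrable (fun x => (1 / ((d + 1 : ℕ) : ℝ) - 1) * (cutoffPrim ε (u x) * f x ^ 2)
      + 3 / 2 * (cutoff ε (u x) * f x * gradInner m u u x)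
      + c * (cutoffPrim ε (u x) * gradInner m u u x)
      - 1 / 2 * (deriv (cutoff ε) (u x) * gradInner m u u x ^ 2)) (riemVolume I m) :=
    integrable_riemVolume m (by fun_prop)
  have i2 : Integrable (fun x => 1 / 2 * D x) (riemVolume I m) :=
    integrable_riemVolume m (by fun_prop)
  have h1 := integral_add i1 i2
  rw [integral_const_mul, hD0, mul_zero, add_zero] at h1
  rw [← h1] at h0
  -- Adding half of the null integral of `D` replaces `-½ χ' P²` by `-½ χ (ψ f - ⟨∇ψ, ∇u⟩)` plus `½
  -- χ' P (ψ - P)`. The extra term is nonnegative since `χ` is monotone and `P ≤ ψ`, so it may be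
  -- dropped.
  refine le_trans (integral_mono (integrable_riemVolume m (by fun_prop)) (i1.add i2)
    fun x => ?_) h0
  have e4 : gradInner m (fun x => cutoff ε (u x)) u x
      = deriv (cutoff ε) (u x) * gradInner m u u x :=
    gradInner_comp_left m _ (hasDerivAt_cutoff ε (u x)) (huC.isDiffAt x)
  have e5 : D x = cutoff ε (u x) * ψ x * -f x + (cutoff ε (u x) * gradInner m ψ u x
      + ψ x * (deriv (cutoff ε) (u x) * gradInner m u u x)) := by
    rw [hD]
    beta_reduce
    rw [gradInner_mul_left m u (hχ.isDiffAt x) (hψ.isDiffAt x), e4]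
  have h2 : 0 ≤ deriv (cutoff ε) (u x) * gradInner m u u x * (ψ x - gradInner m u u x) :=
    mul_nonneg (mul_nonneg (deriv_cutoff_nonneg hε _) (gradInner_self_nonneg m u x))
      (sub_nonneg.2 (hψG x))
  simp only [Pi.add_apply, e5]
  nlinarith [h2]

end Main

/-! ### Removal of the cutoff, then of the majorant. -/

section Limit

variable {d : ℕ} {H : Type*} [TopologicalSpace H]
  {I : ModelWithCorners ℝ (EuclideanSpace ℝ (Fin (d + 1))) H}
  {M : Type*} [TopologicalSpace M] [ChartedSpace H M] [IsManifold I ∞ M]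
  [T2Space M] [CompactSpace M] [MeasurableSpace M] [BorelSpace M]
  (m : Bundle.ContMDiffRiemannianMetric I ∞ (EuclideanSpace ℝ (Fin (d + 1)))
    (fun x : M => TangentSpace I x))
  (hI : range I = univ ∨ range I = {y : EuclideanSpace ℝ (Fin (d + 1)) | 0 ≤ y 0})
  {u f : M → ℝ} (huC : IsC I 1 u) (huI : IsCInt I 3 u) (hun : ∀ x, 0 ≤ u x)
  (hu0 : ∀ x ∈ I.boundary M, u x = 0) (hf : Continuous f)
  (hfu : ∀ x ∈ I.interior M, - laplacian I m u x = f x)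

include hI huC huI hun hu0 hf hfu

/-- The cutoff can be removed. -/
theorem integral_majorant_le {c : ℝ}
    (hRic : ∀ (x : M) (v : TangentSpace I x), c * m.inner x v v ≤ ricci I m x v v)
    {ψ : M → ℝ} (hψ : IsC I 1 ψ) (hψG : ∀ x, gradInner m u u x ≤ ψ x) :
    ∫ x, ((1 / ((d + 1 : ℕ) : ℝ) - 1) * (u x * f x ^ 2)
      + 3 / 2 * (f x * gradInner m u u x) + c * (u x * gradInner m u u x)
      - 1 / 2 * (ψ x * f x - gradInner m ψ u x)) ∂(riemVolume I m) ≤ 0 := by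
  have huc : Continuous u := (huC.of_le (by norm_num)).continuous
  have hu2 : IsCInt I 2 u := huI.of_le (by norm_num)
  have hψc : Continuous ψ := (hψ.of_le (by norm_num)).continuous
  have hGc : Continuous (gradInner m u u) := continuous_gradInner m huC huC
  have hGψ : Continuous (gradInner m ψ u) := continuous_gradInner m hψ huC
  have hηc : ∀ ε, Continuous fun x => cutoffPrim ε (u x) := fun ε =>
    (contDiff_cutoffPrim ε).continuous.comp huc
  have hχc : ∀ ε, Continuous fun x => cutoff ε (u x) := fun ε =>
    (contDiff_cutoff 0 ε).continuous.comp huc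
  -- Domination uniform in `ε`: here `e` stands for `cutoffPrim ε (u x)`, which lies between `0` and
  -- `U = u x`, and `h` for the cutoff, which lies between `0` and `1`.
  have hbound : ∀ e c₁ c₂ c₃ a b h k q U : ℝ, 0 ≤ e → e ≤ U → 0 ≤ h → h ≤ 1 →
      ‖c₁ * (e * a) + c₂ * (h * b) + c₃ * (e * k) - 1 / 2 * (h * q)‖ ≤
        |c₁| * (U * |a|) + |c₂| * |b| + |c₃| * (U * |k|) + 1 / 2 * |q| := by
    intro e c₁ c₂ c₃ a b h k q U he heU hh hh1
    rw [Real.norm_eq_abs]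
    refine (abs_sub _ _).trans (add_le_add ((abs_add_three _ _ _).trans ?_) ?_)
    · simp only [abs_mul, abs_of_nonneg he, abs_of_nonneg hh]
      gcongr
      exact mul_le_of_le_one_left (abs_nonneg _) hh1
    · simp only [abs_mul, abs_of_nonneg hh, abs_of_pos (by norm_num : (0 : ℝ) < 1 / 2)]
      gcongr
      exact mul_le_of_le_one_left (abs_nonneg _) hh1
  refine le_of_tendsto' (x := Filter.atTop) ?_ fun N : ℕ =>
    integral_bochner_majorant m hI huC huI hun hu0 hf hfu hRic hψ hψG
      (ε := 1 / ((N : ℝ) + 1)) (by positivity)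
  refine tendsto_integral_of_dominated_convergence
    (fun x => |1 / ((d + 1 : ℕ) : ℝ) - 1| * (u x * |f x ^ 2|)
      + |3 / 2| * |f x * gradInner m u u x| + |c| * (u x * |gradInner m u u x|)
      + 1 / 2 * |ψ x * f x - gradInner m ψ u x|) (fun N => ?_)
    (integrable_riemVolume m (by fun_prop)) (fun N => Filter.Eventually.of_forall fun x => ?_) ?_
  · have h1 := hηc (1 / ((N : ℝ) + 1))
    have h2 := hχc (1 / ((N : ℝ) + 1))
    exact (integrable_riemVolume m (by fun_prop)).aestronglyMeasurable
  · rw [mul_assoc (cutoff _ _)]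
    exact hbound _ _ _ _ _ _ _ _ _ _ (cutoffPrim_nonneg _ (hun x)) (cutoffPrim_le _ (hun x))
      (cutoff_nonneg _ _) (cutoff_le_one _ _)
  · have hk : ∀ x ∈ I.interior M, - f x = laplacian I m u x := fun x hx => by
      rw [← hfu x hx, neg_neg]
    filter_upwards [ae_mem_interior m hI,
      ae_eq_zero_of_eq_zero m (k := fun x => - f x) hun huc hu2 hf.neg hk] with x hx hx0
    -- Where `u = 0` the cutoff is always zero, so the limit integrand must vanish too. Its gradient
    -- terms do, and the term `ψ f` requires `f = 0`, which holds almost everywhere on the zero set.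
    -- Where `u > 0` the cutoff tends to one.
    rcases (hun x).eq_or_lt with h0 | h0
    · have hfx : f x = 0 := neg_eq_zero.1 (hx0 hx h0.symm)
      simp only [hfx, ← h0, gradInner_eq_zero_of_eq_zero m hun _ hx h0.symm]
      simp
    · have h1 := tendsto_cutoffPrim h0.le
      have h2 := tendsto_cutoff h0
      have h3 := ((((h1.mul_const (f x ^ 2)).const_mul (1 / ((d + 1 : ℕ) : ℝ) - 1)).add
        (((h2.mul_const (f x)).mul_const (gradInner m u u x)).const_mul (3 / 2))).add
        ((h1.mul_const (gradInner m u u x)).const_mul c)).sub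
        ((h2.mul_const (ψ x * f x - gradInner m ψ u x)).const_mul (1 / 2))
      simpa only [one_mul] using h3

/-- The integral inequality, in terms of the length of the gradient on the boundary. -/
theorem integral_inequality {c : ℝ}
    (hRic : ∀ (x : M) (v : TangentSpace I x), c * m.inner x v v ≤ ricci I m x v v) :
    ∫ x, ((1 / ((d + 1 : ℕ) : ℝ) - 1) * (u x * f x ^ 2)
      + 3 / 2 * (f x * gradInner m u u x) + c * (u x * gradInner m u u x)) ∂(riemVolume I m)
      ≤ 1 / 2 * ∫ x, Real.sqrt (gradInner m u u x) ^ 3 ∂(boundaryArea I m) := by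
  have huc : Continuous u := (huC.of_le (by norm_num)).continuous
  have hu2 : IsCInt I 2 u := huI.of_le (by norm_num)
  have hGc : Continuous (gradInner m u u) := continuous_gradInner m huC huC
  have hLC : LocallyCompactSpace H := I.locallyCompactSpace
  have hk : ∀ x ∈ I.interior M, - f x = laplacian I m u x := fun x hx => by
    rw [← hfu x hx, neg_neg]
  set L := ∫ x, ((1 / ((d + 1 : ℕ) : ℝ) - 1) * (u x * f x ^ 2)
      + 3 / 2 * (f x * gradInner m u u x) + c * (u x * gradInner m u u x)) ∂(riemVolume I m) with hL
  set s := ∫ x, Real.sqrt (gradInner m u u x) ∂(boundaryArea I m) with hs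
  have hs0 : 0 ≤ s := integral_nonneg fun x => Real.sqrt_nonneg _
  have hsc : Continuous fun x => Real.sqrt (gradInner m u u x) := hGc.sqrt
  have key : ∀ δ > 0, L ≤ 1 / 2 * (∫ x, Real.sqrt (gradInner m u u x) ^ 3 ∂(boundaryArea I m))
      + 1 / 2 * (δ * s) := by
    intro δ hδ
    -- `P` is merely continuous up to the boundary, so a smooth `ψ` with `P ≤ ψ ≤ P + δ` is glued
    -- from local constants; the conditions are convex in the value of `ψ`.
    obtain ⟨ψ, hψ⟩ := exists_contMDiffMap_forall_mem_convex_of_local_const I (n := ⊤)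
      (t := fun x => Icc (gradInner m u u x) (gradInner m u u x + δ))
      (fun x => convex_Icc _ _) fun x => ⟨gradInner m u u x + δ / 2, by
        have h1 := hGc.continuousAt.eventually (Metric.ball_mem_nhds (gradInner m u u x)
          (half_pos hδ))
        filter_upwards [h1] with z hz
        have h2 := abs_lt.1 (Real.dist_eq _ _ ▸ Metric.mem_ball.1 hz)
        constructor <;> linarith [h2.1, h2.2]⟩
    have hψC : IsC I 1 ψ := isC_of_contMDiff (by norm_cast) (ψ.contMDiff.of_le (by norm_cast))
    have hψc : Continuous ψ := (hψC.of_le (by norm_num)).continuous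
    have hGψ : Continuous (gradInner m ψ u) := continuous_gradInner m hψC huC
    have h1 := integral_majorant_le m hI huC huI hun hu0 hf hfu hRic hψC fun x => (hψ x).1
    -- Here the test function does not vanish on the boundary: this is where the boundary integral
    -- `∫ ψ |∇u|` enters.
    have h2 := green m hI (k := fun x => - f x) hψC huC hu2 hf.neg hk (Or.inr ⟨hu0, hun⟩)
    have i1 : Integrable (fun x => (1 / ((d + 1 : ℕ) : ℝ) - 1) * (u x * f x ^ 2)
      + 3 / 2 * (f x * gradInner m u u x) + c * (u x * gradInner m u u x)) (riemVolume I m) :=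
      integrable_riemVolume m (by fun_prop)
    have i2 : Integrable (fun x => 1 / 2 * (ψ x * - f x + gradInner m ψ u x)) (riemVolume I m) :=
      integrable_riemVolume m (by fun_prop)
    have h3 := integral_add i1 i2
    rw [integral_const_mul, h2, ← hL] at h3
    have h4 : L - 1 / 2 * ∫ x, ψ x * Real.sqrt (gradInner m u u x) ∂(boundaryArea I m) ≤ 0 := by
      refine le_trans (le_of_eq ?_) h1
      rw [sub_eq_add_neg, ← mul_neg, ← h3]
      congr 1
      ext x
      ring
    have h5 : ∫ x, ψ x * Real.sqrt (gradInner m u u x) ∂(boundaryArea I m)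
        ≤ ∫ x, (Real.sqrt (gradInner m u u x) ^ 3 + δ * Real.sqrt (gradInner m u u x))
          ∂(boundaryArea I m) := by
      refine integral_mono (integrable_boundaryArea m hI (by fun_prop))
        (integrable_boundaryArea m hI (by fun_prop)) fun x => ?_
      have h6 : Real.sqrt (gradInner m u u x) ^ 3
          = gradInner m u u x * Real.sqrt (gradInner m u u x) := by
        rw [pow_succ, Real.sq_sqrt (gradInner_self_nonneg m u x)]
      beta_reduce
      rw [h6, ← add_mul]
      exact mul_le_mul_of_nonneg_right (hψ x).2 (Real.sqrt_nonneg _)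
    rw [integral_add (integrable_boundaryArea m hI (by fun_prop))
      (integrable_boundaryArea m hI (by fun_prop)), integral_const_mul] at h5
    linarith
  refine le_of_forall_pos_le_add fun ε hε => ?_
  -- The error `½ δ s` is made at most `ε`; the `+ 1` covers the case `s = 0`.
  have h := key (ε / (s + 1)) (by positivity)
  have h1 : ε / (s + 1) * s ≤ ε := by
    rw [div_mul_eq_mul_div, div_le_iff₀ (by positivity)]
    nlinarith
  linarith

end Limit

end RiemannianGeom

/-! ### The theorem: elimination of the gradient terms. -/

theorem theorem1p8
    {d : ℕ} {H : Type*} [TopologicalSpace H]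
    (I : ModelWithCorners ℝ (EuclideanSpace ℝ (Fin (d + 1))) H)
    (hI : range I = univ ∨ range I = {y : EuclideanSpace ℝ (Fin (d + 1)) | 0 ≤ y 0})
    {M : Type*} [TopologicalSpace M] [ChartedSpace H M] [IsManifold I ∞ M]
    [T2Space M] [CompactSpace M] [MeasurableSpace M] [BorelSpace M]
    (m : Bundle.ContMDiffRiemannianMetric I ∞ (EuclideanSpace ℝ (Fin (d + 1)))
      (fun x : M => TangentSpace I x))
    (κ : ℝ)
    (hRic : ∀ (x : M) (v : TangentSpace I x),
      (((d + 1 : ℕ) : ℝ) - 1) * κ * m.inner x v v ≤ RiemannianGeom.ricci I m x v v)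
    (g : ℝ → ℝ) (hg : Continuous g)
    (u : M → ℝ)
    (hu_int : ContMDiffOn I 𝓘(ℝ, ℝ) 3 u (I.interior M))
    (hu_bdry : ContMDiff I 𝓘(ℝ, ℝ) 1 u)
    (hu_nonneg : ∀ x, 0 ≤ u x)
    (hu_eq : ∀ x ∈ I.interior M, - RiemannianGeom.laplacian I m u x = g (u x))
    (hu_zero : ∀ x ∈ I.boundary M, u x = 0) :
    (∫ x, (RiemannianGeom.normalDeriv I m u x) ^ 3 ∂(RiemannianGeom.boundaryArea I m) ≤
      ∫ x, g (u x) *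
        (2 * (((d + 1 : ℕ) : ℝ) - 1) * u x * g (u x) / ((d + 1 : ℕ) : ℝ)
          - 3 * (∫ σ in (0 : ℝ)..(u x), g σ)
          - (((d + 1 : ℕ) : ℝ) - 1) * κ * (u x) ^ 2) ∂(RiemannianGeom.riemVolume I m)) ∧
    (I.boundary M = ∅ →
      0 ≤ ∫ x, g (u x) *
        (2 * (((d + 1 : ℕ) : ℝ) - 1) * u x * g (u x) / ((d + 1 : ℕ) : ℝ)
          - 3 * (∫ σ in (0 : ℝ)..(u x), g σ)
          - (((d + 1 : ℕ) : ℝ) - 1) * κ * (u x) ^ 2) ∂(RiemannianGeom.riemVolume I m)) := by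
  open RiemannianGeom in
  have huC : IsC I 1 u := isC_of_contMDiff (by norm_cast) hu_bdry
  have huI : IsCInt I 3 u := isCInt_of_contMDiffOn (by norm_cast) hu_int
  have huc : Continuous u := hu_bdry.continuous
  have hu2 : IsCInt I 2 u := huI.of_le (by norm_num)
  have hf : Continuous fun x => g (u x) := hg.comp huc
  have hk : ∀ x ∈ I.interior M, - g (u x) = laplacian I m u x := fun x hx => by
    rw [← hu_eq x hx, neg_neg]
  have hGc : Continuous (gradInner m u u) := continuous_gradInner m huC huC
  have hGd : ∀ t, HasDerivAt (fun t => ∫ σ in (0 : ℝ)..t, g σ) (g t) t := fun t =>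
    (hg.integral_hasStrictDerivAt 0 t).hasDerivAt
  have hGC : ContDiff ℝ 1 fun t => ∫ σ in (0 : ℝ)..t, g σ := contDiff_one_of_hasDerivAt hGd hg
  have hPc : Continuous fun x => ∫ σ in (0 : ℝ)..(u x), g σ := hGC.continuous.comp huc
  set c : ℝ := (((d + 1 : ℕ) : ℝ) - 1) * κ with hc
  have hmain := integral_inequality m hI huC huI hu_nonneg hu_zero hf hu_eq hRic
  -- test functions `u ^ 2` and `G (u)`
  have h1 := green_of_eq_zero m hI (k := fun x => - g (u x)) (huC.comp (F := fun t => t ^ 2)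
    (by fun_prop)) huC hu2 hf.neg hk fun x hx => by rw [hu_zero x hx]; norm_num
  have h2 := green_of_eq_zero m hI (k := fun x => - g (u x)) (huC.comp hGC) huC hu2 hf.neg hk
    fun x hx => by rw [hu_zero x hx]; simp
  have e1 : ∀ x, gradInner m (fun x => u x ^ 2) u x = 2 * u x * gradInner m u u x := fun x => by
    refine gradInner_comp_left m u (F := fun t => t ^ 2) ?_ (huC.isDiffAt x)
    simpa using hasDerivAt_pow 2 (u x)
  have e2 : ∀ x, gradInner m (fun x => ∫ σ in (0 : ℝ)..(u x), g σ) u x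
      = g (u x) * gradInner m u u x := fun x =>
    gradInner_comp_left m u (hGd (u x)) (huC.isDiffAt x)
  simp only [e1, e2] at h1 h2
  -- The boundary measure is carried by `∂M`, where `∂u/∂ν = -|∇u|`; the odd power keeps the sign.
  have hbd : ∫ x, (normalDeriv I m u x) ^ 3 ∂(boundaryArea I m)
      = - ∫ x, Real.sqrt (gradInner m u u x) ^ 3 ∂(boundaryArea I m) := by
    rw [← integral_neg]
    refine integral_congr_ae ?_
    filter_upwards [ae_mem_boundary m hI] with x hx
    rw [normalDeriv_eq m hI huC hu_zero hu_nonneg hx]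
    ring
  have hclaim : - ∫ x, Real.sqrt (gradInner m u u x) ^ 3 ∂(boundaryArea I m)
      ≤ ∫ x, g (u x) * (2 * (((d + 1 : ℕ) : ℝ) - 1) * u x * g (u x) / ((d + 1 : ℕ) : ℝ)
          - 3 * (∫ σ in (0 : ℝ)..(u x), g σ) - c * (u x) ^ 2) ∂(riemVolume I m) := by
    have i0 : Integrable (fun x => (1 / ((d + 1 : ℕ) : ℝ) - 1) * (u x * g (u x) ^ 2)
      + 3 / 2 * (g (u x) * gradInner m u u x) + c * (u x * gradInner m u u x)) (riemVolume I m) :=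
      integrable_riemVolume m (by fun_prop)
    have i1 : Integrable (fun x => u x ^ 2 * - g (u x) + 2 * u x * gradInner m u u x)
      (riemVolume I m) := integrable_riemVolume m (by fun_prop)
    have i2 : Integrable (fun x => (∫ σ in (0 : ℝ)..(u x), g σ) * - g (u x)
      + g (u x) * gradInner m u u x) (riemVolume I m) := integrable_riemVolume m (by fun_prop)
    -- The integrand is `-2` times that of `integral_inequality`, plus `c` times the identity tested
    -- with `u²`, plus `3` times the one tested with `G(u)`. The last two integrate to zero, and the
    -- factor `-2` reverses the inequality.
    have e3 : ∀ x, g (u x) * (2 * (((d + 1 : ℕ) : ℝ) - 1) * u x * g (u x) / ((d + 1 : ℕ) : ℝ)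
          - 3 * (∫ σ in (0 : ℝ)..(u x), g σ) - c * (u x) ^ 2)
        = -2 * ((1 / ((d + 1 : ℕ) : ℝ) - 1) * (u x * g (u x) ^ 2)
          + 3 / 2 * (g (u x) * gradInner m u u x) + c * (u x * gradInner m u u x))
        + (c * (u x ^ 2 * - g (u x) + 2 * u x * gradInner m u u x)
        + 3 * ((∫ σ in (0 : ℝ)..(u x), g σ) * - g (u x) + g (u x) * gradInner m u u x)) := by
      intro x
      have hn : (((d + 1 : ℕ) : ℝ)) ≠ 0 := by positivity
      field_simp
      ring
    simp only [e3]
    have i3 : Integrable (fun x => c * (u x ^ 2 * - g (u x) + 2 * u x * gradInner m u u x)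
        + 3 * ((∫ σ in (0 : ℝ)..(u x), g σ) * - g (u x) + g (u x) * gradInner m u u x))
        (riemVolume I m) := (i1.const_mul c).add (i2.const_mul 3)
    rw [integral_add (i0.const_mul _) i3,
      integral_add (i1.const_mul c) (i2.const_mul 3), integral_const_mul, integral_const_mul,
      integral_const_mul, h1, h2]
    linarith
  refine ⟨hbd ▸ hclaim, fun hempty => ?_⟩
  -- Without boundary the interior is all of `M`, and the boundary measure never charges the
  -- interior.
  have hzero : boundaryArea I m = 0 := by
    rw [← Measure.measure_univ_eq_zero, ← boundaryArea_interior hI m, ← I.compl_boundary, hempty,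
      compl_empty]
  rw [hzero] at hclaim
  simpa using hclaim
end
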